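/- Let $k\ge 2$ and $m\ge 2$. For $\kappa>0$ and $\theta\in\mathcal S^{k-1}=\{v\in\mathbb R^k:\|v\|=1\}$, the Fisher--von Mises--Langevin distribution $\mathrm{FvML}(\kappa,\theta)$ has density proportional to $x\mapsto e^{\kappa x'\theta}$ with respect to surface area on $\mathcal S^{k-1}$. Put $$A_k(\kappa)=\frac{\int_{-1}^1 t\,e^{\kappa t}(1-t^2)^{(k-3)/2}dt}{\int_{-1}^1 e^{\kappa t}(1-t^2)^{(k-3)/2}dt},\qquad D_k(\kappa)=1-\frac{k-1}{\kappa}A_k(\kappa)-A_k(\kappa)^2 .$$ For $\vartheta=(\kappa_1,\dots,\kappa_m,\theta_1,\dots,\theta_m)\in\Theta:=(0,\infty)^m\times(\mathcal S^{k-1})^m$ let $\mathrm P^{(n)}_\vartheta$ be the joint law of $m$ independent samples $X_{i1},\dots,X_{in_i}$ $(i=1,\dots,m)$ of i.i.d. $\mathrm{FvML}(\kappa_i,\theta_i)$ vectors, $n=\sum_i n_i$. Let $\mathcal H_0\subset\Theta$ be the set of parameters with $\kappa_1=\dots=\kappa_m$, and $\mathcal H_1=\Theta\setminus\mathcal H_0$.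 Assumption A: as $n\to\infty$, $r_i^{(n)}:=n_i/n\to r_i\neq0$ for every $i$. Let $\bar X_i=n_i^{-1}\sum_j X_{ij}$, $\hat\kappa=\sum_i r_i^{(n)}A_k^{-1}(\|\bar X_i\|)$, where $A_k^{-1}$ is the inverse of $A_k$ on $(0,\infty)$, and $\hat D_k=D_k(\hat\kappa)$. The spherical means $\bar X_i/\|\bar X_i\|$ are root-$n$ consistent for $\theta_i$ at every $\vartheta\in\Theta$. Let $\hat\theta_1,\dots,\hat\theta_m$ be any measurable estimators of $\theta_1,\dots,\theta_m$, with values in $\mathcal S^{k-1}$ with probability tending to one, that are root-$n$ consistent at every $\vartheta\in\mathcal H_0$ (that is, $n_i^{1/2}(\hat\theta_i-\theta_i)$ is bounded in $\mathrm P^{(n)}_\vartheta$-probability), and put $$Q^{(n)}_{\rm Hom}=\hat D_k^{-1}\Big(\sum_{i=1}^m n_i(\hat\theta_i'\bar X_i)^2-\frac1n\Big(\sum_{i=1}^m n_i\hat\theta_i'\bar X_i\Big)^2\Big).$$ A local perturbation at $\vartheta\in\mathcal H_0$ is a sequence $(c^{(n)},t^{(n)})\in\mathbb R^m\times(\mathbb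 R^k)^m$ with $c^{(n)}\to c$, $t^{(n)}$ bounded, such that the parameter $\vartheta^{(n)}$ with components $\kappa_i+n^{-1/2}(r_i^{(n)})^{-1/2}c_i^{(n)}$ and $\theta_i+n^{-1/2}(r_i^{(n)})^{-1/2}t_i^{(n)}$ is in $\Theta$ for all large $n$. Under Assumption A: (i) $Q^{(n)}_{\rm Hom}$ converges in distribution to $\chi^2_{m-1}$ under $\mathrm P^{(n)}_\vartheta$, for every $\vartheta\in\mathcal H_0$. (ii) For every $\vartheta\in\mathcal H_0$, with common concentration $\kappa$, and every local perturbation at $\vartheta$, $Q^{(n)}_{\rm Hom}$ converges in distribution, under $\mathrm P^{(n)}_{\vartheta^{(n)}}$, to the non-central $\chi^2_{m-1}$ distribution with non-centrality parameter $$D_k(\kappa)\Big[\sum_{i=1}^m c_i^2-\Big(\sum_{i=1}^m\sqrt{r_i}\,c_i\Big)^2\Big].$$ (iii) Let $0<\alpha<1$ and let $\phi^{(n)}_{\rm Hom}$ be the test that rejects when $Q^{(n)}_{\rm Hom}$ exceeds the $\alpha$-upper quantile of $\chi^2_{m-1}$. Then $\mathrm E_{\mathrm P^{(n)}_\vartheta}[\phi^{(n)}_{\rm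 Hom}]\to\alpha$ for every $\vartheta\in\mathcal H_0$, and $\phi_{\rm Hom}$ is locally and asymptotically most stringent, both at each single $\vartheta\in\mathcal H_0$ and over all of $\mathcal H_0$, in the following sense. For $B\subseteq\mathcal H_0$, let $\mathcal C_\alpha(B)$ be the class of sequences $\psi=(\psi^{(n)})$ of (randomized) tests with $\limsup_n\mathrm E_{\mathrm P^{(n)}_{\vartheta^{(n)}}}[\psi^{(n)}]\le\alpha$ along every local perturbation of every $\vartheta\in B$ with $\vartheta^{(n)}\in\mathcal H_0$ for all large $n$, and let $\mathcal A(B)$ be the set of all sequences $a=(\vartheta^{(n)})$ obtained from local perturbations of points of $B$ with $\vartheta^{(n)}\in\mathcal H_1$ for all large $n$. With the asymptotic regret $$R_{\phi}(a)=\sup_{\psi\in\mathcal C_\alpha(B)}\ \limsup_{n}\big(\mathrm E_{\mathrm P^{(n)}_{\vartheta^{(n)}}}[\psi^{(n)}]-\mathrm E_{\mathrm P^{(n)}_{\vartheta^{(n)}}}[\phi^{(n)}]\big),$$ one has, for every $B\subseteq\mathcal H_0$, $\phi_{\rm Hom}\in\mathcal C_\alpha(B)$ and $$\sup_{a\in\mathcal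 A(B)}R_{\phi_{\rm Hom}}(a)\le\sup_{a\in\mathcal A(B)}R_{\psi}(a)\qquad\text{for all }\psi\in\mathcal C_\alpha(B).$$ -/

import Mathlib

open MeasureTheory ProbabilityTheory Filter Set
open scoped Topology

noncomputable section

namespace FvML

/-! ### The Fisher-von Mises-Langevin distribution -/

/-- Euclidean space `ℝ^k`. -/
abbrev Vec (k : ℕ) : Type := EuclideanSpace ℝ (Fin k)

/-- The unit sphere `S^(k-1)` of `ℝ^k`. -/
abbrev Sph (k : ℕ) : Type := Metric.sphere (0 : EuclideanSpace ℝ (Fin k)) 1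

/-- The FvML distribution with concentration `κ` and location `θ`: the probability measure on the
sphere whose density with respect to surface area is proportional to `x ↦ exp (κ x'θ)`. -/
def fvml (k : ℕ) (κ : ℝ) (θ : Vec k) : Measure (Sph k) :=
  (volume : Measure (Vec k)).toSphere.tilted fun x => κ * inner ℝ (x : Vec k) θ

instance instProbFvml (k : ℕ) [NeZero k] (κ : ℝ) (θ : Vec k) :
    IsProbabilityMeasure (fvml k κ θ) := by
  have h0 : NeZero (volume : Measure (Vec k)).toSphere := ⟨Measure.toSphere_ne_zero _⟩
  refine isProbabilityMeasure_tilted ?_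
  have hc : Continuous fun x : Sph k => Real.exp (κ * inner ℝ (x : Vec k) θ) := by fun_prop
  exact hc.integrable_of_hasCompactSupport (HasCompactSupport.of_compactSpace _)

/-- `A_k(κ)`, the mean of the density on `[-1,1]` proportional to
`t ↦ exp (κ t) (1 - t²)^((k-3)/2)`. -/
def A (k : ℕ) (κ : ℝ) : ℝ :=
  (∫ t in (-1 : ℝ)..1, t * Real.exp (κ * t) * (1 - t ^ 2) ^ (((k : ℝ) - 3) / 2)) /
    ∫ t in (-1 : ℝ)..1, Real.exp (κ * t) * (1 - t ^ 2) ^ (((k : ℝ) - 3) / 2)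

/-- `D_k = 1 - ((k-1)/κ) A_k(κ) - A_k(κ)²`. -/
def D (k : ℕ) (κ : ℝ) : ℝ := 1 - ((k : ℝ) - 1) / κ * A k κ - A k κ ^ 2

/-! ### The multi-sample model -/

/-- The parameter `(κ₁, …, κ_m, θ₁, …, θ_m)`. -/
structure Param (m k : ℕ) where
  conc : Fin m → ℝ
  loc : Fin m → Vec k

/-- The parameter space `(0,∞)^m × (S^(k-1))^m`. -/
def paramSpace (m k : ℕ) : Set (Param m k) :=
  {ϑ | ∀ i, 0 < ϑ.conc i ∧ ‖ϑ.loc i‖ = 1}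

/-- The null hypothesis: all concentrations are equal. -/
def nullHyp (m k : ℕ) : Set (Param m k) :=
  {ϑ | ϑ ∈ paramSpace m k ∧ ∀ i i', ϑ.conc i = ϑ.conc i'}

/-- The alternative hypothesis: at least two concentrations differ. -/
def altHyp (m k : ℕ) : Set (Param m k) :=
  {ϑ | ϑ ∈ paramSpace m k ∧ ∃ i i', ϑ.conc i ≠ ϑ.conc i'}

/-- The data: `m` samples, the `i`-th one of size `N i`. -/
abbrev Sample (m k : ℕ) (N : Fin m → ℕ) : Type := (i : Fin m) → Fin (N i) → Sph k

/-- The joint law of `m` independent samples of i.i.d. FvML observations. -/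
def law {m k : ℕ} (N : Fin m → ℕ) (ϑ : Param m k) : Measure (Sample m k N) :=
  Measure.pi fun i => Measure.pi fun _ => fvml k (ϑ.conc i) (ϑ.loc i)

instance instProbLaw {m k : ℕ} [NeZero k] (N : Fin m → ℕ) (ϑ : Param m k) :
    IsProbabilityMeasure (law N ϑ) := by
  unfold law
  infer_instance

/-- The total sample size `n = ∑ n_i`. -/
def total {m : ℕ} (N : Fin m → ℕ) : ℕ := ∑ i, N i

/-- The ratio `n_i / n`. -/
def ratio {m : ℕ} (N : Fin m → ℕ) (i : Fin m) : ℝ := (N i : ℝ) / (total N : ℝ)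

/-- Along the sequence of designs `N j`, the total sample size tends to infinity and the ratios
`n_i / n` converge to nonzero constants `r i`. -/
structure AssumptionA {m : ℕ} (N : ℕ → Fin m → ℕ) (r : Fin m → ℝ) : Prop where
  total_tendsto : Tendsto (fun j => total (N j)) atTop atTop
  ratio_tendsto : ∀ i, Tendsto (fun j => ratio (N j) i) atTop (𝓝 (r i))
  ne_zero : ∀ i, r i ≠ 0

/-! ### The score statistic -/

/-- The `i`-th sample mean `X̄_i`. -/
def sampleMean {m k : ℕ} {N : Fin m → ℕ} (x : Sample m k N) (i : Fin m) : Vec k :=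
  (N i : ℝ)⁻¹ • ∑ j, (x i j : Vec k)

/-- The `i`-th spherical mean `X̄_i / ‖X̄_i‖`. -/
def sphericalMean {m k : ℕ} {N : Fin m → ℕ} (x : Sample m k N) (i : Fin m) : Vec k :=
  ‖sampleMean x i‖⁻¹ • sampleMean x i

/-- The estimator `A_k⁻¹(‖X̄_i‖)` of the `i`-th concentration, where `A_k⁻¹` is the inverse of `A_k`
on `(0,∞)`. -/
def concHat {m k : ℕ} {N : Fin m → ℕ} (x : Sample m k N) (i : Fin m) : ℝ :=
  Function.invFunOn (A k) (Ioi 0) ‖sampleMean x i‖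

/-- The estimator `∑ (n_i / n) A_k⁻¹(‖X̄_i‖)` of the common concentration. -/
def pooledConc {m k : ℕ} {N : Fin m → ℕ} (x : Sample m k N) : ℝ :=
  ∑ i, ratio N i * concHat x i

/-- The statistic `Q_Hom` with estimated locations `θ i` and estimated concentration. -/
def QHom {m k : ℕ} {N : Fin m → ℕ} (θ : Fin m → Vec k) (x : Sample m k N) : ℝ :=
  (D k (pooledConc x))⁻¹ *
    (∑ i, (N i : ℝ) * inner ℝ (θ i) (sampleMean x i) ^ 2
      - 1 / (total N : ℝ) * (∑ i, (N i : ℝ) * inner ℝ (θ i) (sampleMean x i)) ^ 2)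

/-- The estimators `θhat j` of the locations are root-`n` consistent at `ϑ`: they are measurable,
lie on the sphere with probability tending to one, and `√n_i (θhat_i - θ_i)` is bounded in
probability. -/
structure RootNConsistent {m k : ℕ} (N : ℕ → Fin m → ℕ)
    (θhat : (j : ℕ) → Sample m k (N j) → Fin m → Vec k) (ϑ : Param m k) : Prop where
  measurable : ∀ j i, Measurable fun x => θhat j x i
  unit : Tendsto (fun j => law (N j) ϑ {x | ∀ i, ‖θhat j x i‖ = 1}) atTop (𝓝 1)
  tight : ∀ i, ∀ ε : ℝ, 0 < ε → ∃ M : ℝ, ∀ᶠ j in atTop,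
    law (N j) ϑ {x | M < √(N j i : ℝ) * ‖θhat j x i - ϑ.loc i‖} ≤ ENNReal.ofReal ε

/-! ### Chi-square distributions -/

/-- The non-central chi-square distribution with `ν` degrees of freedom and non-centrality
parameter `δ`: the law of `∑ Z_i²` for independent unit-variance Gaussian variables `Z_i`, the first
of mean `√δ` and the others centred. -/
def noncentralChiSq (ν : ℕ) (δ : ℝ) : Measure ℝ :=
  (Measure.pi fun i : Fin ν => gaussianReal (if i.val = 0 then √δ else 0) 1).map
    fun z => ∑ i, z i ^ 2

instance instProbNoncentralChiSq (ν : ℕ) (δ : ℝ) : IsProbabilityMeasure (noncentralChiSq ν δ) :=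
  Measure.isProbabilityMeasure_map (Measurable.aemeasurable (by fun_prop))

/-- The (central) chi-square distribution with `ν` degrees of freedom. -/
abbrev chiSq (ν : ℕ) : Measure ℝ := noncentralChiSq ν 0

/-- The `α`-upper quantile of the chi-square distribution with `ν` degrees of freedom. -/
def chiSqUpperQuantile (ν : ℕ) (α : ℝ) : ℝ :=
  sInf {q : ℝ | chiSq ν (Ioi q) ≤ ENNReal.ofReal α}

/-! ### Local perturbations -/

/-- The perturbed parameter `ϑ + n^(-1/2) ν^(n) (c, t)`. -/
def perturb {m k : ℕ} (N : Fin m → ℕ) (ϑ : Param m k) (c : Fin m → ℝ) (t : Fin m → Vec k) :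
    Param m k where
  conc i := ϑ.conc i + ((√(total N : ℝ))⁻¹ * (√(ratio N i))⁻¹) * c i
  loc i := ϑ.loc i + ((√(total N : ℝ))⁻¹ * (√(ratio N i))⁻¹) • t i

/-- The perturbations `(c j, t j)` are admissible at `ϑ`: `c j` converges to `c'`, `t j` is bounded,
and the perturbed parameter remains in the parameter space for all large `j`. -/
structure IsLocalPerturbation {m k : ℕ} (N : ℕ → Fin m → ℕ) (ϑ : Param m k)
    (c : ℕ → Fin m → ℝ) (t : ℕ → Fin m → Vec k) (c' : Fin m → ℝ) : Prop where
  tendsto : Tendsto c atTop (𝓝 c')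
  bounded : ∃ M : ℝ, ∀ j i, ‖t j i‖ ≤ M
  mem : ∀ᶠ j in atTop, perturb (N j) ϑ (c j) (t j) ∈ paramSpace m k

/-! ### Sequences of tests and stringency -/

/-- A sequence of (possibly randomized) tests. -/
abbrev TestSeq (m k : ℕ) (N : ℕ → Fin m → ℕ) : Type := (j : ℕ) → Sample m k (N j) → ℝ

/-- The probability of rejection `E_ϑ[φ]`. -/
def power {m k : ℕ} {N : ℕ → Fin m → ℕ} (φ : TestSeq m k N) (j : ℕ) (ϑ : Param m k) : ℝ :=
  ∫ x, φ j x ∂law (N j) ϑ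

/-- The class of sequences of tests that have asymptotic level `α` along every sequence of local
perturbations, of a point of `B`, which satisfy the null hypothesis. -/
def levelClass {m k : ℕ} (N : ℕ → Fin m → ℕ) (B : Set (Param m k)) (α : ℝ) :
    Set (TestSeq m k N) :=
  {φ | (∀ j, Measurable (φ j)) ∧ (∀ j x, φ j x ∈ Icc (0 : ℝ) 1) ∧
    ∀ ϑ ∈ B, ∀ c t c', IsLocalPerturbation N ϑ c t c' →
      (∀ᶠ j in atTop, perturb (N j) ϑ (c j) (t j) ∈ nullHyp m k) →
      limsup (fun j => (power φ j (perturb (N j) ϑ (c j) (t j)) : EReal)) atTop ≤ (α : EReal)}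

/-- A sequence of local alternatives, given by its base point and its perturbations. -/
structure LocalSeq (m k : ℕ) where
  base : Param m k
  c : ℕ → Fin m → ℝ
  t : ℕ → Fin m → Vec k

/-- The parameter at stage `j` of a local sequence. -/
def LocalSeq.param {m k : ℕ} (N : ℕ → Fin m → ℕ) (a : LocalSeq m k) (j : ℕ) : Param m k :=
  perturb (N j) a.base (a.c j) (a.t j)

/-- All sequences of local alternatives with base point in `B`. -/
def localAlternatives {m k : ℕ} (N : ℕ → Fin m → ℕ) (B : Set (Param m k)) :
    Set (LocalSeq m k) :=
  {a | a.base ∈ B ∧ (∃ c', IsLocalPerturbation N a.base a.c a.t c') ∧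
    ∀ᶠ j in atTop, a.param N j ∈ altHyp m k}

/-- The asymptotic regret of `φ` along the local alternatives `a`: the largest asymptotic excess of
power, along `a`, of a sequence of tests of the level class over `φ`. -/
def regret {m k : ℕ} (N : ℕ → Fin m → ℕ) (B : Set (Param m k)) (α : ℝ) (φ : TestSeq m k N)
    (a : LocalSeq m k) : EReal :=
  ⨆ ψ ∈ levelClass N B α,
    limsup (fun j => ((power ψ j (a.param N j) - power φ j (a.param N j) : ℝ) : EReal)) atTop

/-- `φ` is locally and asymptotically most stringent, at asymptotic level `α`, at the points of `B`:
it belongs to the level class and minimizes, in this class, the maximal asymptotic regret against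
local alternatives. -/
def IsMostStringent {m k : ℕ} (N : ℕ → Fin m → ℕ) (B : Set (Param m k)) (α : ℝ)
    (φ : TestSeq m k N) : Prop :=
  φ ∈ levelClass N B α ∧
    ∀ ψ ∈ levelClass N B α,
      ⨆ a ∈ localAlternatives N B, regret N B α φ a
        ≤ ⨆ a ∈ localAlternatives N B, regret N B α ψ a

/-- The sequence of tests that reject when `Q_Hom` exceeds the `α`-upper quantile of the chi-square
distribution with `m - 1` degrees of freedom. -/
def testHom {m k : ℕ} {N : ℕ → Fin m → ℕ} (θhat : (j : ℕ) → Sample m k (N j) → Fin m → Vec k)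
    (α : ℝ) : TestSeq m k N :=
  fun j => indicator {x | chiSqUpperQuantile (m - 1) α < QHom (θhat j x) x} 1

end FvML

end

/-! The model is an exponential family with natural parameters `κ_i θ_i`. With the locations held
fixed, moving the concentrations from `κ` to `κ + n_i^(-1/2) c_i` multiplies the likelihood by
exactly `exp (c'z)` over a constant, where `z_i = √n_i (θ_i'X̄_i - A_k(κ))` (`law_shiftConc`). The
law of `x'θ` does not depend on `θ` (`fvml_map_inner`), so taking the perturbed locations as base
point costs nothing and no expansion in the locations is needed. As `D_k` is the variance of `x'θ`
(`D_eq_variance`, an integration by parts), characteristic functions show that `z` tends to `N(D_k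
c, D_k I)` under the shifted law (`tendstoInDistribution_zstat`).

The statistic uses estimated locations instead. Two unit vectors at distance `O(n^(-1/2))` differ,
along either of them, only by `O(1/n)`, so `z` changes by `o(1)` in probability
(`inProb_wstat_sub`). This is proved at the unperturbed parameter and transferred to local
perturbations by a bound on the second moment of the likelihood ratio (`measureReal_law_le`). Up to
the factor `1/D̂_k`, `Q_Hom` is the squared norm of the part of this vector orthogonal to the unit
vector with entries `√(n_i/n)` (`QHom_eq`); hence the non-central chi-square limits.

For stringency, let `s` have entries `√r_i`: perturbations along the null hypothesis have limits
proportional to `s`. Put `δ = D_k ‖p‖²`, where `p` is the part of `c` orthogonal to `s`. By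
Neyman–Pearson against the null point `c - p`, no test of the class has asymptotic power above `E(δ)
= P(N(√δ, 1) > z_α)` (`eventually_power_le_envelope`), and for a fixed direction a one-sided linear
test, itself in the class, reaches this value (`tendsto_power_testLin`). The chi-square test has
power `β(δ)`, so its regret is at most `E(δ) - β(δ)`.

Conversely, the mixture likelihood ratio for the uniform prior on the sphere `D_k ‖c‖² = δ`
orthogonal to `s` increases with the norm of the projection of `z` (`sphTransform_mono`), so the
chi-square test maximizes average limiting power there. Every competitor therefore has, at some `c`
of that sphere and infinitely often, power at most `β(δ) + ε` (`exists_frequently_power_le`), and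
the linear test in that direction shows that its regret is at least `E(δ) - β(δ) - 2ε`. The
comparison takes place at one base point and one value of `δ`, so it holds for every `B`
(`regret_testHom_le`). -/

noncomputable section

namespace FvML

/-! ### Polar coordinates and the uniform measure on the sphere -/

open scoped ENNReal in
lemma lintegral_polar {E : Type*} [NormedAddCommGroup E] [InnerProductSpace ℝ E]
    [FiniteDimensional ℝ E] [MeasurableSpace E] [BorelSpace E] [Nontrivial E]
    {F : E → ℝ≥0∞} (hF : Measurable F) :
    ∫⁻ x, F x = ∫⁻ ω : Metric.sphere (0 : E) 1, (∫⁻ r in Ioi (0 : ℝ),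
      ENNReal.ofReal (r ^ (Module.finrank ℝ E - 1)) * F (r • (ω : E)))
        ∂(volume : Measure E).toSphere := by
  have h1 : ∫⁻ x, F x = ∫⁻ x : ({(0)}ᶜ : Set E), F x.1 ∂((volume : Measure E).comap (↑)) := by
    rw [lintegral_subtype_comap (measurableSet_singleton _).compl, restrict_compl_singleton]
  have h2 := (volume : Measure E).measurePreserving_homeomorphUnitSphereProd.lintegral_comp_emb
    (Homeomorph.measurableEmbedding _) (fun p => F ((p.2 : ℝ) • (p.1 : E)))
  have h3 : ∀ x : ({(0)}ᶜ : Set E),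
      (((homeomorphUnitSphereProd E x).2 : ℝ) • ((homeomorphUnitSphereProd E x).1 : E)) = x := by
    intro x
    have hx : ‖(x : E)‖ ≠ 0 := norm_ne_zero_iff.mpr x.2
    simp [smul_smul, hx]
  simp_rw [h3] at h2
  rw [h1, h2, lintegral_prod _ (by fun_prop)]
  refine lintegral_congr fun ω => ?_
  rw [Measure.volumeIoiPow, lintegral_withDensity_eq_lintegral_mul _ (by fun_prop) (by fun_prop)]
  rw [← lintegral_subtype_comap measurableSet_Ioi]
  rfl

/-- The action of a linear isometry on the sphere. -/
def sphMap {k : ℕ} (U : Vec k ≃ₗᵢ[ℝ] Vec k) (x : Sph k) : Sph k :=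
  ⟨U x, by simp⟩

@[simp] lemma coe_sphMap {k : ℕ} (U : Vec k ≃ₗᵢ[ℝ] Vec k) (x : Sph k) :
    ((sphMap U x : Sph k) : Vec k) = U x := rfl

lemma measurable_sphMap {k : ℕ} (U : Vec k ≃ₗᵢ[ℝ] Vec k) : Measurable (sphMap U) :=
  Measurable.subtype_mk (by fun_prop)

-- The surface measure of `s` is a multiple of the volume of the cone over `s`; a linear isometry
-- carries cones to cones and preserves volume.
open scoped Pointwise in
lemma measurePreserving_sphMap {k : ℕ} (U : Vec k ≃ₗᵢ[ℝ] Vec k) :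
    MeasurePreserving (sphMap U) (volume : Measure (Vec k)).toSphere
      (volume : Measure (Vec k)).toSphere := by
  refine ⟨measurable_sphMap U, ?_⟩
  ext s hs
  rw [Measure.map_apply (measurable_sphMap U) hs, Measure.toSphere_apply' _ hs,
    Measure.toSphere_apply' _ (measurable_sphMap U hs)]
  congr 1
  have h : Ioo (0 : ℝ) 1 • ((↑) '' (sphMap U ⁻¹' s) : Set (Vec k)) =
      U ⁻¹' (Ioo (0 : ℝ) 1 • ((↑) '' s)) := by
    ext y
    simp only [Set.mem_smul, mem_image, mem_preimage]
    constructor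
    · rintro ⟨r, hr, _, ⟨x, hx, rfl⟩, rfl⟩
      exact ⟨r, hr, _, ⟨_, hx, rfl⟩, by simp⟩
    · rintro ⟨r, hr, _, ⟨x, hx, rfl⟩, h⟩
      refine ⟨r, hr, _, ⟨sphMap U.symm x, ?_, rfl⟩, ?_⟩
      · have : sphMap U (sphMap U.symm x) = x := Subtype.ext (by simp)
        change sphMap U (sphMap U.symm x) ∈ s
        rwa [this]
      · apply U.injective
        simp [← h]
  rw [h]
  exact U.measurePreserving.measure_preimage_equiv (f := U.toHomeomorph.toMeasurableEquiv) _

lemma exists_isometry_map_eq {k : ℕ} {θ e : Vec k} (hθ : ‖θ‖ = 1) (he : ‖e‖ = 1) :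
    ∃ U : Vec k ≃ₗᵢ[ℝ] Vec k, U e = θ := by
  have hk : k ≠ 0 := by
    rintro rfl
    simp [Subsingleton.elim θ 0] at hθ
  obtain ⟨d, rfl⟩ := Nat.exists_eq_succ_of_ne_zero hk
  have key : ∀ v : Vec (d + 1), ‖v‖ = 1 →
      ∃ b : OrthonormalBasis (Fin (d + 1)) ℝ (Vec (d + 1)), b 0 = v := by
    intro v hv
    obtain ⟨b, hb⟩ := Orthonormal.exists_orthonormalBasis_extension_of_card_eq (𝕜 := ℝ)
      (E := Vec (d + 1)) (ι := Fin (d + 1)) (by simp) (v := fun _ => v) (s := {0})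
      (by
        constructor
        · intro i; simpa using hv
        · intro i j hij
          exact absurd (Subsingleton.elim i j) hij)
    exact ⟨b, hb 0 rfl⟩
  obtain ⟨b, hb⟩ := key θ hθ
  obtain ⟨b', hb'⟩ := key e he
  exact ⟨b'.equiv b (Equiv.refl _), by rw [← hb', OrthonormalBasis.equiv_apply_basis]; simpa⟩

-- This radial integral appears on both sides of the computation of the surface measure and has to
-- be cancelled there.
open scoped ENNReal in
lemma lintegral_Ioi_pow_mul_indicator (n : ℕ) :
    (∫⁻ r in Ioi (0 : ℝ), ENNReal.ofReal (r ^ n) * (Iio (1 : ℝ)).indicator 1 r) ≠ 0 ∧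
    (∫⁻ r in Ioi (0 : ℝ), ENNReal.ofReal (r ^ n) * (Iio (1 : ℝ)).indicator 1 r) ≠ ∞ := by
  have h : (∫⁻ r in Ioi (0 : ℝ), ENNReal.ofReal (r ^ n) * (Iio (1 : ℝ)).indicator 1 r)
      = ∫⁻ r in Ioo (0 : ℝ) 1, ENNReal.ofReal (r ^ n) := by
    rw [← Ioi_inter_Iio, inter_comm, ← Measure.restrict_restrict measurableSet_Iio,
      ← lintegral_indicator measurableSet_Iio]
    refine lintegral_congr fun r => ?_
    by_cases hr : r ∈ Iio (1 : ℝ) <;> simp [hr]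
  rw [h]
  constructor
  · refine ((setLIntegral_pos_iff (by fun_prop)).2 ?_).ne'
    have : Ioo (0 : ℝ) 1 ⊆ (Function.support fun r : ℝ => ENNReal.ofReal (r ^ n)) ∩ Ioo 0 1 := by
      intro r hr
      refine ⟨?_, hr⟩
      simp only [Function.mem_support, ne_eq, ENNReal.ofReal_eq_zero, not_le]
      exact pow_pos hr.1 n
    exact lt_of_lt_of_le (by simp) (measure_mono this)
  · refine (lt_of_le_of_lt (setLIntegral_mono (g := fun _ => 1) (by fun_prop) ?_) ?_).ne
    · intro r hr
      rw [← ENNReal.ofReal_one]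
      exact ENNReal.ofReal_le_ofReal (pow_le_one₀ hr.1.le hr.2.le)
    · simp

/-- The measure `(1 - t²)^((k-3)/2) dt` on `(-1, 1)`. -/
def marginal (k : ℕ) : Measure ℝ :=
  (volume.restrict (Ioo (-1 : ℝ) 1)).withDensity
    fun t => ENNReal.ofReal ((1 - t ^ 2) ^ (((k : ℝ) - 3) / 2))

-- Substitution `t = cos φ`: for `k = n + 2` the density becomes `(sin φ)^(n-1)`, and the Jacobian
-- supplies one more sine.
open scoped ENNReal in
lemma lintegral_marginal_eq (n : ℕ) {f : ℝ → ℝ≥0∞} (hf : Measurable f) :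
    ∫⁻ t, f t ∂marginal (n + 2) =
      ∫⁻ φ in Ioo 0 Real.pi, ENNReal.ofReal (Real.sin φ ^ n) * f (Real.cos φ) := by
  have himg : Real.cos '' Ioo 0 Real.pi = Ioo (-1) 1 := by
    ext t
    constructor
    · rintro ⟨φ, hφ, rfl⟩
      constructor
      · rw [← Real.cos_pi]
        exact Real.cos_lt_cos_of_nonneg_of_le_pi hφ.1.le le_rfl hφ.2
      · rw [← Real.cos_zero]
        exact Real.cos_lt_cos_of_nonneg_of_le_pi le_rfl hφ.2.le hφ.1
    · intro ht
      refine ⟨Real.arccos t, ⟨Real.arccos_pos.2 ht.2, ?_⟩, Real.cos_arccos ht.1.le ht.2.le⟩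
      refine lt_of_le_of_ne (Real.arccos_le_pi t) fun h => ?_
      rw [Real.arccos_eq_pi] at h
      exact absurd ht.1 (not_lt.2 h)
  rw [marginal, lintegral_withDensity_eq_lintegral_mul _ (by fun_prop) hf, ← himg,
    lintegral_image_eq_lintegral_abs_deriv_mul measurableSet_Ioo
      (fun x _ => (Real.hasDerivAt_cos x).hasDerivWithinAt)
      (Real.injOn_cos.mono Ioo_subset_Icc_self)]
  refine setLIntegral_congr_fun measurableSet_Ioo fun φ hφ => ?_
  have hs : 0 < Real.sin φ := Real.sin_pos_of_pos_of_lt_pi hφ.1 hφ.2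
  simp only [Pi.mul_apply]
  rw [← mul_assoc, ← ENNReal.ofReal_mul (abs_nonneg _)]
  congr 2
  rw [abs_neg, abs_of_pos hs, ← Real.sin_sq, ← Real.rpow_natCast _ 2, ← Real.rpow_mul hs.le]
  nth_rw 1 [← Real.rpow_one (Real.sin φ)]
  rw [← Real.rpow_add hs, ← Real.rpow_natCast]
  congr 1
  push_cast
  ring

-- Polar coordinates in the half plane of pairs (coordinate along an axis, distance to the axis):
-- the weight `s^n` splits into `r^n (sin φ)^n`, and the Jacobian raises the power of `r` to `n +
-- 1`.
open scoped ENNReal in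
lemma lintegral_half_plane_eq (n : ℕ) {f g : ℝ → ℝ≥0∞} (hf : Measurable f) (hg : Measurable g) :
    ∫⁻ p : ℝ × ℝ, (Ioi (0 : ℝ)).indicator (fun s => ENNReal.ofReal (s ^ n)) p.2 *
      (f (p.1 / √(p.1 ^ 2 + p.2 ^ 2)) * g √(p.1 ^ 2 + p.2 ^ 2)) =
      (∫⁻ r in Ioi (0 : ℝ), ENNReal.ofReal (r ^ (n + 1)) * g r) *
        ∫⁻ t, f t ∂marginal (n + 2) := by
  have hsub : Ioo (0 : ℝ) Real.pi ⊆ Ioo (-Real.pi) Real.pi :=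
    Ioo_subset_Ioo_left (by linarith [Real.pi_pos])
  have e3 : ∫⁻ t, f t ∂marginal (n + 2) = ∫⁻ φ in Ioo (-Real.pi) Real.pi,
      (Ioo (0 : ℝ) Real.pi).indicator
        (fun φ => ENNReal.ofReal (Real.sin φ ^ n) * f (Real.cos φ)) φ := by
    rw [lintegral_marginal_eq n hf, lintegral_indicator measurableSet_Ioo,
      Measure.restrict_restrict measurableSet_Ioo, inter_eq_left.2 hsub]
  have hm : Measurable ((Ioo (0 : ℝ) Real.pi).indicator
        (fun φ => ENNReal.ofReal (Real.sin φ ^ n) * f (Real.cos φ))) :=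
    Measurable.indicator (by fun_prop) measurableSet_Ioo
  rw [← lintegral_comp_polarCoord_symm, polarCoord_target, Measure.volume_eq_prod,
    ← Measure.prod_restrict, e3, ← lintegral_prod_mul (by fun_prop) hm.aemeasurable]
  rw [Measure.prod_restrict]
  refine setLIntegral_congr_fun (measurableSet_Ioi.prod measurableSet_Ioo) fun p hp => ?_
  obtain ⟨hp1, hp2⟩ := hp
  have hr : (0 : ℝ) < p.1 := hp1
  have hsq : √((p.1 * Real.cos p.2) ^ 2 + (p.1 * Real.sin p.2) ^ 2) = p.1 := by
    rw [mul_pow, mul_pow, ← mul_add, Real.cos_sq_add_sin_sq, mul_one, Real.sqrt_sq hr.le]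
  simp only [polarCoord_symm_apply, hsq, smul_eq_mul]
  rw [mul_div_cancel_left₀ _ hr.ne']
  by_cases hφ : p.2 ∈ Ioo 0 Real.pi
  · have hs : 0 < Real.sin p.2 := Real.sin_pos_of_pos_of_lt_pi hφ.1 hφ.2
    have hm : p.1 * Real.sin p.2 ∈ Ioi (0 : ℝ) := mul_pos hr hs
    rw [indicator_of_mem hφ, indicator_of_mem hm, mul_pow, pow_succ,
      ENNReal.ofReal_mul (by positivity), ENNReal.ofReal_mul (by positivity)]
    ring
  · have hm : p.1 * Real.sin p.2 ∉ Ioi (0 : ℝ) := by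
      simp only [mem_Ioi, not_lt]
      refine mul_nonpos_of_nonneg_of_nonpos hr.le ?_
      apply Real.sin_nonpos_of_nonpos_of_neg_pi_le _ hp2.1.le
      by_contra h
      exact hφ ⟨not_le.1 h, hp2.2⟩
    rw [indicator_of_notMem hφ, indicator_of_notMem hm]
    simp

-- A function of the direction, cut off at radius one to be integrable, is integrated over `ℝ^(n+2)`
-- in two ways: in spherical coordinates, and by splitting off the first coordinate and using
-- spherical coordinates in the remaining `n + 1`. The radial factor cancels. The value of the
-- constant is irrelevant, since the FvML laws are normalized.
open scoped ENNReal in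
lemma exists_lintegral_toSphere_coord (n : ℕ) : ∃ C : ℝ≥0∞, ∀ f : ℝ → ℝ≥0∞, Measurable f →
    ∫⁻ x : Sph (n + 2), f ((x : Vec (n + 2)) 0) ∂(volume : Measure (Vec (n + 2))).toSphere =
      C * ∫⁻ t, f t ∂marginal (n + 2) := by
  refine ⟨(volume : Measure (Vec (n + 1))).toSphere univ, fun f hf => ?_⟩
  obtain ⟨hc0, hct⟩ := lintegral_Ioi_pow_mul_indicator (n + 1)
  set c := ∫⁻ r in Ioi (0 : ℝ), ENNReal.ofReal (r ^ (n + 1)) * (Iio (1 : ℝ)).indicator 1 r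
    with hc
  let g : ℝ → ℝ≥0∞ := (Iio (1 : ℝ)).indicator 1
  have hg : Measurable g := measurable_one.indicator measurableSet_Iio
  let F : Vec (n + 2) → ℝ≥0∞ := fun x => f (x 0 / ‖x‖) * g ‖x‖
  have hF : Measurable F := by fun_prop
  have h1 : ∫⁻ x, F x = (∫⁻ x : Sph (n + 2), f ((x : Vec (n + 2)) 0)
      ∂(volume : Measure (Vec (n + 2))).toSphere) * c := by
    rw [lintegral_polar hF, ← lintegral_mul_const _ (by fun_prop)]
    refine lintegral_congr fun ω => ?_
    have hgm : Measurable fun r : ℝ =>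
        ENNReal.ofReal (r ^ (n + 1)) * (Iio (1 : ℝ)).indicator (1 : ℝ → ℝ≥0∞) r :=
      Measurable.mul (by fun_prop) hg
    rw [hc, ← lintegral_const_mul _ hgm]
    refine setLIntegral_congr_fun measurableSet_Ioi fun r hr => ?_
    have hr' : (0 : ℝ) < r := hr
    simp only [F, finrank_euclideanSpace, Fintype.card_fin]
    rw [norm_smul, norm_eq_of_mem_sphere, mul_one, Real.norm_of_nonneg hr'.le]
    simp only [PiLp.smul_apply, smul_eq_mul]
    rw [mul_div_cancel_left₀ _ hr'.ne']
    simp only [g, Nat.add_succ_sub_one]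
    ring
  let H : ℝ × ℝ → ℝ≥0∞ := fun p => f (p.1 / √(p.1 ^ 2 + p.2 ^ 2)) * g √(p.1 ^ 2 + p.2 ^ 2)
  have hH : Measurable H := by fun_prop
  have h2 : ∫⁻ x, F x = ∫⁻ a : ℝ, ∫⁻ y : Vec (n + 1), H (a, ‖y‖) := by
    have e1 : ∫⁻ x, F x = ∫⁻ v : Fin (n + 2) → ℝ, F (WithLp.toLp 2 v) :=
      ((PiLp.volume_preserving_toLp (Fin (n + 2))).lintegral_comp hF).symm
    have e2 := (MeasureTheory.volume_preserving_piFinSuccAbove (fun _ : Fin (n + 2) => ℝ) 0).symm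
      |>.lintegral_comp (f := fun v : Fin (n + 2) → ℝ => F (WithLp.toLp 2 v)) (by fun_prop)
    rw [e1, ← e2, Measure.volume_eq_prod, lintegral_prod _ (by fun_prop)]
    refine lintegral_congr fun a => ?_
    rw [← (PiLp.volume_preserving_toLp (Fin (n + 1))).lintegral_comp
      (f := fun y : Vec (n + 1) => H (a, ‖y‖)) (by fun_prop)]
    refine lintegral_congr fun v => ?_
    have hn : ‖(WithLp.toLp 2 ((MeasurableEquiv.piFinSuccAbove (fun _ : Fin (n + 2) => ℝ) 0).symm
        (a, v)) : Vec (n + 2))‖ = √(a ^ 2 + ‖(WithLp.toLp 2 v : Vec (n + 1))‖ ^ 2) := by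
      rw [EuclideanSpace.norm_eq, EuclideanSpace.norm_eq, Real.sq_sqrt (by positivity),
        Fin.sum_univ_succ]
      simp
    simp only [F, H]
    rw [hn]
    simp
  have h3 : ∫⁻ x, F x = (volume : Measure (Vec (n + 1))).toSphere univ *
      ∫⁻ p : ℝ × ℝ, (Ioi (0 : ℝ)).indicator (fun s => ENNReal.ofReal (s ^ n)) p.2 * H p := by
    have hi : Measurable ((Ioi (0 : ℝ)).indicator fun s => ENNReal.ofReal (s ^ n)) :=
      Measurable.indicator (by fun_prop) measurableSet_Ioi
    rw [h2, Measure.volume_eq_prod, lintegral_prod _ (by fun_prop),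
      ← lintegral_const_mul _ (by fun_prop)]
    refine lintegral_congr fun a => ?_
    rw [lintegral_polar (by fun_prop)]
    rw [mul_comm, ← lintegral_const]
    refine lintegral_congr fun ω => ?_
    rw [← lintegral_indicator measurableSet_Ioi]
    refine lintegral_congr fun s => ?_
    by_cases hs : s ∈ Ioi (0 : ℝ)
    · simp [hs, norm_smul, abs_of_pos (show (0 : ℝ) < s from hs)]
    · simp [hs]
  have h4 := lintegral_half_plane_eq n hf hg
  have h5 : (∫⁻ x : Sph (n + 2), f ((x : Vec (n + 2)) 0)
      ∂(volume : Measure (Vec (n + 2))).toSphere) * c =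
      ((volume : Measure (Vec (n + 1))).toSphere univ * ∫⁻ t, f t ∂marginal (n + 2)) * c := by
    rw [← h1, h3, mul_assoc, mul_comm _ c]
    exact congrArg _ h4
  exact (ENNReal.mul_left_inj hc0 hct).1 h5

lemma measurable_inner_sph {k : ℕ} (θ : Vec k) :
    Measurable fun x : Sph k => inner ℝ (x : Vec k) θ := by fun_prop

-- Rotation invariance reduces every `θ` to the first basis vector, so one constant serves all
-- locations.
open scoped ENNReal in
lemma exists_map_inner_toSphere {k : ℕ} (hk : 2 ≤ k) : ∃ C : ℝ≥0∞, ∀ θ : Vec k, ‖θ‖ = 1 →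
    (volume : Measure (Vec k)).toSphere.map (fun x : Sph k => inner ℝ (x : Vec k) θ) =
      C • marginal k := by
  obtain ⟨n, rfl⟩ := Nat.exists_eq_add_of_le' hk
  obtain ⟨C, hC⟩ := exists_lintegral_toSphere_coord n
  refine ⟨C, fun θ hθ => ?_⟩
  obtain ⟨U, hU⟩ := exists_isometry_map_eq hθ
    (e := EuclideanSpace.single 0 1) (by simp)
  ext s hs
  have h1 := hC (s.indicator 1) (measurable_one.indicator hs)
  rw [lintegral_indicator_one hs] at h1
  rw [Measure.map_apply (measurable_inner_sph θ) hs, Measure.smul_apply, smul_eq_mul, ← h1,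
    ← lintegral_indicator_one (measurable_inner_sph θ hs)]
  rw [← (measurePreserving_sphMap U).lintegral_comp
    (measurable_one.indicator (measurable_inner_sph θ hs))]
  refine lintegral_congr fun x => ?_
  have : inner ℝ ((sphMap U x : Sph (n + 2)) : Vec (n + 2)) θ = (x : Vec (n + 2)) 0 := by
    rw [coe_sphMap, ← hU, LinearIsometryEquiv.inner_map_map]
    simp [EuclideanSpace.inner_single_right]
  by_cases hx : (x : Vec (n + 2)) 0 ∈ s
  · rw [indicator_of_mem hx, indicator_of_mem (by simpa only [mem_preimage, this])]
    rfl
  · rw [indicator_of_notMem hx, indicator_of_notMem (by simpa only [mem_preimage, this])]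

end FvML

namespace FvML

/-! ### The one-dimensional exponential family -/

lemma ae_marginal_mem (k : ℕ) : ∀ᵐ t ∂marginal k, t ∈ Ioo (-1 : ℝ) 1 :=
  (withDensity_absolutelyContinuous _ _).ae_le (ae_restrict_mem measurableSet_Ioo)

lemma ae_marginal_mem_Icc (k : ℕ) : ∀ᵐ t ∂marginal k, (id t : ℝ) ∈ Icc (-1 : ℝ) 1 :=
  (ae_marginal_mem k).mono fun _ ht => Ioo_subset_Icc_self ht

lemma exists_norm_eq_one {k : ℕ} (hk : 2 ≤ k) : ∃ e : Vec k, ‖e‖ = 1 :=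
  ⟨EuclideanSpace.single ⟨0, by omega⟩ 1, by simp⟩

lemma toSphere_ne_zero {k : ℕ} (hk : 2 ≤ k) : (volume : Measure (Vec k)).toSphere ≠ 0 := by
  have : NeZero k := ⟨by omega⟩
  exact Measure.toSphere_ne_zero _

lemma marginal_ne_zero {k : ℕ} (hk : 2 ≤ k) : marginal k ≠ 0 := by
  obtain ⟨C, hC⟩ := exists_map_inner_toSphere hk
  obtain ⟨e, he⟩ := exists_norm_eq_one hk
  intro h
  have h1 := hC e he
  rw [h, smul_zero, Measure.map_eq_zero_iff (measurable_inner_sph e).aemeasurable] at h1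
  exact toSphere_ne_zero hk h1

/-- Proportionality to the image of the finite surface measure replaces a Beta integral; the density
is unbounded when `k = 2`. -/
lemma isFiniteMeasure_marginal {k : ℕ} (hk : 2 ≤ k) : IsFiniteMeasure (marginal k) := by
  obtain ⟨C, hC⟩ := exists_map_inner_toSphere hk
  obtain ⟨e, he⟩ := exists_norm_eq_one hk
  have h1 := hC e he
  have hC0 : C ≠ 0 := by
    rintro rfl
    rw [zero_smul, Measure.map_eq_zero_iff (measurable_inner_sph e).aemeasurable] at h1
    exact toSphere_ne_zero hk h1
  have h2 : C * marginal k univ < ⊤ := by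
    rw [← smul_eq_mul, ← Measure.smul_apply, ← h1,
      Measure.map_apply (measurable_inner_sph e) MeasurableSet.univ]
    exact measure_lt_top _ _
  refine ⟨lt_top_iff_ne_top.2 fun h => ?_⟩
  rw [h, ENNReal.mul_top hC0] at h2
  exact lt_irrefl _ h2

lemma integrable_exp_marginal {k : ℕ} (hk : 2 ≤ k) (κ : ℝ) :
    Integrable (fun t => Real.exp (κ * t)) (marginal k) := by
  have := isFiniteMeasure_marginal hk
  exact integrable_exp_mul_of_mem_Icc (X := id) measurable_id.aemeasurable (ae_marginal_mem_Icc k)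

/-- The law of `x'θ` under `FvML(κ, θ)`. -/
def cosLaw (k : ℕ) (κ : ℝ) : Measure ℝ := (marginal k).tilted fun t => κ * t

lemma isProbabilityMeasure_cosLaw {k : ℕ} (hk : 2 ≤ k) (κ : ℝ) :
    IsProbabilityMeasure (cosLaw k κ) := by
  have : NeZero (marginal k) := ⟨marginal_ne_zero hk⟩
  exact isProbabilityMeasure_tilted (integrable_exp_marginal hk κ)

lemma ae_cosLaw_mem (k : ℕ) (κ : ℝ) : ∀ᵐ t ∂cosLaw k κ, t ∈ Ioo (-1 : ℝ) 1 :=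
  (tilted_absolutelyContinuous _ _).ae_le (ae_marginal_mem k)

lemma map_tilted_comp {α β : Type*} {mα : MeasurableSpace α} {mβ : MeasurableSpace β}
    (μ : Measure α) {T : α → β} (hT : Measurable T) {f : β → ℝ} (hf : Measurable f) :
    (μ.tilted (f ∘ T)).map T = (μ.map T).tilted f := by
  ext s hs
  rw [Measure.map_apply hT hs, tilted_apply' _ _ hs, tilted_apply' _ _ (hT hs),
    setLIntegral_map hs (by fun_prop) hT, integral_map hT.aemeasurable
      (by fun_prop)]
  rfl

lemma tilted_smul_measure {α : Type*} {mα : MeasurableSpace α} (μ : Measure α) {C : ENNReal}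
    (h0 : C ≠ 0) (ht : C ≠ ⊤) (f : α → ℝ) : (C • μ).tilted f = μ.tilted f := by
  ext s hs
  rw [tilted_apply' _ _ hs, tilted_apply' _ _ hs, Measure.restrict_smul,
    lintegral_smul_measure, integral_smul_measure, smul_eq_mul,
    ← lintegral_const_mul' _ _ ht]
  refine lintegral_congr fun x => ?_
  have hC : 0 < C.toReal := ENNReal.toReal_pos h0 ht
  nth_rw 1 [← ENNReal.ofReal_toReal ht]
  rw [← ENNReal.ofReal_mul hC.le, smul_eq_mul]
  congr 1
  rw [← mul_div_assoc, mul_div_mul_left _ _ hC.ne']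

/-- The tilting function depends on `x` only through `x'θ`, so it passes to the image measure. The
result is free of `θ`, which later makes the limit theorem insensitive to moving locations. -/
lemma fvml_map_inner {k : ℕ} (hk : 2 ≤ k) (κ : ℝ) {θ : Vec k} (hθ : ‖θ‖ = 1) :
    (fvml k κ θ).map (fun x : Sph k => inner ℝ (x : Vec k) θ) = cosLaw k κ := by
  obtain ⟨C, hC⟩ := exists_map_inner_toSphere hk
  have h1 := hC θ hθ
  have hm := marginal_ne_zero hk
  have hC0 : C ≠ 0 := by
    rintro rfl
    rw [zero_smul, Measure.map_eq_zero_iff (measurable_inner_sph θ).aemeasurable] at h1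
    exact toSphere_ne_zero hk h1
  have hCt : C ≠ ⊤ := by
    rintro rfl
    have h2 : ((⊤ : ENNReal) • marginal k) univ < ⊤ := by
      rw [← h1, Measure.map_apply (measurable_inner_sph θ) MeasurableSet.univ]
      exact measure_lt_top _ _
    rw [Measure.smul_apply, smul_eq_mul, ENNReal.top_mul] at h2
    · exact lt_irrefl _ h2
    · rwa [Ne, Measure.measure_univ_eq_zero]
  rw [cosLaw, ← tilted_smul_measure _ hC0 hCt, ← h1,
    ← map_tilted_comp _ (measurable_inner_sph θ) (by fun_prop)]
  rfl

lemma integral_fvml_comp_inner {k : ℕ} (hk : 2 ≤ k) (κ : ℝ) {θ : Vec k} (hθ : ‖θ‖ = 1)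
    {E : Type*} [NormedAddCommGroup E] [NormedSpace ℝ E] {f : ℝ → E}
    (hf : StronglyMeasurable f) :
    ∫ x : Sph k, f (inner ℝ (x : Vec k) θ) ∂fvml k κ θ = ∫ t, f t ∂cosLaw k κ := by
  rw [← fvml_map_inner hk κ hθ, integral_map (measurable_inner_sph θ).aemeasurable
    hf.aestronglyMeasurable]

lemma integral_marginal (k : ℕ) (g : ℝ → ℝ) :
    ∫ t, g t ∂marginal k =
      ∫ t in (-1 : ℝ)..1, g t * (1 - t ^ 2) ^ (((k : ℝ) - 3) / 2) := by
  rw [marginal, integral_withDensity_eq_integral_toReal_smul (by fun_prop) (by simp),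
    intervalIntegral.integral_of_le (by norm_num), integral_Ioc_eq_integral_Ioo]
  refine setIntegral_congr_fun measurableSet_Ioo fun t ht => ?_
  have : 0 ≤ 1 - t ^ 2 := by nlinarith [ht.1, ht.2]
  simp only [smul_eq_mul]
  rw [ENNReal.toReal_ofReal (by positivity), mul_comm]

lemma mem_interior_integrableExpSet {k : ℕ} (hk : 2 ≤ k) (κ : ℝ) :
    κ ∈ interior (integrableExpSet id (marginal k)) := by
  have : integrableExpSet id (marginal k) = univ :=
    eq_univ_of_forall fun t => integrable_exp_marginal hk t
  simp [this]

lemma A_eq_div (k : ℕ) (κ : ℝ) : A k κ =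
    (∫ t, t * Real.exp (κ * t) ∂marginal k) / ∫ t, Real.exp (κ * t) ∂marginal k := by
  rw [A, integral_marginal, integral_marginal]

/-- `cosLaw` is a one-parameter exponential family, so its mean and variance are the first two
derivatives of the cumulant generating function; in particular the variance is `A_k'`. -/
lemma A_eq_deriv_cgf {k : ℕ} (hk : 2 ≤ k) (κ : ℝ) :
    A k κ = deriv (cgf id (marginal k)) κ := by
  rw [deriv_cgf (mem_interior_integrableExpSet hk κ), A_eq_div]
  rfl

lemma integral_cosLaw_id {k : ℕ} (hk : 2 ≤ k) (κ : ℝ) : ∫ t, t ∂cosLaw k κ = A k κ := by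
  rw [A_eq_deriv_cgf hk, ← integral_tilted_mul_self (mem_interior_integrableExpSet hk κ)]
  rfl

lemma variance_cosLaw {k : ℕ} (hk : 2 ≤ k) (κ : ℝ) :
    Var[id; cosLaw k κ] = deriv (A k) κ := by
  have h := variance_tilted_mul (mem_interior_integrableExpSet hk κ)
  have h2 : A k = deriv (cgf id (marginal k)) := funext fun κ => A_eq_deriv_cgf hk κ
  rw [h2]
  rw [iteratedDeriv_succ, iteratedDeriv_one] at h
  exact h

lemma differentiable_A {k : ℕ} (hk : 2 ≤ k) : Differentiable ℝ (A k) := by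
  have h2 : A k = deriv (cgf id (marginal k)) := funext fun κ => A_eq_deriv_cgf hk κ
  rw [h2]
  exact fun κ => (analyticAt_cgf (mem_interior_integrableExpSet hk κ)).deriv.differentiableAt

lemma integrable_cosLaw_of_continuous {k : ℕ} (hk : 2 ≤ k) (κ : ℝ) {E : Type*}
    [NormedAddCommGroup E] [SecondCountableTopology E] {f : ℝ → E} (hf : Continuous f) :
    Integrable f (cosLaw k κ) := by
  have := isProbabilityMeasure_cosLaw hk κ
  obtain ⟨M, hM⟩ := (isCompact_Icc (a := (-1 : ℝ)) (b := 1)).exists_bound_of_continuousOn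
    hf.continuousOn
  exact Integrable.of_bound hf.aestronglyMeasurable M
    ((ae_cosLaw_mem k κ).mono fun t ht => hM t (Ioo_subset_Icc_self ht))

lemma integrable_marginal_of_continuous {k : ℕ} (hk : 2 ≤ k) {E : Type*}
    [NormedAddCommGroup E] [SecondCountableTopology E] {f : ℝ → E} (hf : Continuous f) :
    Integrable f (marginal k) := by
  have := isFiniteMeasure_marginal hk
  obtain ⟨M, hM⟩ := (isCompact_Icc (a := (-1 : ℝ)) (b := 1)).exists_bound_of_continuousOn
    hf.continuousOn
  exact Integrable.of_bound hf.aestronglyMeasurable M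
    ((ae_marginal_mem k).mono fun t ht => hM t (Ioo_subset_Icc_self ht))

/-- Zero variance would make `marginal k`, which charges no point, concentrate on a single one. -/
lemma variance_cosLaw_pos {k : ℕ} (hk : 2 ≤ k) (κ : ℝ) : 0 < Var[id; cosLaw k κ] := by
  have := isProbabilityMeasure_cosLaw hk κ
  refine lt_of_le_of_ne (variance_nonneg _ _) fun h => ?_
  have hmem : MemLp (id : ℝ → ℝ) 2 (cosLaw k κ) :=
    (memLp_two_iff_integrable_sq measurable_id.aestronglyMeasurable).2
      (integrable_cosLaw_of_continuous hk κ (by fun_prop))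
  have h1 : eVar[id; cosLaw k κ] = 0 := by
    rw [← hmem.ofReal_variance_eq, ← h, ENNReal.ofReal_zero]
  rw [evariance_eq_zero_iff (by fun_prop)] at h1
  have h2 : (fun t => t) =ᵐ[marginal k] fun _ => ∫ t, id t ∂cosLaw k κ :=
    (absolutelyContinuous_tilted (integrable_exp_marginal hk κ)).ae_le h1
  set a := ∫ t, id t ∂cosLaw k κ
  have h3 : ∀ᵐ t ∂marginal k, t ≠ a := by
    have : marginal k ≪ volume :=
      (withDensity_absolutelyContinuous _ _).trans Measure.restrict_le_self.absolutelyContinuous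
    refine this.ae_le ?_
    exact Measure.ae_ne volume a
  have h4 : ∀ᵐ t ∂marginal k, False := by
    filter_upwards [h2, h3] with t ht ht'
    exact ht' ht
  rw [ae_iff] at h4
  simp only [not_false_eq_true, ofPred_true] at h4
  exact marginal_ne_zero hk (Measure.measure_univ_eq_zero.1 h4)

/-- The integration by parts behind `D_k = A_k'`. -/
lemma mul_integral_one_sub_sq {k : ℕ} (hk : 2 ≤ k) (κ : ℝ) :
    κ * ∫ t, (1 - t ^ 2) * Real.exp (κ * t) ∂marginal k =
      ((k : ℝ) - 1) * ∫ t, t * Real.exp (κ * t) ∂marginal k := by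
  have hk' : (2 : ℝ) ≤ k := by exact_mod_cast hk
  set p : ℝ := ((k : ℝ) - 1) / 2 with hp
  have hp0 : 0 < p := by rw [hp]; linarith
  -- The exponent `(k-1)/2` is positive, so this primitive is continuous on `[-1,1]` and vanishes at
  -- both ends, although its derivative may blow up there when `k = 2`.
  let F : ℝ → ℝ := fun t => (1 - t ^ 2) ^ p * Real.exp (κ * t)
  let g : ℝ → ℝ := fun t => κ * ((1 - t ^ 2) * Real.exp (κ * t)) -
    ((k : ℝ) - 1) * (t * Real.exp (κ * t))
  have hg : Integrable g (marginal k) := integrable_marginal_of_continuous hk (by fun_prop)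
  have h0 : ∫ t, g t ∂marginal k = 0 := by
    rw [integral_marginal, intervalIntegral.integral_eq_sub_of_hasDerivAt_of_le (f := F)
      (by norm_num)]
    · simp [F, Real.zero_rpow hp0.ne']
    · refine Continuous.continuousOn ?_
      exact (Continuous.rpow_const (by fun_prop) fun _ => Or.inr hp0.le).mul (by fun_prop)
    · intro t ht
      have h1 : 0 < 1 - t ^ 2 := by nlinarith [ht.1, ht.2]
      have hd1 : HasDerivAt (fun t : ℝ => (1 - t ^ 2)) (-(2 * t)) t := by
        simpa using ((hasDerivAt_pow 2 t).const_sub 1)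
      have hd2 := hd1.rpow_const (p := p) (Or.inl h1.ne')
      have hd3 : HasDerivAt (fun t : ℝ => Real.exp (κ * t)) (Real.exp (κ * t) * κ) t := by
        simpa using ((hasDerivAt_id t).const_mul κ).exp
      have e1 : (1 - t ^ 2) ^ p = (1 - t ^ 2) ^ (((k : ℝ) - 3) / 2) * (1 - t ^ 2) := by
        nth_rw 3 [← Real.rpow_one (1 - t ^ 2)]
        rw [← Real.rpow_add h1]
        congr 1
        rw [hp]; ring
      have e2 : p - 1 = ((k : ℝ) - 3) / 2 := by rw [hp]; ring
      refine (hd2.mul hd3).congr_deriv ?_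
      rw [e2, e1]
      simp only [g, hp]
      ring
    · rw [intervalIntegrable_iff_integrableOn_Ioo_of_le (by norm_num)]
      rw [marginal, integrable_withDensity_iff_integrable_smul' (by fun_prop) (by simp)] at hg
      refine (integrable_congr ?_).1 hg
      filter_upwards [ae_restrict_mem measurableSet_Ioo] with t ht
      have : 0 ≤ 1 - t ^ 2 := by nlinarith [ht.1, ht.2]
      rw [ENNReal.toReal_ofReal (by positivity), smul_eq_mul, mul_comm]
  rw [integral_sub, integral_const_mul, integral_const_mul] at h0
  · linarith
  · exact integrable_marginal_of_continuous hk (by fun_prop)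
  · exact integrable_marginal_of_continuous hk (by fun_prop)

lemma mul_integral_cosLaw_one_sub_sq {k : ℕ} (hk : 2 ≤ k) (κ : ℝ) :
    κ * ∫ t, (1 - t ^ 2) ∂cosLaw k κ = ((k : ℝ) - 1) * A k κ := by
  have h : ∫ t, (1 - t ^ 2) ∂cosLaw k κ = (∫ t, (1 - t ^ 2) * Real.exp (κ * t) ∂marginal k) /
      ∫ t, Real.exp (κ * t) ∂marginal k := by
    rw [cosLaw, integral_tilted, ← integral_div]
    refine integral_congr_ae (ae_of_all _ fun t => ?_)
    simp only [smul_eq_mul]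
    ring
  rw [h, A_eq_div, ← mul_div_assoc, mul_integral_one_sub_sq hk, mul_div_assoc]

/-- The integration by parts gives the second moment as `1 - ((k-1)/κ) A_k(κ)`. -/
lemma D_eq_variance {k : ℕ} (hk : 2 ≤ k) {κ : ℝ} (hκ : κ ≠ 0) :
    D k κ = Var[id; cosLaw k κ] := by
  have := isProbabilityMeasure_cosLaw hk κ
  have h1 := mul_integral_cosLaw_one_sub_sq hk κ
  have hint : Integrable (fun t : ℝ => t ^ 2) (cosLaw k κ) :=
    integrable_cosLaw_of_continuous hk κ (by fun_prop)
  rw [integral_sub (integrable_const _) hint, integral_const] at h1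
  rw [variance_eq_sub ((memLp_two_iff_integrable_sq measurable_id.aestronglyMeasurable).2 hint)]
  simp only [id, Pi.pow_apply]
  rw [integral_cosLaw_id hk, D]
  simp at h1
  field_simp
  linarith

lemma D_pos {k : ℕ} (hk : 2 ≤ k) {κ : ℝ} (hκ : κ ≠ 0) : 0 < D k κ := by
  rw [D_eq_variance hk hκ]
  exact variance_cosLaw_pos hk κ

/-- The integration by parts writes `(k-1) A_k(κ)` as `κ` times the mean of `1 - t²`, which is
positive almost everywhere. -/
lemma A_pos {k : ℕ} (hk : 2 ≤ k) {κ : ℝ} (hκ : 0 < κ) : 0 < A k κ := by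
  have := isProbabilityMeasure_cosLaw hk κ
  have h1 := mul_integral_cosLaw_one_sub_sq hk κ
  have hk' : (2 : ℝ) ≤ k := by exact_mod_cast hk
  have h2 : 0 < ∫ t, (1 - t ^ 2) ∂cosLaw k κ := by
    rw [integral_pos_iff_support_of_nonneg_ae _
      (integrable_cosLaw_of_continuous hk κ (by fun_prop))]
    · have h : cosLaw k κ (Function.support fun t : ℝ => 1 - t ^ 2)ᶜ = 0 := by
        rw [← mem_ae_iff]
        filter_upwards [ae_cosLaw_mem k κ] with t ht
        have : 0 < 1 - t ^ 2 := by nlinarith [ht.1, ht.2]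
        exact this.ne'
      rw [pos_iff_ne_zero]
      intro h'
      have h1 := measure_union_le (μ := cosLaw k κ) (Function.support fun t : ℝ => 1 - t ^ 2)
        (Function.support fun t : ℝ => 1 - t ^ 2)ᶜ
      rw [h, h', union_compl_self, measure_univ] at h1
      simp at h1
    · filter_upwards [ae_cosLaw_mem k κ] with t ht
      simp only [Pi.zero_apply]
      nlinarith [ht.1, ht.2]
  have h3 : 0 < ((k : ℝ) - 1) * A k κ := by rw [← h1]; positivity
  exact (mul_pos_iff_of_pos_left (by linarith)).1 h3

lemma abs_A_le {k : ℕ} (hk : 2 ≤ k) (κ : ℝ) : |A k κ| ≤ 1 := by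
  have := isProbabilityMeasure_cosLaw hk κ
  rw [← integral_cosLaw_id hk, ← Real.norm_eq_abs]
  have := norm_integral_le_of_norm_le_const (μ := cosLaw k κ) (f := fun t => t) (C := 1)
    ((ae_cosLaw_mem k κ).mono fun t ht => by
      rw [Real.norm_eq_abs]; exact abs_le.2 ⟨ht.1.le, ht.2.le⟩)
  simpa using this

lemma strictMono_A {k : ℕ} (hk : 2 ≤ k) : StrictMono (A k) := by
  refine strictMono_of_deriv_pos fun κ => ?_
  rw [← variance_cosLaw hk]
  exact variance_cosLaw_pos hk κ

lemma continuousAt_D {k : ℕ} (hk : 2 ≤ k) {κ : ℝ} (hκ : κ ≠ 0) : ContinuousAt (D k) κ := by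
  have hA : Continuous (A k) := (differentiable_A hk).continuous
  unfold D
  exact ((continuousAt_const).sub ((continuousAt_const.div continuousAt_id hκ).mul
    hA.continuousAt)).sub (hA.continuousAt.pow 2)

lemma measurable_D {k : ℕ} (hk : 2 ≤ k) : Measurable (D k) := by
  have hA : Measurable (A k) := (differentiable_A hk).continuous.measurable
  unfold D
  fun_prop

/-- The Laplace transform, with complex argument, of the centred law of `x'θ`. -/
def cosTransform (k : ℕ) (κ : ℝ) (ζ : ℂ) : ℂ :=
  ∫ t : ℝ, Complex.exp (ζ * ((t - A k κ : ℝ) : ℂ)) ∂cosLaw k κ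

lemma integral_cosLaw_sub_A_sq {k : ℕ} (hk : 2 ≤ k) {κ : ℝ} (hκ : κ ≠ 0) :
    ∫ t, (t - A k κ) ^ 2 ∂cosLaw k κ = D k κ := by
  rw [D_eq_variance hk hκ, variance_eq_integral (by fun_prop)]
  simp only [id]
  rw [integral_cosLaw_id hk]

/-- Second-order Taylor expansion under the integral; centring removes the linear term. Since `|t -
A_k| ≤ 2`, the condition on `ζ` keeps the exponent in the unit disc, and the cubic remainder is at
most `(2‖ζ‖)³`. -/
lemma norm_cosTransform_sub_le {k : ℕ} (hk : 2 ≤ k) {κ : ℝ} (hκ : κ ≠ 0) {ζ : ℂ}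
    (hζ : ‖ζ‖ ≤ 1 / 2) :
    ‖cosTransform k κ ζ - (1 + D k κ * ζ ^ 2 / 2)‖ ≤ 8 * ‖ζ‖ ^ 3 := by
  have := isProbabilityMeasure_cosLaw hk κ
  have hI : ∀ f : ℝ → ℂ, Continuous f → Integrable f (cosLaw k κ) := fun f hf =>
    integrable_cosLaw_of_continuous hk κ hf
  have e1 : ∫ t : ℝ, ((t - A k κ : ℝ) : ℂ) ∂cosLaw k κ = 0 := by
    rw [integral_complex_ofReal, integral_sub (integrable_cosLaw_of_continuous hk κ continuous_id')
      (integrable_const _), integral_cosLaw_id hk]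
    simp
  have e2 : ∫ t : ℝ, ((t - A k κ : ℝ) : ℂ) ^ 2 ∂cosLaw k κ = D k κ := by
    rw [← integral_cosLaw_sub_A_sq hk hκ, ← integral_complex_ofReal]
    simp
  have e3 : (1 + D k κ * ζ ^ 2 / 2 : ℂ) = ∫ t : ℝ, (1 + ζ * ((t - A k κ : ℝ) : ℂ) +
      ζ ^ 2 / 2 * ((t - A k κ : ℝ) : ℂ) ^ 2) ∂cosLaw k κ := by
    rw [integral_add (hI _ (by fun_prop)) (hI _ (by fun_prop)),
      integral_add (hI _ (by fun_prop)) (hI _ (by fun_prop)), integral_const_mul,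
      integral_const_mul, e1, e2]
    simp
    ring
  rw [cosTransform, e3, ← integral_sub (hI _ (by fun_prop)) (hI _ (by fun_prop))]
  have hA := abs_le.1 (abs_A_le hk κ)
  have hb := norm_integral_le_of_norm_le_const (μ := cosLaw k κ)
    (f := fun t : ℝ => Complex.exp (ζ * ((t - A k κ : ℝ) : ℂ)) - (1 + ζ * ((t - A k κ : ℝ) : ℂ) +
      ζ ^ 2 / 2 * ((t - A k κ : ℝ) : ℂ) ^ 2)) (C := 8 * ‖ζ‖ ^ 3) ?_
  · simpa using hb
  filter_upwards [ae_cosLaw_mem k κ] with t ht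
  set w : ℂ := ζ * ((t - A k κ : ℝ) : ℂ) with hw
  have hta : ‖((t - A k κ : ℝ) : ℂ)‖ ≤ 2 := by
    rw [Complex.norm_real, Real.norm_eq_abs, abs_le]
    constructor <;> linarith [ht.1, ht.2]
  have hwn : ‖w‖ ≤ ‖ζ‖ * 2 := by
    rw [hw, norm_mul]
    gcongr
  have hb := Complex.exp_bound (x := w) (by linarith) (n := 3) (by norm_num)
  have hs : ∑ m ∈ Finset.range 3, w ^ m / (m.factorial : ℂ) =
      1 + w + ζ ^ 2 / 2 * ((t - A k κ : ℝ) : ℂ) ^ 2 := by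
    simp [Finset.sum_range_succ, Nat.factorial, hw]
    ring
  rw [hs] at hb
  refine hb.trans ?_
  have h3 : ‖w‖ ^ 3 ≤ (‖ζ‖ * 2) ^ 3 := by gcongr
  have : ((Nat.succ 3 : ℕ) : ℝ) * (((Nat.factorial 3 : ℕ) : ℝ) * ((3 : ℕ) : ℝ))⁻¹ ≤ 1 := by
    norm_num [Nat.factorial]
  calc _ ≤ ‖w‖ ^ 3 * 1 := by gcongr
    _ ≤ _ := by nlinarith

/-- Complex arguments are needed: real `ζ` gives the normalizing constants of the likelihood ratios,
and `ζ = c + is` the characteristic functions under the shifted laws. -/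
lemma tendsto_cosTransform_pow {k : ℕ} (hk : 2 ≤ k) {κ : ℝ} (hκ : κ ≠ 0) (ζ : ℂ) {n : ℕ → ℕ}
    (hn : Tendsto n atTop atTop) :
    Tendsto (fun j => cosTransform k κ (ζ * ((√(n j : ℝ))⁻¹ : ℝ)) ^ n j) atTop
      (𝓝 (Complex.exp (D k κ * ζ ^ 2 / 2))) := by
  refine Tendsto.comp (g := fun n : ℕ => cosTransform k κ (ζ * ((√(n : ℝ))⁻¹ : ℝ)) ^ n) ?_ hn
  apply Complex.tendsto_pow_exp_of_isLittleO_sub_add_div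
  have hs : Tendsto (fun n : ℕ => (√(n : ℝ))⁻¹) atTop (𝓝 0) :=
    tendsto_inv_atTop_zero.comp (Real.tendsto_sqrt_atTop.comp tendsto_natCast_atTop_atTop)
  have hz : Tendsto (fun n : ℕ => ‖ζ * ((√(n : ℝ))⁻¹ : ℝ)‖) atTop (𝓝 0) := by
    have := hs.norm.const_mul ‖ζ‖
    simpa using this
  have h0 : Tendsto (fun n : ℕ => 8 * ‖ζ‖ ^ 3 * (√(n : ℝ))⁻¹) atTop (𝓝 0) := by
    simpa using hs.const_mul (8 * ‖ζ‖ ^ 3)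
  rw [Asymptotics.isLittleO_iff]
  intro c hc
  filter_upwards [hz.eventually_le_const (by norm_num : (0 : ℝ) < 1 / 2),
    h0.eventually_le_const hc, eventually_gt_atTop 0] with n h1 h2 h3
  have hn0 : (0 : ℝ) < n := by exact_mod_cast h3
  have hsq : √(n : ℝ) ^ 2 = n := Real.sq_sqrt hn0.le
  have hb := norm_cosTransform_sub_le hk hκ h1
  have e1 : (D k κ * (ζ * ((√(n : ℝ))⁻¹ : ℝ)) ^ 2 / 2 : ℂ) = D k κ * ζ ^ 2 / 2 / n := by
    rw [mul_pow, ← Complex.ofReal_pow, inv_pow, hsq]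
    push_cast
    ring
  rw [e1] at hb
  refine hb.trans ?_
  rw [norm_mul, Complex.norm_real, Real.norm_of_nonneg (by positivity)]
  have e2 : ‖(1 / n : ℂ)‖ = (√(n : ℝ))⁻¹ ^ 2 := by
    rw [inv_pow, hsq]; simp
  rw [e2]
  have h4 : 0 ≤ (√(n : ℝ))⁻¹ ^ 2 := by positivity
  nlinarith [mul_le_mul_of_nonneg_right h2 h4]

/-- Hoeffding's lemma on an interval of length two. It yields bounds on the normalizing constants
uniform in the sample sizes, as dominated convergence requires. -/
lemma integral_exp_cosLaw_le {k : ℕ} (hk : 2 ≤ k) (κ s : ℝ) :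
    ∫ t, Real.exp (s * (t - A k κ)) ∂cosLaw k κ ≤ Real.exp (s ^ 2 / 2) := by
  have := isProbabilityMeasure_cosLaw hk κ
  have h := (hasSubgaussianMGF_of_mem_Icc (μ := cosLaw k κ) (X := id) (a := -1) (b := 1)
    measurable_id.aemeasurable
    ((ae_cosLaw_mem k κ).mono fun t ht => Ioo_subset_Icc_self ht)).mgf_le s
  have h2 : ∫ t, id t ∂cosLaw k κ = A k κ := integral_cosLaw_id hk κ
  rw [h2] at h
  refine h.trans_eq ?_
  congr 1
  have : ‖(1 : ℝ) - -1‖₊ = 2 := by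
    ext
    norm_num
  rw [this]
  norm_num

end FvML

namespace FvML

/-! ### Likelihood ratios in the multi-sample model -/

lemma tilted_add_const {α : Type*} {mα : MeasurableSpace α} (μ : Measure α) (f : α → ℝ) (a : ℝ) :
    μ.tilted (fun x => f x + a) = μ.tilted f := by
  unfold Measure.tilted
  congr 1
  ext x
  simp_rw [Real.exp_add, integral_mul_const]
  rw [mul_div_mul_right _ _ (Real.exp_pos a).ne']

lemma pi_tilted {ι : Type*} [Fintype ι] {α : ι → Type*} [∀ i, MeasurableSpace (α i)]
    (μ : ∀ i, Measure (α i)) [∀ i, IsProbabilityMeasure (μ i)] (f : ∀ i, α i → ℝ)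
    (hf : ∀ i, Integrable (fun x => Real.exp (f i x)) (μ i)) :
    Measure.pi (fun i => (μ i).tilted (f i)) =
      (Measure.pi μ).tilted fun x => ∑ i, f i (x i) := by
  have hp : ∀ i, IsProbabilityMeasure ((μ i).tilted (f i)) := fun i =>
    isProbabilityMeasure_tilted (hf i)
  refine Measure.pi_eq fun s hs => ?_
  have hZ : ∫ x, Real.exp (∑ i, f i (x i)) ∂Measure.pi μ = ∏ i, ∫ x, Real.exp (f i x) ∂μ i := by
    simp_rw [Real.exp_sum]
    exact integral_fintype_prod_eq_prod fun i x => Real.exp (f i x)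
  rw [tilted_apply_eq_ofReal_integral' _ (MeasurableSet.univ_pi hs), hZ,
    ← integral_indicator (MeasurableSet.univ_pi hs)]
  have h1 : ∀ x : (i : ι) → α i, (univ.pi s).indicator
      (fun x => Real.exp (∑ i, f i (x i)) / ∏ i, ∫ x, Real.exp (f i x) ∂μ i) x =
      ∏ i, (s i).indicator (fun y => Real.exp (f i y) / ∫ x, Real.exp (f i x) ∂μ i) (x i) := by
    intro x
    by_cases hx : x ∈ univ.pi s
    · rw [indicator_of_mem hx, Real.exp_sum, ← Finset.prod_div_distrib]
      exact Finset.prod_congr rfl fun i _ =>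
        (indicator_of_mem (hx i trivial) fun y => Real.exp (f i y) / ∫ x, Real.exp (f i x) ∂μ i).symm
    · rw [indicator_of_notMem hx]
      simp only [Set.mem_pi, mem_univ, true_implies, not_forall] at hx
      obtain ⟨i, hi⟩ := hx
      exact (Finset.prod_eq_zero (Finset.mem_univ i) (indicator_of_notMem hi _)).symm
  simp_rw [h1]
  rw [integral_fintype_prod_eq_prod
    (fun i => (s i).indicator fun y => Real.exp (f i y) / ∫ x, Real.exp (f i x) ∂μ i),
    ENNReal.ofReal_prod_of_nonneg]
  · refine Finset.prod_congr rfl fun i _ => ?_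
    rw [integral_indicator (hs i), tilted_apply_eq_ofReal_integral' _ (hs i)]
  · intro i _
    refine integral_nonneg fun y => indicator_nonneg (fun y _ => ?_) y
    positivity

variable {m k : ℕ}

lemma integrable_sph [NeZero k] {E : Type*} [NormedAddCommGroup E] [SecondCountableTopology E]
    {f : Sph k → E} (hf : Continuous f) (μ : Measure (Sph k)) [IsFiniteMeasure μ] :
    Integrable f μ := by
  obtain ⟨M, hM⟩ := isCompact_univ.exists_bound_of_continuousOn hf.continuousOn
  exact Integrable.of_bound hf.aestronglyMeasurable M (ae_of_all _ fun x => hM x trivial)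

/-- The family is exponential with natural parameter `κθ`, so any two members differ by an
exponential tilt in the difference of these vectors. -/
lemma fvml_eq_tilted [NeZero k] (κ κ' : ℝ) (θ θ' : Vec k) :
    fvml k κ' θ' = (fvml k κ θ).tilted fun x => inner ℝ (x : Vec k) (κ' • θ' - κ • θ) := by
  rw [fvml, fvml, tilted_tilted (integrable_sph (by fun_prop) _)]
  congr 1
  ext x
  simp [inner_sub_right, inner_smul_right]

/-- The difference of the natural parameters `κ_i θ_i`. -/
def natDiff (ϑ ϑ' : Param m k) (i : Fin m) : Vec k :=
  ϑ'.conc i • ϑ'.loc i - ϑ.conc i • ϑ.loc i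

/-- The log-likelihood ratio, up to a constant. -/
def logRatio {N : Fin m → ℕ} (ϑ ϑ' : Param m k) (x : Sample m k N) : ℝ :=
  ∑ i, ∑ j, inner ℝ (x i j : Vec k) (natDiff ϑ ϑ' i)

lemma law_eq_tilted [NeZero k] (N : Fin m → ℕ) (ϑ ϑ' : Param m k) :
    law N ϑ' = (law N ϑ).tilted (logRatio ϑ ϑ') := by
  have h1 : ∀ i, (Measure.pi fun _ : Fin (N i) => fvml k (ϑ'.conc i) (ϑ'.loc i)) =
      (Measure.pi fun _ : Fin (N i) => fvml k (ϑ.conc i) (ϑ.loc i)).tilted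
        fun y => ∑ j, inner ℝ (y j : Vec k) (natDiff ϑ ϑ' i) := by
    intro i
    rw [← pi_tilted (fun _ : Fin (N i) => fvml k (ϑ.conc i) (ϑ.loc i))
      (fun _ y => inner ℝ (y : Vec k) (natDiff ϑ ϑ' i))
      fun _ => integrable_sph (by fun_prop) _]
    congr 1
    ext1 j
    exact fvml_eq_tilted _ _ _ _
  rw [law, funext h1, law]
  rw [pi_tilted (fun i => Measure.pi fun _ : Fin (N i) => fvml k (ϑ.conc i) (ϑ.loc i))
      (fun i y => ∑ j, inner ℝ (y j : Vec k) (natDiff ϑ ϑ' i))]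
  · rfl
  · intro i
    simp_rw [Real.exp_sum]
    exact Integrable.fintype_prod (f := fun _ (y : Sph k) =>
      Real.exp (inner ℝ (y : Vec k) (natDiff ϑ ϑ' i))) fun _ => integrable_sph (by fun_prop) _

lemma integral_law_prod [NeZero k] {𝕜 : Type*} [RCLike 𝕜] (N : Fin m → ℕ) (ϑ : Param m k)
    (f : Fin m → Sph k → 𝕜) :
    ∫ x, ∏ i, ∏ j, f i (x i j) ∂law N ϑ =
      ∏ i, (∫ y, f i y ∂fvml k (ϑ.conc i) (ϑ.loc i)) ^ N i := by
  rw [law, integral_fintype_prod_eq_prod (fun i (y : Fin (N i) → Sph k) => ∏ j, f i (y j))]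
  refine Finset.prod_congr rfl fun i _ => ?_
  rw [integral_fintype_prod_eq_prod (fun (_ : Fin (N i)) y => f i y)]
  simp

lemma continuous_logRatio {N : Fin m → ℕ} (ϑ ϑ' : Param m k) :
    Continuous (logRatio ϑ ϑ' : Sample m k N → ℝ) := by
  unfold logRatio
  fun_prop

lemma integrable_sample {N : Fin m → ℕ} {E : Type*} [NormedAddCommGroup E]
    [SecondCountableTopology E] {f : Sample m k N → E} (hf : Continuous f)
    (μ : Measure (Sample m k N)) [IsFiniteMeasure μ] : Integrable f μ := by
  obtain ⟨M, hM⟩ := isCompact_univ.exists_bound_of_continuousOn hf.continuousOn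
  exact Integrable.of_bound hf.aestronglyMeasurable M (ae_of_all _ fun x => hM x trivial)

/-- With `Y = x'h` of mean `a` and values in `[-‖h‖, ‖h‖]`, Hoeffding's lemma bounds the left side
by `exp (2‖h‖²) exp (2a)`, and Jensen's inequality bounds `exp a` by the mean of `exp Y`. -/
lemma integral_exp_two_inner_le [NeZero k] (μ : Measure (Sph k)) [IsProbabilityMeasure μ]
    (h : Vec k) : ∫ x : Sph k, Real.exp (2 * inner ℝ (x : Vec k) h) ∂μ ≤
      Real.exp (2 * ‖h‖ ^ 2) * (∫ x : Sph k, Real.exp (inner ℝ (x : Vec k) h) ∂μ) ^ 2 := by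
  set Y : Sph k → ℝ := fun x => inner ℝ (x : Vec k) h with hY
  have hYm : Continuous Y := by fun_prop
  have hYb : ∀ x, Y x ∈ Icc (-‖h‖) ‖h‖ := by
    intro x
    have := abs_real_inner_le_norm (x : Vec k) h
    rw [norm_eq_of_mem_sphere, one_mul] at this
    exact abs_le.1 this
  have h1 := (hasSubgaussianMGF_of_mem_Icc (μ := μ) hYm.aemeasurable (ae_of_all _ hYb)).mgf_le 2
  set a := ∫ x, Y x ∂μ
  have h2 : Real.exp a ≤ ∫ x, Real.exp (Y x) ∂μ := by
    have := (convexOn_exp).map_integral_le (μ := μ) (f := Y) Real.continuous_exp.continuousOn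
      isClosed_univ (ae_of_all _ fun _ => trivial) (integrable_sph hYm μ)
      (integrable_sph (by fun_prop) μ)
    exact this
  have h3 : mgf (fun ω => Y ω - a) μ 2 = Real.exp (-(2 * a)) * ∫ x, Real.exp (2 * Y x) ∂μ := by
    rw [mgf, ← integral_const_mul]
    congr 1
    ext x
    rw [← Real.exp_add]
    refine congrArg Real.exp ?_
    ring
  have h4 : (((‖‖h‖ - -‖h‖‖₊ / 2) ^ 2 : NNReal) : ℝ) * 2 ^ 2 / 2 = 2 * ‖h‖ ^ 2 := by
    push_cast
    rw [sub_neg_eq_add, Real.norm_of_nonneg (by positivity)]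
    ring
  rw [h3, h4] at h1
  have h5 : ∫ x, Real.exp (2 * Y x) ∂μ ≤ Real.exp (2 * ‖h‖ ^ 2) * Real.exp a ^ 2 := by
    have := mul_le_mul_of_nonneg_left h1 (Real.exp_pos (2 * a)).le
    rw [← mul_assoc, ← Real.exp_add, add_neg_cancel, Real.exp_zero, one_mul] at this
    refine this.trans_eq ?_
    rw [mul_comm, ← Real.exp_nat_mul]
    norm_num
  refine h5.trans ?_
  gcongr

/-- The bound `2 Σ n_i ‖η_i' - η_i‖²` on the logarithm of the second moment of the likelihood
ratio. -/
def chiBound (N : Fin m → ℕ) (ϑ ϑ' : Param m k) : ℝ := ∑ i, N i * (2 * ‖natDiff ϑ ϑ' i‖ ^ 2)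

lemma integral_exp_two_logRatio_le [NeZero k] (N : Fin m → ℕ) (ϑ ϑ' : Param m k) :
    ∫ x, Real.exp (2 * logRatio ϑ ϑ' x) ∂law N ϑ ≤
      Real.exp (chiBound N ϑ ϑ') * (∫ x, Real.exp (logRatio ϑ ϑ' x) ∂law N ϑ) ^ 2 := by
  have e1 : ∫ x, Real.exp (2 * logRatio ϑ ϑ' x) ∂law N ϑ = ∏ i,
      (∫ y : Sph k, Real.exp (2 * inner ℝ (y : Vec k) (natDiff ϑ ϑ' i))
        ∂fvml k (ϑ.conc i) (ϑ.loc i)) ^ N i := by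
    rw [← integral_law_prod N ϑ fun i (y : Sph k) =>
      Real.exp (2 * inner ℝ (y : Vec k) (natDiff ϑ ϑ' i))]
    simp_rw [logRatio, Finset.mul_sum, Real.exp_sum]
  have e2 : ∫ x, Real.exp (logRatio ϑ ϑ' x) ∂law N ϑ = ∏ i,
      (∫ y : Sph k, Real.exp (inner ℝ (y : Vec k) (natDiff ϑ ϑ' i))
        ∂fvml k (ϑ.conc i) (ϑ.loc i)) ^ N i := by
    rw [← integral_law_prod N ϑ fun i (y : Sph k) =>
      Real.exp (inner ℝ (y : Vec k) (natDiff ϑ ϑ' i))]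
    simp_rw [logRatio, Real.exp_sum]
  rw [e1, e2, chiBound, Real.exp_sum, ← Finset.prod_pow, ← Finset.prod_mul_distrib]
  refine Finset.prod_le_prod (fun i _ => ?_) fun i _ => ?_
  · exact pow_nonneg (integral_nonneg fun _ => (Real.exp_pos _).le) _
  · rw [Real.exp_nat_mul, ← pow_mul, mul_comm (N i) 2, pow_mul, ← mul_pow]
    exact pow_le_pow_left₀ (integral_nonneg fun _ => (Real.exp_pos _).le)
      (integral_exp_two_inner_le _ _) _

/-- The likelihood ratio of `ϑ'` with respect to `ϑ`. -/
def likRatio {N : Fin m → ℕ} [NeZero k] (ϑ ϑ' : Param m k) (x : Sample m k N) : ℝ :=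
  Real.exp (logRatio ϑ ϑ' x) / ∫ x, Real.exp (logRatio ϑ ϑ' x) ∂law N ϑ

lemma continuous_likRatio {N : Fin m → ℕ} [NeZero k] (ϑ ϑ' : Param m k) :
    Continuous (likRatio ϑ ϑ' : Sample m k N → ℝ) := by
  have := continuous_logRatio (N := N) ϑ ϑ'
  unfold likRatio
  fun_prop

lemma integral_exp_logRatio_pos (N : Fin m → ℕ) [NeZero k] (ϑ ϑ' : Param m k) :
    0 < ∫ x, Real.exp (logRatio ϑ ϑ' x) ∂law N ϑ :=
  integral_exp_pos (integrable_sample (by have := continuous_logRatio (N := N) ϑ ϑ'; fun_prop) _)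

lemma integral_law_eq {N : Fin m → ℕ} [NeZero k] (ϑ ϑ' : Param m k) (f : Sample m k N → ℝ) :
    ∫ x, f x ∂law N ϑ' = ∫ x, likRatio ϑ ϑ' x * f x ∂law N ϑ := by
  rw [law_eq_tilted N ϑ ϑ', integral_tilted]
  rfl

lemma integral_likRatio (N : Fin m → ℕ) [NeZero k] (ϑ ϑ' : Param m k) :
    ∫ x, likRatio ϑ ϑ' x ∂law N ϑ = 1 := by
  have := integral_law_eq (N := N) ϑ ϑ' fun _ => 1
  simpa using this.symm

lemma integral_likRatio_sq_le (N : Fin m → ℕ) [NeZero k] (ϑ ϑ' : Param m k) :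
    ∫ x, likRatio ϑ ϑ' x ^ 2 ∂law N ϑ ≤ Real.exp (chiBound N ϑ ϑ') := by
  have h := integral_exp_two_logRatio_le N ϑ ϑ'
  have hp := integral_exp_logRatio_pos N ϑ ϑ'
  unfold likRatio
  simp_rw [div_pow, integral_div]
  rw [div_le_iff₀ (by positivity)]
  refine le_trans (le_of_eq ?_) h
  congr 1
  ext x
  rw [← Real.exp_nat_mul]
  norm_num

/-- Quantitative contiguity: pointwise `L 1_S ≤ a 1_S + L²/a` for the likelihood ratio `L`, and the
second moment of `L` is controlled. -/
lemma measureReal_law_le (N : Fin m → ℕ) [NeZero k] (ϑ ϑ' : Param m k)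
    {s : Set (Sample m k N)} (hs : MeasurableSet s) {a : ℝ} (ha : 0 < a) :
    (law N ϑ').real s ≤ a * (law N ϑ).real s + Real.exp (chiBound N ϑ ϑ') / a := by
  have h1 : (law N ϑ').real s = ∫ x, likRatio ϑ ϑ' x * s.indicator 1 x ∂law N ϑ := by
    rw [← integral_law_eq, integral_indicator_one hs]
  have hc := continuous_likRatio (N := N) ϑ ϑ'
  have hI : Integrable (s.indicator (1 : Sample m k N → ℝ)) (law N ϑ) :=
    (integrable_const (1 : ℝ)).indicator hs
  have hL : Integrable (fun x => likRatio ϑ ϑ' x ^ 2) (law N ϑ) :=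
    integrable_sample (by fun_prop) _
  calc (law N ϑ').real s
      ≤ ∫ x, (a * s.indicator 1 x + likRatio ϑ ϑ' x ^ 2 / a) ∂law N ϑ := by
        rw [h1]
        refine integral_mono_of_nonneg (ae_of_all _ fun x => ?_)
          ((hI.const_mul a).add (hL.div_const a)) (ae_of_all _ fun x => ?_)
        · exact mul_nonneg (div_nonneg (Real.exp_pos _).le (integral_exp_logRatio_pos N ϑ ϑ').le)
            (indicator_nonneg (fun _ _ => zero_le_one) x)
        · by_cases hx : x ∈ s
          · simp only [indicator_of_mem hx, Pi.one_apply, mul_one]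
            rw [← sub_nonneg]
            have : a + likRatio ϑ ϑ' x ^ 2 / a - likRatio ϑ ϑ' x =
              ((likRatio ϑ ϑ' x - a) ^ 2 + a * likRatio ϑ ϑ' x) / a := by field_simp; ring
            rw [this]
            have : 0 ≤ likRatio ϑ ϑ' x :=
              div_nonneg (Real.exp_pos _).le (integral_exp_logRatio_pos N ϑ ϑ').le
            positivity
          · simp only [indicator_of_notMem hx, mul_zero, zero_add]
            positivity
    _ = a * (law N ϑ).real s + (∫ x, likRatio ϑ ϑ' x ^ 2 ∂law N ϑ) / a := by
        rw [integral_add (hI.const_mul a) (hL.div_const a), integral_const_mul, integral_div,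
          integral_indicator_one hs]
    _ ≤ _ := by
        gcongr
        exact integral_likRatio_sq_le N ϑ ϑ'

/-- The difference is at most the mean of `|L - 1|`; by Cauchy–Schwarz its square is at most the
mean of `(L - 1)²`, that is, the second moment of `L` minus one. -/
lemma sq_integral_law_sub_le (N : Fin m → ℕ) [NeZero k] (ϑ ϑ' : Param m k)
    {f : Sample m k N → ℝ} (hf : Measurable f) (hf1 : ∀ x, |f x| ≤ 1) :
    (∫ x, f x ∂law N ϑ' - ∫ x, f x ∂law N ϑ) ^ 2 ≤ Real.exp (chiBound N ϑ ϑ') - 1 := by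
  have hc := continuous_likRatio (N := N) ϑ ϑ'
  have hfi : Integrable f (law N ϑ) := Integrable.of_bound hf.aestronglyMeasurable 1
    (ae_of_all _ hf1)
  have hLi : Integrable (likRatio ϑ ϑ') (law N ϑ) := integrable_sample hc _
  have hLf : Integrable (fun x => likRatio ϑ ϑ' x * f x) (law N ϑ) :=
    hLi.mul_bdd (c := 1) hf.aestronglyMeasurable (ae_of_all _ hf1)
  rw [integral_law_eq ϑ ϑ', ← integral_sub hLf hfi]
  set g : Sample m k N → ℝ := fun x => |likRatio ϑ ϑ' x - 1| with hg
  have hgc : Continuous g := by fun_prop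
  have h1 : |∫ x, (likRatio ϑ ϑ' x * f x - f x) ∂law N ϑ| ≤ ∫ x, g x ∂law N ϑ := by
    refine (abs_integral_le_integral_abs).trans ?_
    refine integral_mono (hLf.sub hfi).abs (integrable_sample hgc _) fun x => ?_
    simp only [hg]
    rw [show likRatio ϑ ϑ' x * f x - f x = (likRatio ϑ ϑ' x - 1) * f x by ring, abs_mul]
    exact mul_le_of_le_one_right (abs_nonneg _) (hf1 x)
  have h2 : (∫ x, g x ∂law N ϑ) ^ 2 ≤ ∫ x, g x ^ 2 ∂law N ϑ := by
    have hmem : MemLp g 2 (law N ϑ) := (memLp_two_iff_integrable_sq hgc.aestronglyMeasurable).2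
      (integrable_sample (by fun_prop) _)
    have := variance_eq_sub hmem
    have h0 := variance_nonneg g (law N ϑ)
    simp only [Pi.pow_apply] at this
    linarith
  have h3 : ∫ x, g x ^ 2 ∂law N ϑ = ∫ x, likRatio ϑ ϑ' x ^ 2 ∂law N ϑ - 1 := by
    have : ∀ x, g x ^ 2 = likRatio ϑ ϑ' x ^ 2 - 2 * likRatio ϑ ϑ' x + 1 := by
      intro x
      simp only [hg, sq_abs]
      ring
    simp_rw [this]
    rw [integral_add (integrable_sample (by fun_prop) _) (integrable_const _),
      integral_sub (integrable_sample (by fun_prop) _) (hLi.const_mul 2), integral_const_mul,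
      integral_likRatio]
    simp
    ring
  calc _ = |∫ x, (likRatio ϑ ϑ' x * f x - f x) ∂law N ϑ| ^ 2 := (sq_abs _).symm
    _ ≤ (∫ x, g x ∂law N ϑ) ^ 2 := by gcongr
    _ ≤ _ := by
      have := integral_likRatio_sq_le N ϑ ϑ'
      linarith

/-! ### The central sequence -/

/-- The central sequence `√n_i (θ_i'X̄_i - A_k(κ))`. -/
def zstat {N : Fin m → ℕ} (κ : ℝ) (θ : Fin m → Vec k) (x : Sample m k N) : Vec m :=
  WithLp.toLp 2 fun i => (√(N i : ℝ))⁻¹ * ∑ j, (inner ℝ (x i j : Vec k) (θ i) - A k κ)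

lemma continuous_zstat {N : Fin m → ℕ} (κ : ℝ) (θ : Fin m → Vec k) :
    Continuous (zstat κ θ : Sample m k N → Vec m) := by
  unfold zstat
  fun_prop

/-- Local perturbation of the concentrations only. -/
def shiftConc (N : Fin m → ℕ) (κ : ℝ) (θ : Fin m → Vec k) (c : Vec m) : Param m k where
  conc i := κ + (√(N i : ℝ))⁻¹ * c i
  loc := θ

/-- With the locations unchanged the log-likelihood ratio is exactly linear in the central sequence,
up to a constant: there is no remainder to control. -/
lemma law_shiftConc [NeZero k] (N : Fin m → ℕ) (κ : ℝ) (θ : Fin m → Vec k) (c : Vec m) :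
    law N (shiftConc N κ θ c) =
      (law N ⟨fun _ => κ, θ⟩).tilted fun x => inner ℝ c (zstat κ θ x) := by
  rw [law_eq_tilted N ⟨fun _ => κ, θ⟩ (shiftConc N κ θ c),
    ← tilted_add_const _ (fun x => inner ℝ c (zstat κ θ x))
      (∑ i, ∑ _j : Fin (N i), (√(N i : ℝ))⁻¹ * c i * A k κ)]
  congr 1
  ext x
  rw [PiLp.inner_apply, ← Finset.sum_add_distrib]
  refine Finset.sum_congr rfl fun i _ => ?_
  simp only [natDiff, shiftConc, zstat, RCLike.inner_apply, conj_trivial]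
  rw [Finset.mul_sum, Finset.sum_mul, ← Finset.sum_add_distrib]
  refine Finset.sum_congr rfl fun j _ => ?_
  rw [← sub_smul, inner_smul_right]
  ring

/-- Independence factorizes the exponential moment, and each factor depends only on the law of
`x'θ`, so `θ` disappears. -/
lemma integral_cexp_zstat [NeZero k] (hk : 2 ≤ k) (N : Fin m → ℕ) (κ : ℝ) {θ : Fin m → Vec k}
    (hθ : ∀ i, ‖θ i‖ = 1) (ζ : Fin m → ℂ) :
    ∫ x, Complex.exp (∑ i, ζ i * (zstat κ θ x i : ℂ)) ∂law N ⟨fun _ => κ, θ⟩ =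
      ∏ i, cosTransform k κ (ζ i * ((√(N i : ℝ))⁻¹ : ℝ)) ^ N i := by
  have e1 : ∀ x : Sample m k N, Complex.exp (∑ i, ζ i * (zstat κ θ x i : ℂ)) =
      ∏ i, ∏ j, Complex.exp (ζ i * ((√(N i : ℝ))⁻¹ : ℝ) *
        ((inner ℝ (x i j : Vec k) (θ i) - A k κ : ℝ) : ℂ)) := by
    intro x
    simp_rw [← Complex.exp_sum]
    congr 1
    refine Finset.sum_congr rfl fun i _ => ?_
    simp only [zstat]
    push_cast
    rw [Finset.mul_sum, Finset.mul_sum]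
    refine Finset.sum_congr rfl fun j _ => ?_
    ring
  simp_rw [e1]
  rw [integral_law_prod N ⟨fun _ => κ, θ⟩ fun i (y : Sph k) =>
    Complex.exp (ζ i * ((√(N i : ℝ))⁻¹ : ℝ) * ((inner ℝ (y : Vec k) (θ i) - A k κ : ℝ) : ℂ))]
  refine Finset.prod_congr rfl fun i _ => ?_
  rw [cosTransform, ← integral_fvml_comp_inner hk κ (hθ i)
    (Continuous.stronglyMeasurable (by fun_prop))]

/-- The normalizing constant of the likelihood ratio `exp (c'z)`. -/
def normConst (k : ℕ) (N : Fin m → ℕ) (κ : ℝ) (c : Vec m) : ℝ :=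
  ∏ i, (∫ t, Real.exp (c i * (√(N i : ℝ))⁻¹ * (t - A k κ)) ∂cosLaw k κ) ^ N i

lemma integral_exp_inner_zstat [NeZero k] (hk : 2 ≤ k) (N : Fin m → ℕ) (κ : ℝ)
    {θ : Fin m → Vec k} (hθ : ∀ i, ‖θ i‖ = 1) (c : Vec m) :
    ∫ x, Real.exp (inner ℝ c (zstat κ θ x)) ∂law N ⟨fun _ => κ, θ⟩ = normConst k N κ c := by
  have h := integral_cexp_zstat hk N κ hθ fun i => (c i : ℂ)
  have e : ∀ x : ℝ, cosTransform k κ x = ((∫ t, Real.exp (x * (t - A k κ)) ∂cosLaw k κ : ℝ) : ℂ) := by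
    intro x
    rw [cosTransform, ← integral_complex_ofReal]
    simp
  have e2 : ∀ x : Sample m k N, Complex.exp (∑ i, (c i : ℂ) * (zstat κ θ x i : ℂ)) =
      ((Real.exp (inner ℝ c (zstat κ θ x)) : ℝ) : ℂ) := by
    intro x
    simp [PiLp.inner_apply, mul_comm]
  simp_rw [e2, ← Complex.ofReal_mul, e] at h
  rw [integral_complex_ofReal] at h
  rw [normConst]
  exact_mod_cast h

lemma normConst_pos (hk : 2 ≤ k) (N : Fin m → ℕ) (κ : ℝ) (c : Vec m) :
    0 < normConst k N κ c := by
  have := isProbabilityMeasure_cosLaw hk κ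
  exact Finset.prod_pos fun i _ => pow_pos
    (integral_exp_pos (integrable_cosLaw_of_continuous hk κ (by fun_prop))) _

lemma normConst_le (hk : 2 ≤ k) (N : Fin m → ℕ) (κ : ℝ) (c : Vec m) :
    normConst k N κ c ≤ Real.exp (‖c‖ ^ 2 / 2) := by
  rw [normConst, EuclideanSpace.norm_sq_eq, Finset.sum_div, Real.exp_sum]
  refine Finset.prod_le_prod (fun i _ => pow_nonneg (integral_nonneg fun _ =>
    (Real.exp_pos _).le) _) fun i _ => ?_
  refine (pow_le_pow_left₀ (integral_nonneg fun _ => (Real.exp_pos _).le)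
    (integral_exp_cosLaw_le hk κ _) _).trans ?_
  rw [← Real.exp_nat_mul]
  refine Real.exp_le_exp.2 ?_
  rw [mul_pow, inv_pow, Real.sq_sqrt (Nat.cast_nonneg _), Real.norm_eq_abs, sq_abs]
  rcases Nat.eq_zero_or_pos (N i) with h | h
  · simp [h]; positivity
  · have : (0 : ℝ) < N i := by exact_mod_cast h
    apply le_of_eq
    field_simp

lemma tendsto_normConst (hk : 2 ≤ k) {N : ℕ → Fin m → ℕ}
    (hN : ∀ i, Tendsto (fun j => N j i) atTop atTop) {κ : ℝ} (hκ : κ ≠ 0) (c : Vec m) :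
    Tendsto (fun j => normConst k (N j) κ c) atTop (𝓝 (Real.exp (D k κ * ‖c‖ ^ 2 / 2))) := by
  have h : Real.exp (D k κ * ‖c‖ ^ 2 / 2) = ∏ i, Real.exp (D k κ * c i ^ 2 / 2) := by
    rw [← Real.exp_sum, EuclideanSpace.norm_sq_eq, Finset.mul_sum, Finset.sum_div]
    simp
  rw [h]
  refine tendsto_finsetProd _ fun i _ => ?_
  have h1 := tendsto_cosTransform_pow hk hκ (c i : ℂ) (hN i)
  have e : ∀ x : ℝ, cosTransform k κ x = ((∫ t, Real.exp (x * (t - A k κ)) ∂cosLaw k κ : ℝ) : ℂ) := by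
    intro x
    rw [cosTransform, ← integral_complex_ofReal]
    simp
  simp_rw [← Complex.ofReal_mul, e] at h1
  have h2 := (Complex.continuous_re.tendsto _).comp h1
  refine (h2.congr fun j => ?_).trans_eq ?_
  · simp only [Function.comp]
    rw [← Complex.ofReal_pow, Complex.ofReal_re]
  · congr 1
    rw [← Complex.exp_ofReal_re]
    congr 2
    push_cast
    rfl

end FvML

namespace FvML

variable {m k : ℕ}

/-! ### The central limit theorem for the central sequence -/

/-- Since the shifted law is an exponential tilt, its characteristic function is the complex Laplace
transform of the base law at `c + is`, divided by its value at `c`. -/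
lemma charFun_map_zstat [NeZero k] (hk : 2 ≤ k) (N : Fin m → ℕ) (κ : ℝ)
    {θ : Fin m → Vec k} (hθ : ∀ i, ‖θ i‖ = 1) (c s : Vec m) :
    charFun ((law N (shiftConc N κ θ c)).map (zstat κ θ)) s =
      (∏ i, cosTransform k κ ((c i + s i * Complex.I) * ((√(N i : ℝ))⁻¹ : ℝ)) ^ N i) /
        (normConst k N κ c : ℂ) := by
  rw [charFun_apply, integral_map (continuous_zstat κ θ).measurable.aemeasurable
    (Continuous.aestronglyMeasurable (by fun_prop)), law_shiftConc, integral_tilted,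
    integral_exp_inner_zstat hk N κ hθ, ← integral_cexp_zstat hk N κ hθ, ← integral_div]
  congr 1
  ext x
  rw [Complex.real_smul, Complex.ofReal_div, Complex.ofReal_exp, div_mul_eq_mul_div,
    ← Complex.exp_add]
  congr 2
  simp only [PiLp.inner_apply, RCLike.inner_apply, conj_trivial]
  push_cast
  rw [Finset.sum_mul, ← Finset.sum_add_distrib]
  refine Finset.sum_congr rfl fun i _ => ?_
  ring

lemma charFun_map_affine_stdGaussian (d : ℝ) (hd : 0 ≤ d) (c s : Vec m) :
    charFun ((stdGaussian (Vec m)).map fun z => √d • z + d • c) s =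
      Complex.exp ((d * inner ℝ c s : ℝ) * Complex.I - (d * ‖s‖ ^ 2 / 2 : ℝ)) := by
  have h1 : (stdGaussian (Vec m)).map (fun z => √d • z + d • c) =
      ((stdGaussian (Vec m)).map fun z => √d • z).map fun z => z + d • c := by
    rw [Measure.map_map (by fun_prop) (by fun_prop)]
    rfl
  rw [h1, charFun_map_add_const, charFun_map_smul, charFun_stdGaussian, ← Complex.exp_add]
  congr 1
  rw [norm_smul, ← Complex.ofReal_pow, mul_pow, Real.norm_of_nonneg (Real.sqrt_nonneg d),
    Real.sq_sqrt hd, real_inner_smul_left, real_inner_comm]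
  push_cast
  ring

/-- The limit is read off from `(c + is)² - c² = 2ics - s²`. The base locations may vary with `j`
because the transform does not involve them. -/
theorem tendstoInDistribution_zstat [NeZero k] (hk : 2 ≤ k) {N : ℕ → Fin m → ℕ}
    (hN : ∀ i, Tendsto (fun j => N j i) atTop atTop) {κ : ℝ} (hκ : κ ≠ 0)
    {θ : ℕ → Fin m → Vec k} (hθ : ∀ᶠ j in atTop, ∀ i, ‖θ j i‖ = 1) (c : Vec m) :
    TendstoInDistribution (fun j x => zstat κ (θ j) x) atTop
      (fun z : Vec m => √(D k κ) • z + D k κ • c)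
      (fun j => law (N j) (shiftConc (N j) κ (θ j) c)) (stdGaussian (Vec m)) := by
  have hD := D_pos hk hκ
  refine ⟨fun j => (continuous_zstat κ (θ j)).measurable.aemeasurable, by fun_prop, ?_⟩
  refine ProbabilityMeasure.tendsto_iff_tendsto_charFun.2 fun s => ?_
  simp only [ProbabilityMeasure.coe_mk]
  rw [charFun_map_affine_stdGaussian _ hD.le]
  have h1 : Tendsto (fun j => (∏ i, cosTransform k κ ((c i + s i * Complex.I) *
      ((√(N j i : ℝ))⁻¹ : ℝ)) ^ N j i) / (normConst k (N j) κ c : ℂ)) atTop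
      (𝓝 ((∏ i, Complex.exp (D k κ * (c i + s i * Complex.I) ^ 2 / 2)) /
        ((Real.exp (D k κ * ‖c‖ ^ 2 / 2) : ℝ) : ℂ))) := by
    refine Tendsto.div ?_ ?_ ?_
    · exact tendsto_finsetProd _ fun i _ => tendsto_cosTransform_pow hk hκ _ (hN i)
    · exact (Complex.continuous_ofReal.tendsto _).comp (tendsto_normConst hk hN hκ c)
    · exact_mod_cast (Real.exp_pos _).ne'
  refine (h1.congr' ?_).trans_eq ?_
  · filter_upwards [hθ] with j hj
    rw [charFun_map_zstat hk (N j) κ hj]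
  · congr 1
    rw [← Complex.exp_sum, Complex.ofReal_exp, ← Complex.exp_sub]
    congr 1
    have e1 : inner ℝ c s = ∑ i, c i * s i := by
      simp [PiLp.inner_apply, mul_comm]
    rw [e1, EuclideanSpace.norm_sq_eq, EuclideanSpace.norm_sq_eq]
    simp only [Real.norm_eq_abs, sq_abs]
    push_cast
    simp only [Finset.mul_sum, Finset.sum_div, Finset.sum_mul, ← Finset.sum_sub_distrib]
    refine Finset.sum_congr rfl fun i _ => ?_
    ring_nf
    simp
    ring

/-! ### Slutsky's theorem on varying probability spaces -/

/-- Bounded Lipschitz functions suffice for weak convergence: their mean changes by at most `L ε`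
where the two variables are close, and by at most their oscillation elsewhere. -/
theorem tendstoInDistribution_of_tendsto_sub {E Ω' : Type*} {Ω : ℕ → Type*}
    [∀ j, MeasurableSpace (Ω j)] {μ : (j : ℕ) → Measure (Ω j)} [∀ j, IsProbabilityMeasure (μ j)]
    [MeasurableSpace Ω'] {μ' : Measure Ω'} [IsProbabilityMeasure μ'] [NormedAddCommGroup E]
    [SecondCountableTopology E] [MeasurableSpace E] [BorelSpace E] {X Y : (j : ℕ) → Ω j → E}
    {Z : Ω' → E} (hXZ : TendstoInDistribution X atTop Z μ μ')
    (hXY : ∀ ε > 0, Tendsto (fun j => (μ j).real {ω | ε ≤ ‖Y j ω - X j ω‖}) atTop (𝓝 0))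
    (hY : ∀ j, Measurable (Y j)) (hX : ∀ j, Measurable (X j)) :
    TendstoInDistribution Y atTop Z μ μ' := by
  have hZ : AEMeasurable Z μ' := hXZ.aemeasurable_limit
  refine ⟨fun j => (hY j).aemeasurable, hZ, ?_⟩
  suffices ∀ (F : E → ℝ) (_ : ∃ C : ℝ, ∀ x y, dist (F x) (F y) ≤ C)
      (_ : ∃ L, LipschitzWith L F),
      Tendsto (fun n => ∫ ω, F ω ∂((μ n).map (Y n))) atTop (𝓝 (∫ ω, F ω ∂(μ'.map Z))) by
    exact tendsto_iff_forall_lipschitz_integral_tendsto.2 this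
  rintro F ⟨M, hFb⟩ ⟨L, hFL⟩
  have hFc : Continuous F := hFL.continuous
  have h1 := tendsto_iff_forall_lipschitz_integral_tendsto.1 hXZ.tendsto F ⟨M, hFb⟩ ⟨L, hFL⟩
  simp only [ProbabilityMeasure.coe_mk] at h1
  have hM : 0 ≤ M := dist_nonneg.trans (hFb 0 0)
  have hint : ∀ j (W : Ω j → E), Measurable W → Integrable (fun ω => F (W ω)) (μ j) := by
    intro j W hW
    refine Integrable.of_bound (hFc.measurable.comp hW).aestronglyMeasurable (‖F 0‖ + M)
      (ae_of_all _ fun a => ?_)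
    have := hFb (W a) 0
    rw [Real.dist_eq] at this
    rw [← sub_le_iff_le_add']
    exact (abs_sub_abs_le_abs_sub _ _).trans this
  have key : ∀ ε > 0, ∀ j, |∫ ω, F ω ∂((μ j).map (Y j)) - ∫ ω, F ω ∂((μ j).map (X j))| ≤
      L * ε + M * (μ j).real {ω | ε ≤ ‖Y j ω - X j ω‖} := by
    intro ε hε j
    have hS : MeasurableSet {ω | ε ≤ ‖Y j ω - X j ω‖} :=
      measurableSet_le measurable_const ((hY j).sub (hX j)).norm
    rw [integral_map (hY j).aemeasurable hFc.aestronglyMeasurable,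
      integral_map (hX j).aemeasurable hFc.aestronglyMeasurable,
      ← integral_sub (hint j _ (hY j)) (hint j _ (hX j))]
    refine abs_integral_le_integral_abs.trans ?_
    have hI : Integrable (fun ω => {ω | ε ≤ ‖Y j ω - X j ω‖}.indicator (1 : Ω j → ℝ) ω) (μ j) :=
      (integrable_const (1 : ℝ)).indicator hS
    have h2 : L * ε + M * (μ j).real {ω | ε ≤ ‖Y j ω - X j ω‖} =
        ∫ ω, (L * ε + M * {ω | ε ≤ ‖Y j ω - X j ω‖}.indicator 1 ω) ∂μ j := by
      rw [integral_add (integrable_const _) (hI.const_mul M),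
        integral_const_mul M, integral_indicator_one hS, integral_const]
      simp
    rw [h2]
    refine integral_mono ((hint j _ (hY j)).sub (hint j _ (hX j))).abs
      ((integrable_const _).add (hI.const_mul M))
      fun ω => ?_
    simp only
    by_cases hω : ω ∈ {ω | ε ≤ ‖Y j ω - X j ω‖}
    · rw [indicator_of_mem hω, ← Real.dist_eq]
      have := hFb (Y j ω) (X j ω)
      have h0 : 0 ≤ L * ε := by positivity
      simp only [Pi.one_apply]
      linarith
    · rw [indicator_of_notMem hω, mul_zero, add_zero, ← Real.dist_eq]
      refine (hFL.dist_le_mul _ _).trans ?_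
      rw [dist_eq_norm]
      have : ‖Y j ω - X j ω‖ ≤ ε := le_of_lt (not_le.1 hω)
      gcongr
  have h3 : Tendsto (fun j => ∫ ω, F ω ∂((μ j).map (Y j)) - ∫ ω, F ω ∂((μ j).map (X j))) atTop
      (𝓝 0) := by
    rw [Metric.tendsto_nhds]
    intro η hη
    -- Makes the Lipschitz contribution at most `η / 2`; `L + 1` allows for `L = 0`.
    have hε : 0 < η / (2 * (L + 1)) := by positivity
    have h4 := ((hXY _ hε).const_mul M)
    rw [mul_zero] at h4
    filter_upwards [h4.eventually_lt_const (half_pos hη)] with j hj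
    rw [Real.dist_eq, sub_zero]
    refine (key _ hε j).trans_lt ?_
    have : L * (η / (2 * (L + 1))) ≤ η / 2 := by
      rw [mul_div_assoc', div_le_div_iff₀ (by positivity) (by positivity)]
      nlinarith [L.2]
    linarith
  simpa using h3.add h1

/-- Joint convergence in distribution with a sequence converging in probability to a constant. -/
theorem tendstoInDistribution_prodMk_const {E E' Ω' : Type*} {Ω : ℕ → Type*}
    [∀ j, MeasurableSpace (Ω j)] {μ : (j : ℕ) → Measure (Ω j)} [∀ j, IsProbabilityMeasure (μ j)]
    [MeasurableSpace Ω'] {μ' : Measure Ω'} [IsProbabilityMeasure μ'] [NormedAddCommGroup E]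
    [SecondCountableTopology E] [MeasurableSpace E] [BorelSpace E]
    [NormedAddCommGroup E'] [SecondCountableTopology E'] [MeasurableSpace E'] [BorelSpace E']
    {X Y : (j : ℕ) → Ω j → E} {V : (j : ℕ) → Ω j → E'} {v : E'}
    {Z : Ω' → E} (hXZ : TendstoInDistribution X atTop Z μ μ')
    (hXY : ∀ ε > 0, Tendsto (fun j => (μ j).real {ω | ε ≤ ‖Y j ω - X j ω‖}) atTop (𝓝 0))
    (hV : ∀ ε > 0, Tendsto (fun j => (μ j).real {ω | ε ≤ ‖V j ω - v‖}) atTop (𝓝 0))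
    (hX : ∀ j, Measurable (X j)) (hY : ∀ j, Measurable (Y j)) (hVm : ∀ j, Measurable (V j)) :
    TendstoInDistribution (fun j ω => (Y j ω, V j ω)) atTop (fun ω => (Z ω, v)) μ μ' := by
  refine tendstoInDistribution_of_tendsto_sub (X := fun j ω => (X j ω, v)) ?_ ?_
    (fun j => (hY j).prodMk (hVm j)) fun j => (hX j).prodMk measurable_const
  · exact hXZ.continuous_comp (g := fun x => (x, v)) (by fun_prop)
  · intro ε hε
    have h := (hXY ε hε).add (hV ε hε)
    rw [add_zero] at h
    refine squeeze_zero (fun _ => measureReal_nonneg) (fun j => ?_) h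
    refine (measureReal_mono ?_).trans (measureReal_union_le _ _)
    intro ω hω
    simp only [Prod.mk_sub_mk, Prod.norm_mk, mem_ofPred_eq, le_max_iff] at hω
    exact hω

end FvML

namespace FvML

variable {m k : ℕ}

/-! ### Convergence in probability on varying probability spaces -/

/-- `X j` converges in `μ j`-probability to the constant `a`. -/
def InProb {E : Type*} [NormedAddCommGroup E] {Ω : ℕ → Type*} [∀ j, MeasurableSpace (Ω j)]
    (μ : (j : ℕ) → Measure (Ω j)) (X : (j : ℕ) → Ω j → E) (a : E) : Prop :=
  ∀ ε > 0, Tendsto (fun j => (μ j).real {ω | ε ≤ ‖X j ω - a‖}) atTop (𝓝 0)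

section InProb

variable {E F : Type*} [NormedAddCommGroup E] [NormedAddCommGroup F] {Ω : ℕ → Type*}
  [∀ j, MeasurableSpace (Ω j)] {μ : (j : ℕ) → Measure (Ω j)}

lemma InProb.comp [∀ j, IsProbabilityMeasure (μ j)] {X : (j : ℕ) → Ω j → E} {a : E} (h : InProb μ X a) {f : E → F}
    (hf : ContinuousAt f a) : InProb μ (fun j ω => f (X j ω)) (f a) := by
  intro ε hε
  obtain ⟨δ, hδ, hδ'⟩ := Metric.continuousAt_iff.1 hf ε hε
  refine squeeze_zero (fun _ => measureReal_nonneg) (fun j => measureReal_mono ?_) (h δ hδ)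
  intro ω hω
  by_contra hlt
  have h1 : dist (X j ω) a < δ := by rw [dist_eq_norm]; exact not_le.1 hlt
  have h2 := hδ' h1
  rw [dist_eq_norm] at h2
  exact absurd h2 (not_lt.2 hω)

lemma tendsto_measureReal_iUnion {ι : Type*} [Fintype ι] {S : ι → (j : ℕ) → Set (Ω j)}
    (h : ∀ i, Tendsto (fun j => (μ j).real (S i j)) atTop (𝓝 0)) :
    Tendsto (fun j => (μ j).real (⋃ i, S i j)) atTop (𝓝 0) := by
  have h1 : Tendsto (fun j => ∑ i, (μ j).real (S i j)) atTop (𝓝 0) := by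
    simpa using tendsto_finsetSum Finset.univ fun i _ => h i
  exact squeeze_zero (fun _ => measureReal_nonneg) (fun j => measureReal_iUnion_fintype_le _) h1

lemma inProb_of_coord [∀ j, IsProbabilityMeasure (μ j)] {X : (j : ℕ) → Ω j → Vec m} {a : Vec m}
    (h : ∀ i, InProb μ (fun j ω => X j ω i) (a i)) : InProb μ X a := by
  intro ε hε
  have hm : (0 : ℝ) < m + 1 := by positivity
  refine squeeze_zero (fun _ => measureReal_nonneg) (fun j => measureReal_mono ?_)
    (tendsto_measureReal_iUnion fun i => h i (ε / (m + 1)) (by positivity))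
  intro ω hω
  by_contra hlt
  simp only [mem_iUnion, mem_ofPred_eq, not_exists, not_le] at hlt
  have h1 : ‖X j ω - a‖ ≤ ∑ i, ‖X j ω i - a i‖ := by
    have h0 : X j ω - a = ∑ i, EuclideanSpace.single i (X j ω i - a i) := by
      ext l
      simp [Finset.sum_apply, Pi.single_apply]
    rw [h0]
    refine (norm_sum_le _ _).trans (le_of_eq ?_)
    simp
  have h2 : ∑ i, ‖X j ω i - a i‖ ≤ ∑ _i : Fin m, ε / (m + 1) :=
    Finset.sum_le_sum fun i _ => (hlt i).le
  have h3 : ∑ _i : Fin m, ε / (m + 1) < ε := by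
    simp only [Finset.sum_const, Finset.card_univ, Fintype.card_fin, nsmul_eq_mul]
    rw [mul_div_assoc', div_lt_iff₀ hm]
    nlinarith
  have : ε ≤ ‖X j ω - a‖ := hω
  linarith

lemma inProb_const {v : ℕ → E} {a : E} (h : Tendsto v atTop (𝓝 a)) :
    InProb μ (fun j _ => v j) a := by
  intro ε hε
  refine tendsto_const_nhds.congr' ?_
  filter_upwards [Metric.tendsto_nhds.1 h ε hε] with j hj
  rw [dist_eq_norm] at hj
  simp [not_le.2 hj]

lemma InProb.prodMk [∀ j, IsProbabilityMeasure (μ j)] {X : (j : ℕ) → Ω j → E} {Y : (j : ℕ) → Ω j → F} {a : E} {b : F}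
    (hX : InProb μ X a) (hY : InProb μ Y b) : InProb μ (fun j ω => (X j ω, Y j ω)) (a, b) := by
  intro ε hε
  have h := (hX ε hε).add (hY ε hε)
  rw [add_zero] at h
  refine squeeze_zero (fun _ => measureReal_nonneg) (fun j => ?_) h
  refine (measureReal_mono ?_).trans (measureReal_union_le _ _)
  intro ω hω
  simp only [Prod.mk_sub_mk, Prod.norm_mk, mem_ofPred_eq, le_max_iff] at hω
  exact hω

end InProb

/-! ### Sample means -/

lemma integral_fvml_comp_sphMap [NeZero k] (κ : ℝ) {θ : Vec k} (U : Vec k ≃ₗᵢ[ℝ] Vec k)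
    (hU : U θ = θ) {f : Sph k → ℝ} (hf : Continuous f) :
    ∫ x, f (sphMap U x) ∂fvml k κ θ = ∫ x, f x ∂fvml k κ θ := by
  rw [fvml, integral_tilted, integral_tilted]
  set Z := ∫ x : Sph k, Real.exp (κ * inner ℝ (x : Vec k) θ) ∂(volume : Measure (Vec k)).toSphere
  have h : ∫ x, (Real.exp (κ * inner ℝ ((sphMap U x : Sph k) : Vec k) θ) / Z) • f (sphMap U x)
      ∂(volume : Measure (Vec k)).toSphere =
      ∫ x : Sph k, (Real.exp (κ * inner ℝ (x : Vec k) θ) / Z) • f x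
        ∂(volume : Measure (Vec k)).toSphere := by
    conv_rhs => rw [← (measurePreserving_sphMap U).map_eq]
    rw [integral_map (measurable_sphMap U).aemeasurable
      (Continuous.aestronglyMeasurable (by fun_prop))]
  rw [← h]
  congr 1
  ext x
  congr 4
  rw [coe_sphMap]
  conv_rhs => rw [← hU, LinearIsometryEquiv.inner_map_map]

/-- The reflection that fixes the line of `θ` preserves the law and negates every direction
orthogonal to `θ`, so only the component of the mean along `θ` survives. -/
lemma integral_inner_fvml [NeZero k] (hk : 2 ≤ k) (κ : ℝ) {θ : Vec k} (hθ : ‖θ‖ = 1)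
    (v : Vec k) : ∫ x : Sph k, inner ℝ (x : Vec k) v ∂fvml k κ θ = A k κ * inner ℝ θ v := by
  have h1 : ∫ x : Sph k, inner ℝ (x : Vec k) θ ∂fvml k κ θ = A k κ := by
    rw [← integral_cosLaw_id hk]
    exact integral_fvml_comp_inner hk κ hθ (f := fun t => t) stronglyMeasurable_id
  set u : Vec k := v - inner ℝ θ v • θ with hu
  have huθ : inner ℝ θ u = 0 := by
    rw [hu, inner_sub_right, real_inner_smul_right, real_inner_self_eq_norm_sq, hθ]
    ring
  have h2 : ∫ x : Sph k, inner ℝ (x : Vec k) u ∂fvml k κ θ = 0 := by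
    let K : Submodule ℝ (Vec k) := Submodule.span ℝ {θ}
    have hKθ : K.reflection θ = θ :=
      Submodule.reflection_mem_subspace_eq_self (Submodule.mem_span_singleton_self θ)
    have hKu : K.reflection u = -u :=
      Submodule.reflection_mem_subspace_orthogonalComplement_eq_neg
        (Submodule.mem_orthogonal_singleton_iff_inner_right.2 huθ)
    have h3 := integral_fvml_comp_sphMap κ K.reflection hKθ
      (f := fun x : Sph k => inner ℝ (x : Vec k) (K.reflection u)) (by fun_prop)
    simp only [coe_sphMap, LinearIsometryEquiv.inner_map_map] at h3
    rw [hKu] at h3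
    simp only [inner_neg_right, integral_neg] at h3
    linarith
  have hv : v = u + inner ℝ θ v • θ := by rw [hu]; abel
  conv_lhs => rw [hv]
  simp only [inner_add_right, real_inner_smul_right]
  rw [integral_add (integrable_sph (by fun_prop) _) (integrable_sph (by fun_prop) _), h2,
    integral_const_mul, h1]
  ring

lemma integral_law_coord [NeZero k] (N : Fin m → ℕ) (ϑ : Param m k) (i : Fin m) (j : Fin (N i))
    {f : Sph k → ℝ} (hf : Continuous f) :
    ∫ x, f (x i j) ∂law N ϑ = ∫ y, f y ∂fvml k (ϑ.conc i) (ϑ.loc i) := by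
  have h1 : (law N ϑ).map (fun x => x i) =
      Measure.pi fun _ : Fin (N i) => fvml k (ϑ.conc i) (ϑ.loc i) :=
    (measurePreserving_eval (fun i => Measure.pi fun _ : Fin (N i) =>
      fvml k (ϑ.conc i) (ϑ.loc i)) i).map_eq
  have h2 : (Measure.pi fun _ : Fin (N i) => fvml k (ϑ.conc i) (ϑ.loc i)).map (fun y => y j) =
      fvml k (ϑ.conc i) (ϑ.loc i) :=
    (measurePreserving_eval (fun _ : Fin (N i) => fvml k (ϑ.conc i) (ϑ.loc i)) j).map_eq
  rw [← h2, integral_map (measurable_pi_apply j).aemeasurable hf.aestronglyMeasurable, ← h1,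
    integral_map (measurable_pi_apply i).aemeasurable (Continuous.aestronglyMeasurable (by fun_prop))]

lemma variance_law_sum_le [NeZero k] (N : Fin m → ℕ) (ϑ : Param m k) (i : Fin m) {f : Sph k → ℝ}
    (hf : Continuous f) (hf1 : ∀ y, |f y| ≤ 1) :
    Var[fun x : Sample m k N => ∑ j, f (x i j); law N ϑ] ≤ N i := by
  have h1 : (law N ϑ).map (fun x => x i) =
      Measure.pi fun _ : Fin (N i) => fvml k (ϑ.conc i) (ϑ.loc i) :=
    (measurePreserving_eval (fun i => Measure.pi fun _ : Fin (N i) =>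
      fvml k (ϑ.conc i) (ϑ.loc i)) i).map_eq
  have h2 : Var[fun x : Sample m k N => ∑ j, f (x i j); law N ϑ] =
      Var[fun y : Fin (N i) → Sph k => ∑ j, f (y j);
        Measure.pi fun _ : Fin (N i) => fvml k (ϑ.conc i) (ϑ.loc i)] := by
    rw [← h1, variance_map (X := fun y : Fin (N i) → Sph k => ∑ j, f (y j))
      (Y := fun x : Sample m k N => x i) (Continuous.aemeasurable (by fun_prop))
      (measurable_pi_apply i).aemeasurable]
    rfl
  have hmem : MemLp f 2 (fvml k (ϑ.conc i) (ϑ.loc i)) :=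
    (memLp_two_iff_integrable_sq hf.aestronglyMeasurable).2 (integrable_sph (by fun_prop) _)
  have h3 := variance_sum_pi (μ := fun _ : Fin (N i) => fvml k (ϑ.conc i) (ϑ.loc i))
    (X := fun _ => f) fun _ => hmem
  have h4 : (∑ j : Fin (N i), fun ω : Fin (N i) → Sph k => f (ω j)) = fun y => ∑ j, f (y j) := by
    ext y; simp
  rw [h4] at h3
  rw [h2, h3]
  have h5 : Var[f; fvml k (ϑ.conc i) (ϑ.loc i)] ≤ 1 := by
    refine (variance_le_expectation_sq hf.aestronglyMeasurable).trans ?_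
    have : ∫ y, (f ^ 2) y ∂fvml k (ϑ.conc i) (ϑ.loc i) ≤
        ∫ _y, (1 : ℝ) ∂fvml k (ϑ.conc i) (ϑ.loc i) := by
      refine integral_mono (integrable_sph (by fun_prop) _) (integrable_const _) fun y => ?_
      simp only [Pi.pow_apply]
      rw [← sq_abs]
      exact pow_le_one₀ (abs_nonneg _) (hf1 y)
    simpa using this
  calc ∑ _j : Fin (N i), Var[f; fvml k (ϑ.conc i) (ϑ.loc i)] ≤ ∑ _j : Fin (N i), (1 : ℝ) :=
        Finset.sum_le_sum fun _ _ => h5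
    _ = N i := by simp

lemma continuous_sampleMean {N : Fin m → ℕ} (i : Fin m) :
    Continuous fun x : Sample m k N => sampleMean x i := by
  unfold sampleMean
  fun_prop

/-- Each coordinate of an observation is bounded by one, so each coordinate of the mean has variance
at most `1 / n_i`; there are `k` of them. -/
lemma integral_norm_sampleMean_sub_sq_le [NeZero k] (hk : 2 ≤ k) (N : Fin m → ℕ)
    {ϑ : Param m k} (i : Fin m) (hθ : ‖ϑ.loc i‖ = 1) (hN : 0 < N i) :
    ∫ x, ‖sampleMean x i - A k (ϑ.conc i) • ϑ.loc i‖ ^ 2 ∂law N ϑ ≤ k / N i := by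
  have hN' : (0 : ℝ) < N i := by exact_mod_cast hN
  have hcoord : ∀ a : Fin k, ∫ x : Sample m k N,
      (sampleMean x i a - A k (ϑ.conc i) * ϑ.loc i a) ^ 2 ∂law N ϑ ≤ 1 / N i := by
    intro a
    let f : Sph k → ℝ := fun y => (y : Vec k) a
    have hf : Continuous f := by fun_prop
    have hf1 : ∀ y, |f y| ≤ 1 := by
      intro y
      have := PiLp.norm_apply_le (y : Vec k) a
      rwa [norm_eq_of_mem_sphere] at this
    have hmean : ∫ x : Sample m k N, ∑ j, f (x i j) ∂law N ϑ =
        N i * (A k (ϑ.conc i) * ϑ.loc i a) := by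
      rw [integral_finsetSum _ fun j _ => integrable_sample (by fun_prop) _]
      have : ∀ j : Fin (N i), ∫ x : Sample m k N, f (x i j) ∂law N ϑ =
          A k (ϑ.conc i) * ϑ.loc i a := by
        intro j
        rw [integral_law_coord N ϑ i j hf]
        have := integral_inner_fvml hk (ϑ.conc i) hθ (EuclideanSpace.single a 1)
        simpa [EuclideanSpace.inner_single_right] using this
      simp [this]
    have hv := variance_law_sum_le N ϑ i hf hf1
    rw [variance_eq_integral (Continuous.aemeasurable (by fun_prop)), hmean] at hv
    have e : ∀ x : Sample m k N, (sampleMean x i a - A k (ϑ.conc i) * ϑ.loc i a) ^ 2 =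
        (∑ j, f (x i j) - N i * (A k (ϑ.conc i) * ϑ.loc i a)) ^ 2 / (N i : ℝ) ^ 2 := by
      intro x
      have : sampleMean x i a = (N i : ℝ)⁻¹ * ∑ j, f (x i j) := by
        simp [sampleMean, f, Finset.sum_apply]
      rw [this, ← div_pow]
      congr 1
      field_simp
    simp_rw [e]
    rw [integral_div, div_le_div_iff₀ (by positivity) hN']
    nlinarith
  have e2 : ∀ x : Sample m k N, ‖sampleMean x i - A k (ϑ.conc i) • ϑ.loc i‖ ^ 2 =
      ∑ a, (sampleMean x i a - A k (ϑ.conc i) * ϑ.loc i a) ^ 2 := by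
    intro x
    rw [EuclideanSpace.norm_sq_eq]
    simp
  have hcs := continuous_sampleMean (k := k) (N := N) i
  simp_rw [e2]
  rw [integral_finsetSum _ fun a _ => integrable_sample (by fun_prop) _]
  calc _ ≤ ∑ _a : Fin k, 1 / (N i : ℝ) := Finset.sum_le_sum fun a _ => hcoord a
    _ = k / N i := by simp [div_eq_mul_inv]

lemma measureReal_sampleMean_le [NeZero k] (hk : 2 ≤ k) (N : Fin m → ℕ)
    {ϑ : Param m k} (i : Fin m) (hθ : ‖ϑ.loc i‖ = 1) {M : ℝ} (hM : 0 < M) :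
    (law N ϑ).real {x | M < √(N i : ℝ) * ‖sampleMean x i - A k (ϑ.conc i) • ϑ.loc i‖} ≤
      k / M ^ 2 := by
  rcases Nat.eq_zero_or_pos (N i) with h0 | hN
  · have : {x : Sample m k N | M < √(N i : ℝ) * ‖sampleMean x i - A k (ϑ.conc i) • ϑ.loc i‖} = ∅ := by
      ext x
      simp [h0, hM.le]
    rw [this, measureReal_empty]
    positivity
  have hN' : (0 : ℝ) < N i := by exact_mod_cast hN
  have hcs := continuous_sampleMean (k := k) (N := N) i
  have h1 := mul_meas_ge_le_integral_of_nonneg (μ := law N ϑ)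
    (f := fun x => ‖sampleMean x i - A k (ϑ.conc i) • ϑ.loc i‖ ^ 2)
    (ae_of_all _ fun x => by positivity) (integrable_sample (by fun_prop) _) (M ^ 2 / N i)
  have h2 := h1.trans (integral_norm_sampleMean_sub_sq_le hk N i hθ hN)
  have h3 : (law N ϑ).real {x | M < √(N i : ℝ) * ‖sampleMean x i - A k (ϑ.conc i) • ϑ.loc i‖} ≤
      (law N ϑ).real {x | M ^ 2 / N i ≤ ‖sampleMean x i - A k (ϑ.conc i) • ϑ.loc i‖ ^ 2} := by
    refine measureReal_mono fun x hx => ?_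
    simp only [mem_ofPred_eq] at hx ⊢
    rw [div_le_iff₀ hN']
    have := pow_le_pow_left₀ hM.le hx.le 2
    rw [mul_pow, Real.sq_sqrt hN'.le] at this
    linarith
  refine h3.trans ?_
  rw [le_div_iff₀ (by positivity)]
  rw [div_mul_eq_mul_div, div_le_div_iff_of_pos_right hN'] at h2
  linarith

lemma AssumptionA.pos {N : ℕ → Fin m → ℕ} {r : Fin m → ℝ} (hA : AssumptionA N r) (i : Fin m) :
    0 < r i := by
  refine lt_of_le_of_ne (ge_of_tendsto' (hA.ratio_tendsto i) fun j => ?_) (hA.ne_zero i).symm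
  unfold ratio
  positivity

lemma AssumptionA.tendsto_size {N : ℕ → Fin m → ℕ} {r : Fin m → ℝ} (hA : AssumptionA N r)
    (i : Fin m) : Tendsto (fun j => N j i) atTop atTop := by
  have h1 : Tendsto (fun j => (total (N j) : ℝ)) atTop atTop :=
    tendsto_natCast_atTop_atTop.comp hA.total_tendsto
  have h2 := (hA.ratio_tendsto i).pos_mul_atTop (hA.pos i) h1
  refine tendsto_natCast_atTop_iff.1 (h2.congr' ?_)
  filter_upwards [hA.total_tendsto.eventually_gt_atTop 0] with j hj
  have : (0 : ℝ) < total (N j) := by exact_mod_cast hj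
  simp only [ratio]
  field_simp

lemma tendsto_sqrt_size {N : ℕ → Fin m → ℕ}
    {i : Fin m} (hN : Tendsto (fun j => N j i) atTop atTop) :
    Tendsto (fun j => √(N j i : ℝ)) atTop atTop :=
  Real.tendsto_sqrt_atTop.comp (tendsto_natCast_atTop_atTop.comp hN)

lemma inProb_sampleMean [NeZero k] (hk : 2 ≤ k) {N : ℕ → Fin m → ℕ} {ϑ : Param m k} {i : Fin m}
    (hN : Tendsto (fun j => N j i) atTop atTop) (hθ : ‖ϑ.loc i‖ = 1) :
    InProb (fun j => law (N j) ϑ) (fun _ x => sampleMean x i) (A k (ϑ.conc i) • ϑ.loc i) := by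
  intro ε hε
  have hs := tendsto_sqrt_size hN
  have h1 : Tendsto (fun j => (k : ℝ) / (ε / 2 * √(N j i : ℝ)) ^ 2) atTop (𝓝 0) := by
    refine Tendsto.const_div_atTop ?_ _
    exact (tendsto_pow_atTop (by norm_num)).comp (hs.const_mul_atTop (by positivity))
  refine squeeze_zero' (Eventually.of_forall fun _ => measureReal_nonneg) ?_ h1
  filter_upwards [hs.eventually_gt_atTop 0] with j hj
  refine le_trans (measureReal_mono fun x hx => ?_)
    (measureReal_sampleMean_le hk (N j) i hθ (by positivity : 0 < ε / 2 * √(N j i : ℝ)))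
  simp only [mem_ofPred_eq] at hx ⊢
  nlinarith

/-- Normalization is Lipschitz near `a θ`, with a deterministic constant. The bound also covers `x =
0`, where the normalized vector is `0` by convention, so no exceptional event is needed in proving
tightness. -/
lemma norm_normalize_sub_le {θ x : Vec k} (hθ : ‖θ‖ = 1) {a : ℝ} (ha : 0 < a) :
    ‖‖x‖⁻¹ • x - θ‖ ≤ 2 / a * ‖x - a • θ‖ := by
  rcases eq_or_ne x 0 with rfl | hx
  · simp [hθ, norm_smul, abs_of_pos ha, ha.ne']
  have hx' : 0 < ‖x‖ := norm_pos_iff.2 hx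
  have h1 : a • (‖x‖⁻¹ • x - θ) = (x - a • θ) - ((‖x‖ - a) * ‖x‖⁻¹) • x := by
    rw [smul_sub, smul_smul, sub_mul, mul_inv_cancel₀ hx'.ne', sub_smul, one_smul]
    abel
  have h2 : ‖((‖x‖ - a) * ‖x‖⁻¹) • x‖ ≤ ‖x - a • θ‖ := by
    rw [norm_smul, norm_mul, norm_inv, norm_norm, mul_assoc, inv_mul_cancel₀ hx'.ne', mul_one]
    have h3 : ‖a • θ‖ = a := by rw [norm_smul, hθ, mul_one, Real.norm_of_nonneg ha.le]
    have := abs_norm_sub_norm_le x (a • θ)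
    rwa [h3] at this
  have h4 : a * ‖‖x‖⁻¹ • x - θ‖ ≤ 2 * ‖x - a • θ‖ := by
    have : ‖a • (‖x‖⁻¹ • x - θ)‖ = a * ‖‖x‖⁻¹ • x - θ‖ := by
      rw [norm_smul, Real.norm_of_nonneg ha.le]
    rw [← this, h1]
    refine (norm_sub_le _ _).trans ?_
    linarith
  rw [div_mul_eq_mul_div, le_div_iff₀ ha]
  linarith

lemma measurable_sphericalMean {N : Fin m → ℕ} (i : Fin m) :
    Measurable fun x : Sample m k N => sphericalMean x i := by
  have := (continuous_sampleMean (k := k) (N := N) i).measurable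
  unfold sphericalMean
  fun_prop

theorem rootNConsistent_sphericalMean [NeZero k] (hk : 2 ≤ k) {N : ℕ → Fin m → ℕ}
    (hN : ∀ i, Tendsto (fun j => N j i) atTop atTop) {ϑ : Param m k} (hϑ : ϑ ∈ paramSpace m k) :
    RootNConsistent N (fun _ x => sphericalMean x) ϑ := by
  refine ⟨fun j i => measurable_sphericalMean i, ?_, fun i ε hε => ?_⟩
  · have hS : ∀ j, MeasurableSet {x : Sample m k (N j) | ∀ i, ‖sphericalMean x i‖ = 1} := by
      intro j
      have := fun i => measurable_sphericalMean (k := k) (N := N j) i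
      rw [ofPred_forall]
      exact MeasurableSet.iInter fun i => measurableSet_eq_fun (this i).norm measurable_const
    have h1 : Tendsto (fun j => (law (N j) ϑ).real
        {x : Sample m k (N j) | ∀ i, ‖sphericalMean x i‖ = 1}ᶜ) atTop (𝓝 0) := by
      refine squeeze_zero (fun _ => measureReal_nonneg) (fun j => measureReal_mono ?_)
        (tendsto_measureReal_iUnion (μ := fun j => law (N j) ϑ) fun i =>
          inProb_sampleMean hk (hN i) (hϑ i).2 (A k (ϑ.conc i)) (A_pos hk (hϑ i).1))
      intro x hx
      simp only [mem_compl_iff, mem_ofPred_eq, not_forall] at hx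
      obtain ⟨i, hi⟩ := hx
      refine mem_iUnion.2 ⟨i, ?_⟩
      have h0 : sampleMean x i = 0 := by
        by_contra h0
        apply hi
        rw [sphericalMean, norm_smul, norm_inv, norm_norm,
          inv_mul_cancel₀ (norm_ne_zero_iff.2 h0)]
      simp only [mem_ofPred_eq, h0, zero_sub, norm_neg, norm_smul, (hϑ i).2, mul_one]
      exact le_abs_self _
    have h2 : Tendsto (fun j => ENNReal.ofReal (1 - (law (N j) ϑ).real
        {x : Sample m k (N j) | ∀ i, ‖sphericalMean x i‖ = 1}ᶜ)) atTop (𝓝 1) := by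
      have := ENNReal.tendsto_ofReal (h1.const_sub 1)
      simpa using this
    refine h2.congr fun j => ?_
    rw [probReal_compl_eq_one_sub (hS j), sub_sub_cancel, ofReal_measureReal]
  · have ha := A_pos hk (hϑ i).1
    set a := A k (ϑ.conc i) with ha'
    obtain ⟨M, hM0, hM⟩ : ∃ M : ℝ, 0 < M ∧ (k : ℝ) / M ^ 2 ≤ ε := by
      have : Tendsto (fun M : ℝ => (k : ℝ) / M ^ 2) atTop (𝓝 0) :=
        Tendsto.const_div_atTop (tendsto_pow_atTop (by norm_num)) _
      obtain ⟨M, h1, h2⟩ := ((this.eventually_le_const hε).and (eventually_gt_atTop 0)).exists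
      exact ⟨M, h2, h1⟩
    refine ⟨2 / a * M, Eventually.of_forall fun j => ?_⟩
    rw [← ofReal_measureReal]
    refine ENNReal.ofReal_le_ofReal ((measureReal_mono fun x hx => ?_).trans
      ((measureReal_sampleMean_le hk (N j) i (hϑ i).2 hM0).trans hM))
    simp only [mem_ofPred_eq] at hx ⊢
    have h1 := norm_normalize_sub_le (x := sampleMean x i) (hϑ i).2 ha
    have h2 : 2 / a * M < 2 / a * (√(N j i : ℝ) * ‖sampleMean x i - a • ϑ.loc i‖) := by
      calc _ < _ := hx
        _ ≤ √(N j i : ℝ) * (2 / a * ‖sampleMean x i - a • ϑ.loc i‖) := by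
          gcongr
          exact h1
        _ = _ := by ring
    exact lt_of_mul_lt_mul_left h2 (by positivity)

end FvML

namespace FvML

variable {m k : ℕ}

/-! ### The estimator of the concentration -/

lemma invFunOn_A_eq (hk : 2 ≤ k) {κ : ℝ} (hκ : 0 < κ) :
    Function.invFunOn (A k) (Ioi 0) (A k κ) = κ :=
  (strictMono_A hk).injective (Function.invFunOn_eq ⟨κ, hκ, rfl⟩)

/-- On the image of `(0,∞)`, an interval, the inverse is monotone; off that image `invFunOn` takes
one default value. -/
lemma measurable_invFunOn_A (hk : 2 ≤ k) : Measurable (Function.invFunOn (A k) (Ioi 0)) := by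
  have hA : Continuous (A k) := (differentiable_A hk).continuous
  have hconn : OrdConnected (A k '' Ioi 0) :=
    ((isPreconnected_Ioi).image _ hA.continuousOn).ordConnected
  have hS : MeasurableSet (A k '' Ioi 0) := hconn.measurableSet
  have hmono : MonotoneOn (Function.invFunOn (A k) (Ioi 0)) (A k '' Ioi 0) := by
    rintro _ ⟨a, ha, rfl⟩ _ ⟨b, hb, rfl⟩ hab
    rw [invFunOn_A_eq hk ha, invFunOn_A_eq hk hb]
    exact (strictMono_A hk).le_iff_le.1 hab
  have hconst : ∃ c, ∀ y ∉ A k '' Ioi 0, Function.invFunOn (A k) (Ioi 0) y = c := by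
    refine ⟨Classical.choice inferInstance, fun y hy => ?_⟩
    exact Function.invFunOn_neg fun ⟨a, ha, h⟩ => hy ⟨a, ha, h⟩
  obtain ⟨c, hc⟩ := hconst
  refine measurable_of_restrict_of_restrict_compl hS ?_ ?_
  · refine Monotone.measurable (f := Set.domRestrict (A k '' Ioi 0) (Function.invFunOn (A k) (Ioi 0))) ?_
    exact fun a b hab => hmono a.2 b.2 hab
  · have : Set.domRestrict (A k '' Ioi 0)ᶜ (Function.invFunOn (A k) (Ioi 0)) = fun _ => c :=
      funext fun y => hc y y.2
    rw [this]
    exact measurable_const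

lemma continuousAt_invFunOn_A (hk : 2 ≤ k) {κ : ℝ} (hκ : 0 < κ) :
    ContinuousAt (Function.invFunOn (A k) (Ioi 0)) (A k κ) := by
  have hA : Continuous (A k) := (differentiable_A hk).continuous
  have hm := strictMono_A hk
  rw [ContinuousAt, invFunOn_A_eq hk hκ, Metric.tendsto_nhds]
  intro ε hε
  -- The bound by `κ / 2` keeps the preimages found by the intermediate value theorem in `(0,∞)`,
  -- where `invFunOn` really inverts `A k`.
  set η := min (ε / 2) (κ / 2) with hη
  have hη0 : 0 < η := lt_min (by positivity) (by positivity)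
  have hη1 : η ≤ ε / 2 := min_le_left _ _
  have hη2 : η ≤ κ / 2 := min_le_right _ _
  filter_upwards [Icc_mem_nhds (hm (show κ - η < κ by linarith))
    (hm (show κ < κ + η by linarith))] with y hy
  obtain ⟨u, hu, rfl⟩ := intermediate_value_Icc (show κ - η ≤ κ + η by linarith)
    hA.continuousOn hy
  rw [invFunOn_A_eq hk (by linarith [hu.1] : 0 < u), Real.dist_eq, abs_lt]
  constructor <;> linarith [hu.1, hu.2]

lemma measurable_pooledConc (hk : 2 ≤ k) {N : Fin m → ℕ} :
    Measurable (pooledConc : Sample m k N → ℝ) := by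
  have h1 := measurable_invFunOn_A hk
  have h2 : ∀ i, Measurable fun x : Sample m k N => concHat x i := fun i =>
    h1.comp (continuous_sampleMean i).norm.measurable
  unfold pooledConc
  fun_prop

lemma measurable_QHom (hk : 2 ≤ k) {N : Fin m → ℕ} {θhat : Sample m k N → Fin m → Vec k}
    (hθ : ∀ i, Measurable fun x => θhat x i) :
    Measurable fun x : Sample m k N => QHom (θhat x) x := by
  have h1 := (measurable_D hk).comp (measurable_pooledConc (N := N) hk)
  have h2 := fun i => (continuous_sampleMean (k := k) (N := N) i).measurable
  simp only [Function.comp_def] at h1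
  unfold QHom
  fun_prop

lemma sum_ratio {N : Fin m → ℕ} (h : 0 < total N) : ∑ i, ratio N i = 1 := by
  have h' : (0 : ℝ) < total N := by exact_mod_cast h
  simp only [ratio, ← Finset.sum_div]
  rw [← Nat.cast_sum, ← total, div_self h'.ne']

lemma AssumptionA.sum_eq_one {N : ℕ → Fin m → ℕ} {r : Fin m → ℝ} (hA : AssumptionA N r) :
    ∑ i, r i = 1 := by
  refine tendsto_nhds_unique (tendsto_finsetSum Finset.univ fun i _ => hA.ratio_tendsto i) ?_
  refine tendsto_const_nhds.congr' ?_
  filter_upwards [hA.total_tendsto.eventually_gt_atTop 0] with j hj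
  exact (sum_ratio hj).symm

lemma inProb_concHat [NeZero k] (hk : 2 ≤ k) {N : ℕ → Fin m → ℕ} {ϑ : Param m k} {i : Fin m}
    (hN : Tendsto (fun j => N j i) atTop atTop) (hκ : 0 < ϑ.conc i) (hθ : ‖ϑ.loc i‖ = 1) :
    InProb (fun j => law (N j) ϑ) (fun _ x => concHat x i) (ϑ.conc i) := by
  have h1 := (inProb_sampleMean hk hN hθ).comp (f := fun v => ‖v‖) continuous_norm.continuousAt
  have h2 : ‖A k (ϑ.conc i) • ϑ.loc i‖ = A k (ϑ.conc i) := by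
    rw [norm_smul, hθ, mul_one, Real.norm_of_nonneg (A_pos hk hκ).le]
  simp only [h2] at h1
  have h3 := h1.comp (continuousAt_invFunOn_A hk hκ)
  rwa [invFunOn_A_eq hk hκ] at h3

/-- The weights `n_i / n` sum to one, so the pooled error is at most the largest of the individual
errors. -/
lemma inProb_pooledConc [NeZero k] (hk : 2 ≤ k) {N : ℕ → Fin m → ℕ} {r : Fin m → ℝ}
    (hA : AssumptionA N r) {κ : ℝ} (hκ : 0 < κ) {ϑ : Param m k} (hc : ∀ i, ϑ.conc i = κ)
    (hθ : ∀ i, ‖ϑ.loc i‖ = 1) :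
    InProb (fun j => law (N j) ϑ) (fun _ x => pooledConc x) κ := by
  intro ε hε
  have h0 : ∀ i, Tendsto (fun j => (law (N j) ϑ).real {x | ε / 2 ≤ ‖concHat x i - κ‖})
      atTop (𝓝 0) := by
    intro i
    have h := inProb_concHat hk (hA.tendsto_size i) (by rw [hc i]; exact hκ) (hθ i)
    rw [hc i] at h
    exact h (ε / 2) (by positivity)
  have h := tendsto_measureReal_iUnion h0
  refine squeeze_zero' (Eventually.of_forall fun _ => measureReal_nonneg) ?_ h
  filter_upwards [hA.total_tendsto.eventually_gt_atTop 0] with j hj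
  refine measureReal_mono fun x hx => ?_
  by_contra hlt
  simp only [mem_iUnion, mem_ofPred_eq, not_exists, not_le] at hlt
  have h1 : pooledConc x - κ = ∑ i, ratio (N j) i * (concHat x i - κ) := by
    simp only [mul_sub, Finset.sum_sub_distrib, ← Finset.sum_mul, sum_ratio hj, one_mul]
    rfl
  have h2 : ‖pooledConc x - κ‖ ≤ ∑ i, ratio (N j) i * (ε / 2) := by
    rw [h1]
    refine (norm_sum_le _ _).trans (Finset.sum_le_sum fun i _ => ?_)
    have h0 : 0 ≤ ratio (N j) i := by unfold ratio; positivity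
    rw [norm_mul, Real.norm_of_nonneg h0]
    exact mul_le_mul_of_nonneg_left (hlt i).le h0
  rw [← Finset.sum_mul, sum_ratio hj] at h2
  have : ε ≤ ‖pooledConc x - κ‖ := hx
  linarith

/-! ### Contiguity of local perturbations -/

/-- The scaling of the local parameter is just `n_i^(-1/2)`; when the total is zero both sides
vanish by the convention on inverses. -/
lemma perturb_coef (N : Fin m → ℕ) (i : Fin m) :
    (√(total N : ℝ))⁻¹ * (√(ratio N i))⁻¹ = (√(N i : ℝ))⁻¹ := by
  rcases Nat.eq_zero_or_pos (total N) with h | h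
  · have : N i = 0 := by
      have h0 : N i ≤ total N := Finset.single_le_sum (f := N) (fun _ _ => Nat.zero_le _)
        (Finset.mem_univ i)
      omega
    simp [h, this]
  · have h' : (0 : ℝ) < total N := by exact_mod_cast h
    rw [ratio, Real.sqrt_div (Nat.cast_nonneg _), inv_div, ← mul_div_assoc,
      inv_mul_cancel₀ (Real.sqrt_pos.2 h').ne', one_div]

lemma perturb_eq (N : Fin m → ℕ) (ϑ : Param m k) (c : Fin m → ℝ) (t : Fin m → Vec k) :
    perturb N ϑ c t = ⟨fun i => ϑ.conc i + (√(N i : ℝ))⁻¹ * c i,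
      fun i => ϑ.loc i + (√(N i : ℝ))⁻¹ • t i⟩ := by
  simp only [perturb, perturb_coef]

/-- Contiguity: a bounded second moment of the likelihood ratio carries vanishing probabilities from
one sequence of laws to the other. -/
lemma tendsto_measureReal_of_chiBound_le [NeZero k] {N : ℕ → Fin m → ℕ} {ϑ ϑ' : ℕ → Param m k}
    {K : ℝ} (hK : ∀ᶠ j in atTop, chiBound (N j) (ϑ j) (ϑ' j) ≤ K)
    {S : (j : ℕ) → Set (Sample m k (N j))} (hS : ∀ j, MeasurableSet (S j))
    (h : Tendsto (fun j => (law (N j) (ϑ j)).real (S j)) atTop (𝓝 0)) :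
    Tendsto (fun j => (law (N j) (ϑ' j)).real (S j)) atTop (𝓝 0) := by
  rw [Metric.tendsto_nhds]
  intro ε hε
  -- With this threshold on the likelihood ratio, the tail term `exp K / a` equals `ε / 2`.
  have ha : 0 < 2 * Real.exp K / ε := by positivity
  have h2 := h.const_mul (2 * Real.exp K / ε)
  rw [mul_zero] at h2
  filter_upwards [hK, h2.eventually_lt_const (half_pos hε)] with j hj1 hj2
  rw [Real.dist_eq, sub_zero, abs_of_nonneg measureReal_nonneg]
  refine (measureReal_law_le (N j) (ϑ j) (ϑ' j) (hS j) ha).trans_lt ?_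
  have h3 : Real.exp (chiBound (N j) (ϑ j) (ϑ' j)) / (2 * Real.exp K / ε) ≤ ε / 2 := by
    rw [div_div_eq_mul_div, div_le_div_iff₀ (by positivity) (by positivity)]
    have := Real.exp_le_exp.2 hj1
    nlinarith
  linarith

lemma tendsto_integral_sub_of_chiBound [NeZero k] {N : ℕ → Fin m → ℕ} {ϑ ϑ' : ℕ → Param m k}
    (h : Tendsto (fun j => chiBound (N j) (ϑ j) (ϑ' j)) atTop (𝓝 0))
    {f : (j : ℕ) → Sample m k (N j) → ℝ} (hf : ∀ j, Measurable (f j)) (hf1 : ∀ j x, |f j x| ≤ 1) :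
    Tendsto (fun j => ∫ x, f j x ∂law (N j) (ϑ' j) - ∫ x, f j x ∂law (N j) (ϑ j)) atTop (𝓝 0) := by
  have h1 : Tendsto (fun j => Real.exp (chiBound (N j) (ϑ j) (ϑ' j)) - 1) atTop (𝓝 0) := by
    have := ((Real.continuous_exp.tendsto 0).comp h).sub_const 1
    simpa using this
  have h2 := squeeze_zero (fun j => sq_nonneg _)
    (fun j => sq_integral_law_sub_le (N j) (ϑ j) (ϑ' j) (hf j) (hf1 j)) h1
  have h3 := (Real.continuous_sqrt.tendsto 0).comp h2
  simp only [Function.comp_def, Real.sqrt_sq_eq_abs, Real.sqrt_zero] at h3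
  exact (tendsto_zero_iff_abs_tendsto_zero _).2 h3

lemma natCast_mul_inv_sqrt_sq_le (n : ℕ) : (n : ℝ) * (√(n : ℝ))⁻¹ ^ 2 ≤ 1 := by
  rw [inv_pow, Real.sq_sqrt (Nat.cast_nonneg n)]
  exact mul_inv_le_one

lemma inv_sqrt_natCast_le_one (n : ℕ) : (√(n : ℝ))⁻¹ ≤ 1 := by
  rcases Nat.eq_zero_or_pos n with h | h
  · simp [h]
  · exact inv_le_one_of_one_le₀ (Real.one_le_sqrt.2 (by exact_mod_cast h))

/-- A local perturbation moves the natural parameter of sample `i` by `O(n_i^(-1/2))`, so `n_i`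
times the square of the displacement stays bounded. Here the locations move as well as the
concentrations. -/
lemma chiBound_local_le (N : Fin m → ℕ) {κ : ℝ} {θ : Fin m → Vec k} (hθ : ∀ i, ‖θ i‖ = 1)
    {c : Fin m → ℝ} {t : Fin m → Vec k} {C T : ℝ} (hC : ∀ i, |c i| ≤ C) (hT : ∀ i, ‖t i‖ ≤ T) :
    chiBound N ⟨fun _ => κ, θ⟩ ⟨fun i => κ + (√(N i : ℝ))⁻¹ * c i,
      fun i => θ i + (√(N i : ℝ))⁻¹ • t i⟩ ≤ m * (2 * (|κ| * T + C + C * T) ^ 2) := by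
  have key : ∀ i, (N i : ℝ) * (2 * ‖natDiff (⟨fun _ => κ, θ⟩ : Param m k)
      ⟨fun i => κ + (√(N i : ℝ))⁻¹ * c i, fun i => θ i + (√(N i : ℝ))⁻¹ • t i⟩ i‖ ^ 2) ≤
      2 * (|κ| * T + C + C * T) ^ 2 := by
    intro i
    have hC0 : 0 ≤ C := (abs_nonneg _).trans (hC i)
    have hT0 : 0 ≤ T := (norm_nonneg _).trans (hT i)
    set s := (√(N i : ℝ))⁻¹ with hs
    have hs0 : 0 ≤ s := by positivity
    have hs1 : s ≤ 1 := inv_sqrt_natCast_le_one _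
    have e : natDiff (⟨fun _ => κ, θ⟩ : Param m k)
        ⟨fun i => κ + (√(N i : ℝ))⁻¹ * c i, fun i => θ i + (√(N i : ℝ))⁻¹ • t i⟩ i =
        s • (κ • t i + c i • θ i + (s * c i) • t i) := by
      simp only [natDiff, ← hs]
      module
    have h1 : ‖κ • t i + c i • θ i + (s * c i) • t i‖ ≤ |κ| * T + C + C * T := by
      refine (norm_add₃_le).trans ?_
      simp only [norm_smul, hθ, mul_one, Real.norm_eq_abs, abs_mul, abs_of_nonneg hs0]
      gcongr
      · exact hT i
      · exact hC i
      · calc s * |c i| ≤ 1 * C := mul_le_mul hs1 (hC i) (abs_nonneg _) zero_le_one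
          _ = C := one_mul C
      · exact hT i
    rw [e, norm_smul, Real.norm_of_nonneg hs0, mul_pow]
    have h2 := pow_le_pow_left₀ (norm_nonneg _) h1 2
    have h3 := natCast_mul_inv_sqrt_sq_le (N i)
    calc (N i : ℝ) * (2 * (s ^ 2 * ‖κ • t i + c i • θ i + (s * c i) • t i‖ ^ 2))
        = 2 * (((N i : ℝ) * s ^ 2) * ‖κ • t i + c i • θ i + (s * c i) • t i‖ ^ 2) := by ring
      _ ≤ 2 * (1 * (|κ| * T + C + C * T) ^ 2) := by gcongr
      _ = _ := by ring
  calc chiBound N _ _ ≤ ∑ _i : Fin m, 2 * (|κ| * T + C + C * T) ^ 2 :=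
        Finset.sum_le_sum fun i _ => key i
    _ = _ := by simp

lemma chiBound_shiftConc_le (N : Fin m → ℕ) {κ : ℝ} {θ : Fin m → Vec k} (hθ : ∀ i, ‖θ i‖ = 1)
    (c c' : Vec m) :
    chiBound N (shiftConc N κ θ c) (shiftConc N κ θ c') ≤ ∑ i, 2 * (c' i - c i) ^ 2 := by
  refine Finset.sum_le_sum fun i _ => ?_
  have e : natDiff (shiftConc N κ θ c) (shiftConc N κ θ c') i =
      ((√(N i : ℝ))⁻¹ * (c' i - c i)) • θ i := by
    simp only [natDiff, shiftConc]
    module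
  rw [e, norm_smul, hθ, mul_one, Real.norm_eq_abs, sq_abs, mul_pow]
  have h3 := natCast_mul_inv_sqrt_sq_le (N i)
  calc (N i : ℝ) * (2 * ((√(N i : ℝ))⁻¹ ^ 2 * (c' i - c i) ^ 2))
      = 2 * (((N i : ℝ) * (√(N i : ℝ))⁻¹ ^ 2) * (c' i - c i) ^ 2) := by ring
    _ ≤ 2 * (1 * (c' i - c i) ^ 2) := by gcongr
    _ = _ := by ring

lemma chiBound_nonneg (N : Fin m → ℕ) (ϑ ϑ' : Param m k) : 0 ≤ chiBound N ϑ ϑ' :=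
  Finset.sum_nonneg fun i _ => by positivity

end FvML

namespace FvML

variable {m k : ℕ}

/-! ### Joint limit of the sample projections -/

/-- The vector `√n_i (θ_i'X̄_i - A_k(κ))`. -/
def wstat {N : Fin m → ℕ} (κ : ℝ) (θ : Fin m → Vec k) (x : Sample m k N) : Vec m :=
  WithLp.toLp 2 fun i => √(N i : ℝ) * (inner ℝ (θ i) (sampleMean x i) - A k κ)

lemma zstat_eq_wstat {N : Fin m → ℕ} (κ : ℝ) (θ : Fin m → Vec k) (x : Sample m k N) :
    zstat κ θ x = wstat κ θ x := by
  ext i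
  simp only [zstat, wstat]
  rcases Nat.eq_zero_or_pos (N i) with h | h
  · simp [h]
  · have h' : (0 : ℝ) < √(N i : ℝ) := Real.sqrt_pos.2 (by exact_mod_cast h)
    have h2 : (N i : ℝ) = √(N i : ℝ) * √(N i : ℝ) := (Real.mul_self_sqrt (Nat.cast_nonneg _)).symm
    rw [Finset.sum_sub_distrib, sampleMean, inner_smul_right, inner_sum]
    simp only [Finset.sum_const, Finset.card_univ, Fintype.card_fin, nsmul_eq_mul]
    rw [Finset.sum_congr rfl fun j _ => real_inner_comm (θ i) (x i j : Vec k)]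
    generalize ∑ j, inner ℝ (θ i) (x i j : Vec k) = S
    generalize √(N i : ℝ) = q at h' h2
    rw [h2]
    field_simp

lemma measurable_wstat {N : Fin m → ℕ} (κ : ℝ) {θhat : Sample m k N → Fin m → Vec k}
    (hθ : ∀ i, Measurable fun x => θhat x i) :
    Measurable fun x : Sample m k N => wstat κ (θhat x) x := by
  have h2 := fun i => (continuous_sampleMean (k := k) (N := N) i).measurable
  unfold wstat
  fun_prop

/-- The reason why root-`n` estimation of the locations has no effect: for unit vectors, `θ₂ - θ₁`
has inner product `-‖θ₂ - θ₁‖² / 2` with `θ₁`. Every term of the difference is then a product of two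
quantities that are bounded after scaling by `s`, leaving a factor `s⁻¹`. -/
lemma abs_sqrt_mul_inner_sub_le {a s K T M : ℝ} {θ₀ θ₁ θ₂ X : Vec k} (h1 : ‖θ₁‖ = 1)
    (h2 : ‖θ₂‖ = 1) (hs : 0 < s) (hK : s * ‖θ₂ - θ₀‖ ≤ K) (hT : s * ‖θ₁ - θ₀‖ ≤ T)
    (hM : s * ‖X - a • θ₀‖ ≤ M) :
    |s * (inner ℝ θ₂ X - a) - s * (inner ℝ θ₁ X - a)| ≤
      ((K + T) * (M + |a| * T) + |a| * (K + T) ^ 2) * s⁻¹ := by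
  have hd : s * ‖θ₂ - θ₁‖ ≤ K + T := by
    have : ‖θ₂ - θ₁‖ ≤ ‖θ₂ - θ₀‖ + ‖θ₁ - θ₀‖ := by
      rw [show θ₂ - θ₁ = (θ₂ - θ₀) - (θ₁ - θ₀) by abel]
      exact norm_sub_le _ _
    nlinarith
  have hX : s * ‖X - a • θ₁‖ ≤ M + |a| * T := by
    have : ‖X - a • θ₁‖ ≤ ‖X - a • θ₀‖ + |a| * ‖θ₁ - θ₀‖ := by
      rw [show X - a • θ₁ = (X - a • θ₀) - a • (θ₁ - θ₀) by rw [smul_sub]; abel]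
      refine (norm_sub_le _ _).trans_eq ?_
      rw [norm_smul, Real.norm_eq_abs]
    calc s * ‖X - a • θ₁‖ ≤ s * (‖X - a • θ₀‖ + |a| * ‖θ₁ - θ₀‖) := by gcongr
      _ = s * ‖X - a • θ₀‖ + |a| * (s * ‖θ₁ - θ₀‖) := by ring
      _ ≤ _ := by gcongr
  have hin : inner ℝ (θ₂ - θ₁) θ₁ = -(‖θ₂ - θ₁‖ ^ 2 / 2) := by
    have := @norm_sub_sq_real _ _ _ θ₂ θ₁
    rw [inner_sub_left, real_inner_self_eq_norm_sq, this, h1, h2]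
    ring
  have e : s * (inner ℝ θ₂ X - a) - s * (inner ℝ θ₁ X - a) =
      s * (inner ℝ (θ₂ - θ₁) (X - a • θ₁) - a * (‖θ₂ - θ₁‖ ^ 2 / 2)) := by
    rw [inner_sub_right, inner_smul_right, hin, inner_sub_left]
    ring
  have h0 : 0 ≤ s * ‖θ₂ - θ₁‖ := by positivity
  have h3 := abs_real_inner_le_norm (θ₂ - θ₁) (X - a • θ₁)
  rw [e, abs_mul, abs_of_pos hs, ← div_eq_mul_inv, le_div_iff₀ hs]
  calc s * |inner ℝ (θ₂ - θ₁) (X - a • θ₁) - a * (‖θ₂ - θ₁‖ ^ 2 / 2)| * s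
      ≤ s * (‖θ₂ - θ₁‖ * ‖X - a • θ₁‖ + |a| * ‖θ₂ - θ₁‖ ^ 2) * s := by
        gcongr
        refine (abs_sub _ _).trans (add_le_add h3 ?_)
        rw [abs_mul, abs_of_nonneg (by positivity : 0 ≤ ‖θ₂ - θ₁‖ ^ 2 / 2)]
        gcongr
        linarith [sq_nonneg ‖θ₂ - θ₁‖]
    _ = (s * ‖θ₂ - θ₁‖) * (s * ‖X - a • θ₁‖) + |a| * (s * ‖θ₂ - θ₁‖) ^ 2 := by ring
    _ ≤ _ := by
        gcongr
        exact h0.trans hd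

lemma RootNConsistent.measurableSet_unit {N : ℕ → Fin m → ℕ}
    {θhat : (j : ℕ) → Sample m k (N j) → Fin m → Vec k} {ϑ : Param m k}
    (h : RootNConsistent N θhat ϑ) (j : ℕ) : MeasurableSet {x | ∀ i, ‖θhat j x i‖ = 1} := by
  rw [ofPred_forall]
  exact MeasurableSet.iInter fun i => measurableSet_eq_fun (h.measurable j i).norm measurable_const

/-- Stated at the fixed parameter `ϑ`, where root-`n` consistency is assumed, but comparing with the
perturbed locations `θ'`, at which the limit theorem is applied. -/
lemma inProb_wstat_sub [NeZero k] (hk : 2 ≤ k) {N : ℕ → Fin m → ℕ}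
    (hN : ∀ i, Tendsto (fun j => N j i) atTop atTop)
    {θhat : (j : ℕ) → Sample m k (N j) → Fin m → Vec k} {ϑ : Param m k} {κ : ℝ}
    (hκ : ∀ i, ϑ.conc i = κ) (hθ : ∀ i, ‖ϑ.loc i‖ = 1) (hc : RootNConsistent N θhat ϑ)
    {θ' : ℕ → Fin m → Vec k} (hθ' : ∀ᶠ j in atTop, ∀ i, ‖θ' j i‖ = 1) {T : ℝ}
    (hT : ∀ j i, √(N j i : ℝ) * ‖θ' j i - ϑ.loc i‖ ≤ T) :
    InProb (fun j => law (N j) ϑ) (fun j x => wstat κ (θhat j x) x - zstat κ (θ' j) x)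
      (0 : Vec m) := by
  refine inProb_of_coord fun i ε hε => ?_
  have hu : Tendsto (fun j => (law (N j) ϑ).real {x | ∀ i, ‖θhat j x i‖ = 1}ᶜ) atTop (𝓝 0) := by
    have h1 := (ENNReal.tendsto_toReal ENNReal.one_ne_top).comp hc.unit
    have h2 := h1.const_sub 1
    simp only [ENNReal.toReal_one, sub_self] at h2
    refine h2.congr fun j => ?_
    rw [measureReal_compl (hc.measurableSet_unit j)]
    simp [measureReal_def]
  rw [Metric.tendsto_nhds]
  intro η hη
  obtain ⟨K, hK⟩ := hc.tight i (η / 4) (by positivity)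
  have hM0 : 0 < √(4 * (k : ℝ) / η) + 1 := by positivity
  -- Chosen so that Chebyshev's bound `k / M²` for the scaled sample mean is at most `η / 4`.
  set M := √(4 * (k : ℝ) / η) + 1 with hM
  have hkM : (k : ℝ) / M ^ 2 ≤ η / 4 := by
    have : 4 * (k : ℝ) / η ≤ M ^ 2 := by
      rw [hM]
      nlinarith [Real.sq_sqrt (show 0 ≤ 4 * (k : ℝ) / η by positivity),
        Real.sqrt_nonneg (4 * (k : ℝ) / η)]
    rw [div_le_iff₀ hη] at this
    rw [div_le_iff₀ (by positivity)]
    linarith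
  have hs := tendsto_sqrt_size (hN i)
  set b := (K + T) * (M + |A k κ| * T) + |A k κ| * (K + T) ^ 2 with hb
  have hsm : Tendsto (fun j => b * (√(N j i : ℝ))⁻¹) atTop (𝓝 0) := by
    simpa using (tendsto_inv_atTop_zero.comp hs).const_mul b
  filter_upwards [hK, hu.eventually_lt_const (show 0 < η / 4 by positivity), hθ',
    hsm.eventually_lt_const hε, hs.eventually_gt_atTop 0] with j hj1 hj2 hj3 hj4 hj5
  rw [Real.dist_eq, sub_zero, abs_of_nonneg measureReal_nonneg]
  have hsub : {x : Sample m k (N j) | ε ≤ ‖(wstat κ (θhat j x) x - zstat κ (θ' j) x) i -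
      (0 : Vec m) i‖} ⊆ {x | ∀ i, ‖θhat j x i‖ = 1}ᶜ ∪
      ({x | K < √(N j i : ℝ) * ‖θhat j x i - ϑ.loc i‖} ∪
      {x | M < √(N j i : ℝ) * ‖sampleMean x i - A k (ϑ.conc i) • ϑ.loc i‖}) := by
    intro x hx
    by_contra hn
    simp only [Set.mem_union, mem_compl_iff, mem_ofPred_eq, not_or, not_not, not_lt] at hn
    obtain ⟨g1, g2, g3⟩ := hn
    rw [hκ i] at g3
    have h := abs_sqrt_mul_inner_sub_le (hj3 i) (g1 i) hj5 g2 (hT j i) g3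
    simp only [mem_ofPred_eq, zstat_eq_wstat, PiLp.sub_apply, PiLp.zero_apply, sub_zero,
      Real.norm_eq_abs] at hx
    simp only [wstat] at hx
    exact absurd (hx.trans h) (not_le.2 hj4)
  refine (measureReal_mono hsub).trans_lt ?_
  refine (measureReal_union_le _ _).trans_lt ?_
  have h1 := measureReal_union_le (μ := law (N j) ϑ)
    {x | K < √(N j i : ℝ) * ‖θhat j x i - ϑ.loc i‖}
    {x | M < √(N j i : ℝ) * ‖sampleMean x i - A k (ϑ.conc i) • ϑ.loc i‖}
  have h2 : (law (N j) ϑ).real {x | K < √(N j i : ℝ) * ‖θhat j x i - ϑ.loc i‖} ≤ η / 4 :=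
    ENNReal.toReal_le_of_le_ofReal (by positivity) hj1
  have h3 := measureReal_sampleMean_le hk (N j) (ϑ := ϑ) i (hθ i) hM0
  linarith

lemma InProb.of_chiBound_le [NeZero k] {E : Type*} [NormedAddCommGroup E] [MeasurableSpace E]
    [BorelSpace E] [SecondCountableTopology E] {N : ℕ → Fin m → ℕ} {ϑ ϑ' : ℕ → Param m k}
    {K : ℝ} (hK : ∀ᶠ j in atTop, chiBound (N j) (ϑ j) (ϑ' j) ≤ K)
    {X : (j : ℕ) → Sample m k (N j) → E} {a : E} (hX : ∀ j, Measurable (X j))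
    (h : InProb (fun j => law (N j) (ϑ j)) X a) : InProb (fun j => law (N j) (ϑ' j)) X a :=
  fun ε hε => tendsto_measureReal_of_chiBound_le hK
    (fun j => measurableSet_le measurable_const ((hX j).sub_const a).norm) (h ε hε)

/-- A vanishing `chiBound` makes the means of bounded functions, and hence the weak limits, agree;
the test function is rescaled to be bounded by one. -/
lemma tendstoInDistribution_of_chiBound [NeZero k] {E Ω' : Type*} [NormedAddCommGroup E]
    [MeasurableSpace E] [BorelSpace E] [SecondCountableTopology E] [MeasurableSpace Ω']
    {μ' : Measure Ω'} [IsProbabilityMeasure μ'] {N : ℕ → Fin m → ℕ} {ϑ ϑ' : ℕ → Param m k}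
    (h : Tendsto (fun j => chiBound (N j) (ϑ j) (ϑ' j)) atTop (𝓝 0))
    {X : (j : ℕ) → Sample m k (N j) → E} {Z : Ω' → E} (hX : ∀ j, Measurable (X j))
    (hXZ : TendstoInDistribution X atTop Z (fun j => law (N j) (ϑ j)) μ') :
    TendstoInDistribution X atTop Z (fun j => law (N j) (ϑ' j)) μ' := by
  refine ⟨fun j => (hX j).aemeasurable, hXZ.aemeasurable_limit, ?_⟩
  refine ProbabilityMeasure.tendsto_iff_forall_integral_tendsto.2 fun f => ?_
  have h1 := ProbabilityMeasure.tendsto_iff_forall_integral_tendsto.1 hXZ.tendsto f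
  simp only [ProbabilityMeasure.coe_mk] at h1 ⊢
  have hf : Measurable f := f.continuous.measurable
  have hM : 0 < ‖f‖ + 1 := by positivity
  have h2 := (tendsto_integral_sub_of_chiBound h
    (f := fun j x => (‖f‖ + 1)⁻¹ * f (X j x)) (fun j => (hf.comp (hX j)).const_mul _)
    (fun j x => by
      rw [abs_mul, abs_of_pos (inv_pos.2 hM), inv_mul_le_iff₀ hM, mul_one]
      exact (f.norm_coe_le_norm (X j x)).trans (by linarith))).const_mul (‖f‖ + 1)
  have h3 := h2.add h1
  rw [mul_zero, zero_add] at h3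
  refine h3.congr fun j => ?_
  rw [integral_map (hX j).aemeasurable hf.aestronglyMeasurable,
    integral_map (hX j).aemeasurable hf.aestronglyMeasurable, integral_const_mul,
    integral_const_mul, ← mul_sub, ← mul_assoc, mul_inv_cancel₀ hM.ne']
  ring

lemma perturb_eq_shiftConc (N : Fin m → ℕ) (κ : ℝ) (θ : Fin m → Vec k) (c : Fin m → ℝ)
    (t : Fin m → Vec k) : perturb N ⟨fun _ => κ, θ⟩ c t =
      shiftConc N κ (fun i => θ i + (√(N i : ℝ))⁻¹ • t i) (WithLp.toLp 2 c) :=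
  perturb_eq N _ c t

lemma IsLocalPerturbation.eventually_norm_eq_one {N : ℕ → Fin m → ℕ} {ϑ : Param m k}
    {c : ℕ → Fin m → ℝ} {t : ℕ → Fin m → Vec k} {c' : Fin m → ℝ}
    (h : IsLocalPerturbation N ϑ c t c') :
    ∀ᶠ j in atTop, ∀ i, ‖ϑ.loc i + (√(N j i : ℝ))⁻¹ • t j i‖ = 1 := by
  filter_upwards [h.mem] with j hj i
  have := (hj i).2
  rwa [perturb_eq] at this

/-- Along local perturbations with limit `c'`, the parameter may be replaced by the one with
constant perturbation `c'` of the concentrations. -/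
lemma IsLocalPerturbation.tendsto_chiBound [NeZero k] {N : ℕ → Fin m → ℕ} {κ : ℝ}
    {θ : Fin m → Vec k} {c : ℕ → Fin m → ℝ} {t : ℕ → Fin m → Vec k} {c' : Fin m → ℝ}
    (h : IsLocalPerturbation N ⟨fun _ => κ, θ⟩ c t c') :
    Tendsto (fun j => chiBound (N j)
      (shiftConc (N j) κ (fun i => θ i + (√(N j i : ℝ))⁻¹ • t j i) (WithLp.toLp 2 c'))
      (perturb (N j) ⟨fun _ => κ, θ⟩ (c j) (t j))) atTop (𝓝 0) := by
  have h1 : Tendsto (fun j => ∑ i, 2 * (c j i - c' i) ^ 2) atTop (𝓝 0) := by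
    have : (0 : ℝ) = ∑ i : Fin m, 2 * (c' i - c' i) ^ 2 := by simp
    rw [this]
    exact tendsto_finsetSum _ fun i _ =>
      (((tendsto_pi_nhds.1 h.tendsto i).sub_const _).pow 2).const_mul 2
  refine squeeze_zero' (Eventually.of_forall fun j => chiBound_nonneg _ _ _) ?_ h1
  filter_upwards [h.eventually_norm_eq_one] with j hj
  rw [perturb_eq_shiftConc]
  exact chiBound_shiftConc_le (N j) hj _ _

/-- The vector of the square roots of the sampling ratios. -/
def sqrtRatio (N : Fin m → ℕ) : Vec m := WithLp.toLp 2 fun i => √(ratio N i)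

lemma AssumptionA.tendsto_sqrtRatio {N : ℕ → Fin m → ℕ} {r : Fin m → ℝ} (hA : AssumptionA N r) :
    Tendsto (fun j => sqrtRatio (N j)) atTop (𝓝 (WithLp.toLp 2 fun i => √(r i))) := by
  refine ((PiLp.continuous_toLp 2 _).tendsto _).comp (tendsto_pi_nhds.2 fun i => ?_)
  exact (Real.continuous_sqrt.tendsto _).comp (hA.ratio_tendsto i)

/-- The joint limit, under local perturbations, of the statistics entering the tests. -/
theorem tendstoInDistribution_joint [NeZero k] (hk : 2 ≤ k) {N : ℕ → Fin m → ℕ} {r : Fin m → ℝ}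
    (hA : AssumptionA N r) {κ : ℝ} (hκ : 0 < κ) {θ : Fin m → Vec k} (hθ : ∀ i, ‖θ i‖ = 1)
    {θhat : (j : ℕ) → Sample m k (N j) → Fin m → Vec k}
    (hc : RootNConsistent N θhat ⟨fun _ => κ, θ⟩)
    {c : ℕ → Fin m → ℝ} {t : ℕ → Fin m → Vec k} {c' : Fin m → ℝ}
    (hp : IsLocalPerturbation N ⟨fun _ => κ, θ⟩ c t c') :
    TendstoInDistribution (fun j x => (wstat κ (θhat j x) x,
        (sqrtRatio (N j), (D k (pooledConc x))⁻¹))) atTop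
      (fun z : Vec m => (√(D k κ) • z + D k κ • (WithLp.toLp 2 c' : Vec m),
        ((WithLp.toLp 2 fun i => √(r i) : Vec m), (D k κ)⁻¹)))
      (fun j => law (N j) (perturb (N j) ⟨fun _ => κ, θ⟩ (c j) (t j))) (stdGaussian (Vec m)) := by
  have hN := hA.tendsto_size
  obtain ⟨T, hT⟩ := hp.bounded
  have hm1 : ∀ j, Measurable fun x : Sample m k (N j) => wstat κ (θhat j x) x :=
    fun j => measurable_wstat κ (hc.measurable j)
  have hm2 : ∀ j, Measurable fun x : Sample m k (N j) =>
      (sqrtRatio (N j), (D k (pooledConc x))⁻¹) := fun j =>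
    measurable_const.prodMk ((measurable_D hk).comp (measurable_pooledConc hk)).inv
  set θ' : ℕ → Fin m → Vec k := fun j i => θ i + (√(N j i : ℝ))⁻¹ • t j i with hθ'
  have hunit : ∀ᶠ j in atTop, ∀ i, ‖θ' j i‖ = 1 := hp.eventually_norm_eq_one
  set v : Vec m := WithLp.toLp 2 c' with hv
  have hK : ∀ᶠ j in atTop, chiBound (N j) ⟨fun _ => κ, θ⟩ (shiftConc (N j) κ (θ' j) v) ≤
      m * (2 * (|κ| * T + ‖v‖ + ‖v‖ * T) ^ 2) := Eventually.of_forall fun j =>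
    chiBound_local_le (N j) hθ (fun i => PiLp.norm_apply_le v i) (hT j)
  -- The concentration perturbation is first frozen at its limit, keeping the moving locations. The
  -- limit theorem applies there, while the two convergences in probability are proved at the
  -- unperturbed parameter and carried over by contiguity.
  refine tendstoInDistribution_of_chiBound hp.tendsto_chiBound
    (fun j => (hm1 j).prodMk (hm2 j)) ?_
  refine tendstoInDistribution_prodMk_const (tendstoInDistribution_zstat hk hN hκ.ne' hunit v) ?_ ?_
    (fun j => (continuous_zstat κ (θ' j)).measurable) hm1 hm2
  · have h1 := inProb_wstat_sub hk hN (ϑ := ⟨fun _ => κ, θ⟩) (κ := κ) (fun _ => rfl) hθ hc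
      (θ' := θ') hunit (T := T) (fun j i => by
        simp only [hθ', add_sub_cancel_left, norm_smul, norm_inv, Real.norm_eq_abs,
          abs_of_nonneg (Real.sqrt_nonneg _), ← mul_assoc]
        have h0 : √(N j i : ℝ) * (√(N j i : ℝ))⁻¹ ≤ 1 := mul_inv_le_one
        exact (mul_le_of_le_one_left (norm_nonneg _) h0).trans (hT j i))
    have h2 := h1.of_chiBound_le hK fun j => (hm1 j).sub (continuous_zstat κ (θ' j)).measurable
    intro ε hε
    have h3 := h2 ε hε
    simp only [sub_zero, Pi.sub_apply] at h3
    exact h3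
  · have h1 := (inProb_pooledConc hk hA hκ (ϑ := ⟨fun _ => κ, θ⟩) (fun _ => rfl) hθ).comp
      (f := fun t => (D k t)⁻¹) ((continuousAt_D hk hκ.ne').inv₀ (D_pos hk hκ.ne').ne')
    exact ((inProb_const hA.tendsto_sqrtRatio).prodMk h1).of_chiBound_le hK hm2

/-! ### The test statistics as functions of the sample projections -/

lemma sum_sqrt_ratio_mul (N : Fin m → ℕ) (b : Fin m → ℝ) :
    ∑ i, √(ratio N i) * (√(N i : ℝ) * b i) = (√(total N : ℝ))⁻¹ * ∑ i, (N i : ℝ) * b i := by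
  rw [Finset.mul_sum]
  refine Finset.sum_congr rfl fun i _ => ?_
  rw [ratio, Real.sqrt_div (Nat.cast_nonneg _), div_eq_inv_mul]
  calc _ = (√(total N : ℝ))⁻¹ * ((√(N i : ℝ) * √(N i : ℝ)) * b i) := by ring
    _ = _ := by rw [Real.mul_self_sqrt (Nat.cast_nonneg _)]

lemma inner_sqrtRatio_wstat {N : Fin m → ℕ} (κ : ℝ) (θ : Fin m → Vec k) (x : Sample m k N) :
    inner ℝ (sqrtRatio N) (wstat κ θ x) =
      (√(total N : ℝ))⁻¹ * ∑ i, (N i : ℝ) * (inner ℝ (θ i) (sampleMean x i) - A k κ) := by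
  rw [← sum_sqrt_ratio_mul, PiLp.inner_apply]
  simp [sqrtRatio, wstat, mul_comm]

/-- Subtracting `A_k(κ)` from every projection changes nothing: it adds a multiple of `sqrtRatio N`
to the vector, and the quadratic form is the squared norm of the part orthogonal to that direction.
-/
lemma QHom_eq {N : Fin m → ℕ} (κ : ℝ) (θ : Fin m → Vec k) (x : Sample m k N) :
    QHom θ x = (D k (pooledConc x))⁻¹ *
      (‖wstat κ θ x‖ ^ 2 - inner ℝ (sqrtRatio N) (wstat κ θ x) ^ 2) := by
  rw [QHom, inner_sqrtRatio_wstat]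
  congr 1
  set b : Fin m → ℝ := fun i => inner ℝ (θ i) (sampleMean x i)
  have h1 : ‖wstat κ θ x‖ ^ 2 = ∑ i, (N i : ℝ) * (b i - A k κ) ^ 2 := by
    rw [EuclideanSpace.norm_sq_eq]
    refine Finset.sum_congr rfl fun i _ => ?_
    simp only [wstat, Real.norm_eq_abs, sq_abs, mul_pow]
    rw [Real.sq_sqrt (Nat.cast_nonneg _)]
  have h2 : ∑ i, (N i : ℝ) * (b i - A k κ) = ∑ i, (N i : ℝ) * b i - total N * A k κ := by
    simp only [mul_sub, Finset.sum_sub_distrib, ← Finset.sum_mul, total, Nat.cast_sum]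
  have h3 : ∑ i, (N i : ℝ) * (b i - A k κ) ^ 2 =
      ∑ i, (N i : ℝ) * b i ^ 2 - 2 * A k κ * ∑ i, (N i : ℝ) * b i + total N * A k κ ^ 2 := by
    rw [total, Nat.cast_sum, Finset.sum_mul, Finset.mul_sum, ← Finset.sum_sub_distrib,
      ← Finset.sum_add_distrib]
    exact Finset.sum_congr rfl fun i _ => by ring
  rw [h1, h2, h3, mul_pow, inv_pow, Real.sq_sqrt (Nat.cast_nonneg _)]
  rcases Nat.eq_zero_or_pos (total N) with h | h
  · have hz : ∀ i, N i = 0 := fun i => by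
      have h0 : N i ≤ total N := Finset.single_le_sum (f := N) (fun _ _ => Nat.zero_le _)
        (Finset.mem_univ i)
      omega
    simp [h, hz]
  · have h' : (total N : ℝ) ≠ 0 := by positivity
    field_simp
    ring

/-- The studentized linear statistic in the direction `u`. -/
def linStat {N : Fin m → ℕ} (u : Vec m) (θ : Fin m → Vec k) (x : Sample m k N) : ℝ :=
  √((D k (pooledConc x))⁻¹) * (∑ i, u i * (√(N i : ℝ) * inner ℝ (θ i) (sampleMean x i)) -
    inner ℝ u (sqrtRatio N) * ((√(total N : ℝ))⁻¹ *
      ∑ i, (N i : ℝ) * inner ℝ (θ i) (sampleMean x i)))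

lemma measurable_linStat (hk : 2 ≤ k) {N : Fin m → ℕ} {θhat : Sample m k N → Fin m → Vec k}
    (hθ : ∀ i, Measurable fun x => θhat x i) (u : Vec m) :
    Measurable fun x : Sample m k N => linStat u (θhat x) x := by
  have h1 := (measurable_D hk).comp (measurable_pooledConc (N := N) hk)
  have h2 := fun i => (continuous_sampleMean (k := k) (N := N) i).measurable
  simp only [Function.comp_def] at h1
  unfold linStat
  fun_prop

/-- The unknown centring `A_k(κ)` cancels because the coefficient vector is projected off `sqrtRatio
N`. The same observable statistic thus serves all null values of `κ`, which membership in the level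
class over an arbitrary `B` requires. -/
lemma linStat_eq {N : Fin m → ℕ} (u : Vec m) (κ : ℝ) (θ : Fin m → Vec k) (x : Sample m k N) :
    linStat u θ x = √((D k (pooledConc x))⁻¹) * (inner ℝ u (wstat κ θ x) -
      inner ℝ u (sqrtRatio N) * inner ℝ (sqrtRatio N) (wstat κ θ x)) := by
  rw [linStat, inner_sqrtRatio_wstat]
  congr 1
  set b : Fin m → ℝ := fun i => inner ℝ (θ i) (sampleMean x i)
  have h1 : inner ℝ u (wstat κ θ x) = ∑ i, u i * (√(N i : ℝ) * b i) -
      A k κ * ∑ i, u i * √(N i : ℝ) := by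
    rw [PiLp.inner_apply, Finset.mul_sum, ← Finset.sum_sub_distrib]
    refine Finset.sum_congr rfl fun i _ => ?_
    simp only [wstat, RCLike.inner_apply, conj_trivial, b]
    ring
  have h2 : ∑ i, (N i : ℝ) * (b i - A k κ) = ∑ i, (N i : ℝ) * b i - total N * A k κ := by
    simp only [mul_sub, Finset.sum_sub_distrib, ← Finset.sum_mul, total, Nat.cast_sum]
  have h3 : inner ℝ u (sqrtRatio N) = (√(total N : ℝ))⁻¹ * ∑ i, u i * √(N i : ℝ) := by
    rw [PiLp.inner_apply, Finset.mul_sum]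
    refine Finset.sum_congr rfl fun i _ => ?_
    simp only [sqrtRatio, ratio, Real.sqrt_div (Nat.cast_nonneg (N i)), RCLike.inner_apply,
      conj_trivial]
    ring
  rw [h1, h2, h3]
  rcases Nat.eq_zero_or_pos (total N) with h | h
  · have hz : ∀ i, N i = 0 := fun i => by
      have h0 : N i ≤ total N := Finset.single_le_sum (f := N) (fun _ _ => Nat.zero_le _)
        (Finset.mem_univ i)
      omega
    simp [hz]
  · have h' : 0 < (total N : ℝ) := by exact_mod_cast h
    have h4 : (total N : ℝ) = √(total N : ℝ) * √(total N : ℝ) :=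
      (Real.mul_self_sqrt h'.le).symm
    have h5 : √(total N : ℝ) ≠ 0 := (Real.sqrt_pos.2 h').ne'
    generalize √(total N : ℝ) = q at *
    rw [h4]
    field_simp
    ring

/-! ### Limit laws of the quadratic and linear statistics under local perturbations -/

section Limits

variable [NeZero k] {N : ℕ → Fin m → ℕ} {r : Fin m → ℝ} {κ : ℝ} {θ : Fin m → Vec k}
  {θhat : (j : ℕ) → Sample m k (N j) → Fin m → Vec k} {c : ℕ → Fin m → ℝ}
  {t : ℕ → Fin m → Vec k} {c' : Fin m → ℝ}

theorem tendstoInDistribution_QHom (hk : 2 ≤ k) (hA : AssumptionA N r) (hκ : 0 < κ)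
    (hθ : ∀ i, ‖θ i‖ = 1) (hc : RootNConsistent N θhat ⟨fun _ => κ, θ⟩)
    (hp : IsLocalPerturbation N ⟨fun _ => κ, θ⟩ c t c') :
    TendstoInDistribution (fun j x => QHom (θhat j x) x) atTop
      (fun z : Vec m => ‖z + √(D k κ) • (WithLp.toLp 2 c' : Vec m)‖ ^ 2 -
        inner ℝ (WithLp.toLp 2 fun i => √(r i) : Vec m)
          (z + √(D k κ) • (WithLp.toLp 2 c' : Vec m)) ^ 2)
      (fun j => law (N j) (perturb (N j) ⟨fun _ => κ, θ⟩ (c j) (t j))) (stdGaussian (Vec m)) := by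
  -- Continuous mapping; in the limit the factor `1/D_k` cancels the scale `√D_k` common to the
  -- noise and to the drift.
  have h := (tendstoInDistribution_joint hk hA hκ hθ hc hp).continuous_comp
    (g := fun p : Vec m × Vec m × ℝ => p.2.2 * (‖p.1‖ ^ 2 - inner ℝ p.2.1 p.1 ^ 2)) (by fun_prop)
  refine h.congr (fun j => ae_of_all _ fun x => (QHom_eq κ (θhat j x) x).symm)
    (ae_of_all _ fun z => ?_)
  have hD := D_pos hk hκ.ne'
  set d := D k κ
  set v : Vec m := WithLp.toLp 2 c'
  have e : √d • z + d • v = √d • (z + √d • v) := by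
    rw [smul_add, smul_smul, Real.mul_self_sqrt hD.le]
  simp only [Function.comp_apply]
  rw [e, norm_smul, inner_smul_right, Real.norm_of_nonneg (Real.sqrt_nonneg _), mul_pow, mul_pow,
    Real.sq_sqrt hD.le]
  field_simp

theorem tendstoInDistribution_linStat (hk : 2 ≤ k) (hA : AssumptionA N r) (hκ : 0 < κ)
    (hθ : ∀ i, ‖θ i‖ = 1) (hc : RootNConsistent N θhat ⟨fun _ => κ, θ⟩)
    (hp : IsLocalPerturbation N ⟨fun _ => κ, θ⟩ c t c') {u : Vec m}
    (hu : inner ℝ u (WithLp.toLp 2 fun i => √(r i) : Vec m) = 0) :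
    TendstoInDistribution (fun j x => linStat u (θhat j x) x) atTop
      (fun z : Vec m => inner ℝ u (z + √(D k κ) • (WithLp.toLp 2 c' : Vec m)))
      (fun j => law (N j) (perturb (N j) ⟨fun _ => κ, θ⟩ (c j) (t j))) (stdGaussian (Vec m)) := by
  have h := (tendstoInDistribution_joint hk hA hκ hθ hc hp).continuous_comp
    (g := fun p : Vec m × Vec m × ℝ => √p.2.2 * (inner ℝ u p.1 -
      inner ℝ u p.2.1 * inner ℝ p.2.1 p.1)) (by fun_prop)
  refine h.congr (fun j => ae_of_all _ fun x => (linStat_eq u κ (θhat j x) x).symm)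
    (ae_of_all _ fun z => ?_)
  have hD := D_pos hk hκ.ne'
  set d := D k κ
  set v : Vec m := WithLp.toLp 2 c'
  have e : √d • z + d • v = √d • (z + √d • v) := by
    rw [smul_add, smul_smul, Real.mul_self_sqrt hD.le]
  have h5 : √d ≠ 0 := (Real.sqrt_pos.2 hD).ne'
  simp only [Function.comp_apply]
  rw [e, hu, inner_smul_right, Real.sqrt_inv]
  field_simp
  ring

end Limits

end FvML

namespace FvML

variable {m k : ℕ}

/-! ### Tail functions of atomless laws -/

section Tail

variable {μ : Measure ℝ} [IsProbabilityMeasure μ]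

lemma continuous_measureReal_Ioi (h : ∀ y, μ {y} = 0) : Continuous fun q => μ.real (Ioi q) := by
  have e : ∀ q, μ.real (Ioi q) = ∫ x, (Ioi q).indicator (1 : ℝ → ℝ) x ∂μ := fun q =>
    (integral_indicator_one measurableSet_Ioi).symm
  simp_rw [e]
  refine continuous_iff_continuousAt.2 fun q => ?_
  refine continuousAt_of_dominated (bound := fun _ => 1) (Eventually.of_forall fun p =>
      (measurable_one.indicator measurableSet_Ioi).aestronglyMeasurable)
    (Eventually.of_forall fun p => ae_of_all _ fun x => ?_) (integrable_const _) ?_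
  · by_cases hx : x ∈ Ioi p <;> simp [hx]
  · have h1 : ∀ᵐ x ∂μ, x ≠ q := by
      rw [ae_iff]
      simpa using h q
    filter_upwards [h1] with x hx
    rcases lt_or_gt_of_ne hx with hlt | hgt
    · refine (continuousAt_const (y := (0 : ℝ))).congr ?_
      filter_upwards [lt_mem_nhds hlt] with p hp
      simp [indicator, not_lt.2 hp.le]
    · refine (continuousAt_const (y := (1 : ℝ))).congr ?_
      filter_upwards [gt_mem_nhds hgt] with p hp
      simp [indicator, hp]

lemma tendsto_measureReal_Ioi_atTop (μ : Measure ℝ) [IsProbabilityMeasure μ] :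
    Tendsto (fun q => μ.real (Ioi q)) atTop (𝓝 0) := by
  have h := (tendsto_cdf_atTop μ).const_sub 1
  rw [sub_self] at h
  refine h.congr fun q => ?_
  rw [cdf_eq_real, ← compl_Iic, measureReal_compl measurableSet_Iic]
  simp

lemma tendsto_measureReal_Ioi_atBot (μ : Measure ℝ) [IsProbabilityMeasure μ] :
    Tendsto (fun q => μ.real (Ioi q)) atBot (𝓝 1) := by
  have h := (tendsto_cdf_atBot μ).const_sub 1
  rw [sub_zero] at h
  refine h.congr fun q => ?_
  rw [cdf_eq_real, ← compl_Iic, measureReal_compl measurableSet_Iic]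
  simp

lemma exists_measureReal_Ioi_eq (h : ∀ y, μ {y} = 0) {α : ℝ} (h0 : 0 < α) (h1 : α < 1) :
    ∃ q, μ.real (Ioi q) = α := by
  obtain ⟨a, ha⟩ := ((tendsto_measureReal_Ioi_atTop μ).eventually_lt_const h0).exists
  obtain ⟨b, hb⟩ := ((tendsto_measureReal_Ioi_atBot μ).eventually_const_lt h1).exists
  exact mem_range_of_exists_le_of_exists_ge (continuous_measureReal_Ioi h) ⟨a, ha.le⟩ ⟨b, hb.le⟩

/-- Below the infimum the tail exceeds `α`, and the infimum itself belongs to the closed set, so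
continuity of the tail forces equality. The condition on negative `q` bounds the set from below. -/
lemma measureReal_Ioi_sInf (h : ∀ y, μ {y} = 0) (hneg : ∀ q < 0, μ.real (Ioi q) = 1) {α : ℝ}
    (h0 : 0 < α) (h1 : α < 1) :
    μ.real (Ioi (sInf {q : ℝ | μ (Ioi q) ≤ ENNReal.ofReal α})) = α := by
  have e : {q : ℝ | μ (Ioi q) ≤ ENNReal.ofReal α} = {q | μ.real (Ioi q) ≤ α} := by
    ext q
    exact (ENNReal.le_ofReal_iff_toReal_le (measure_ne_top μ _) h0.le)
  rw [e]
  have hc := continuous_measureReal_Ioi h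
  have hlb : ∀ q ∈ {q | μ.real (Ioi q) ≤ α}, 0 ≤ q := by
    intro q hq
    by_contra hlt
    have := hneg q (not_le.1 hlt)
    have hq' : μ.real (Ioi q) ≤ α := hq
    linarith
  have hne : {q | μ.real (Ioi q) ≤ α}.Nonempty := by
    obtain ⟨q, hq⟩ := exists_measureReal_Ioi_eq h h0 h1
    exact ⟨q, hq.le⟩
  have hcl : IsClosed {q | μ.real (Ioi q) ≤ α} := isClosed_le hc continuous_const
  have hmem := hcl.csInf_mem hne ⟨0, hlb⟩
  refine le_antisymm hmem ?_
  refine ge_of_tendsto (hc.continuousWithinAt (s := Iio (sInf {q | μ.real (Ioi q) ≤ α}))) ?_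
  filter_upwards [self_mem_nhdsWithin] with q hq
  have := notMem_of_lt_csInf hq ⟨0, hlb⟩
  exact (not_le.1 this).le

/-- Portmanteau theorem: the boundary of the half-line is a single point, which the limit law does
not charge. -/
lemma tendsto_measureReal_Ioi_of_tendstoInDistribution {Ω' : Type*} {Ω : ℕ → Type*}
    [∀ j, MeasurableSpace (Ω j)] {P : (j : ℕ) → Measure (Ω j)} [∀ j, IsProbabilityMeasure (P j)]
    [MeasurableSpace Ω'] {P' : Measure Ω'} [IsProbabilityMeasure P'] {X : (j : ℕ) → Ω j → ℝ}
    {Z : Ω' → ℝ} (hX : ∀ j, Measurable (X j)) (h : TendstoInDistribution X atTop Z P P')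
    (hμ : P'.map Z = μ) (hna : ∀ y, μ {y} = 0) (q : ℝ) :
    Tendsto (fun j => (P j).real {ω | q < X j ω}) atTop (𝓝 (μ.real (Ioi q))) := by
  have h1 := ProbabilityMeasure.tendsto_measure_of_null_frontier_of_tendsto' h.tendsto
    (E := Ioi q) (by
      rw [frontier_Ioi]
      change (P'.map Z) {q} = 0
      rw [hμ, hna])
  simp only [ProbabilityMeasure.coe_mk, hμ] at h1
  have h2 := (ENNReal.tendsto_toReal (measure_ne_top μ (Ioi q))).comp h1
  refine h2.congr fun j => ?_
  simp only [Function.comp_apply, measureReal_def]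
  rw [Measure.map_apply (hX j) measurableSet_Ioi]
  rfl

end Tail

/-! ### Chi-square laws -/

lemma gaussianReal_singleton (a y : ℝ) : gaussianReal a 1 {y} = 0 := by
  have := nullSingletonClass_gaussianReal (μ := a) (v := 1) one_ne_zero
  exact measure_singleton y

/-- Given all coordinates but the first, at most two values of the first one are possible. At least
one degree of freedom is required, since with none the law is a point mass. -/
lemma noncentralChiSq_singleton (ν : ℕ) (δ y : ℝ) : noncentralChiSq (ν + 1) δ {y} = 0 := by
  rw [noncentralChiSq, Measure.map_apply (by fun_prop) (measurableSet_singleton y)]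
  set γ : Fin (ν + 1) → Measure ℝ := fun i => gaussianReal (if i.val = 0 then √δ else 0) 1
  have hS : MeasurableSet {p : ℝ × (Fin ν → ℝ) | p.1 ^ 2 + ∑ i, p.2 i ^ 2 = y} :=
    measurableSet_eq_fun (by fun_prop) measurable_const
  have h1 := (measurePreserving_piFinSuccAbove γ 0).measure_preimage hS.nullMeasurableSet
  have e : MeasurableEquiv.piFinSuccAbove (fun _ : Fin (ν + 1) => ℝ) 0 ⁻¹'
      {p : ℝ × (Fin ν → ℝ) | p.1 ^ 2 + ∑ i, p.2 i ^ 2 = y} =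
      (fun z : Fin (ν + 1) → ℝ => ∑ i, z i ^ 2) ⁻¹' {y} := by
    ext z
    simp [MeasurableEquiv.piFinSuccAbove, Fin.sum_univ_succ, Fin.tail]
  rw [← e]
  refine h1.trans ?_
  rw [Measure.prod_apply_symm hS, lintegral_eq_zero_iff (measurable_measure_prodMk_right hS)]
  refine ae_of_all _ fun p => ?_
  refine measure_mono_null (t := {√(y - ∑ i, p i ^ 2)} ∪ {-√(y - ∑ i, p i ^ 2)}) ?_ ?_
  · intro x hx
    have hx' : x ^ 2 = y - ∑ i, p i ^ 2 := by
      have : x ^ 2 + ∑ i, p i ^ 2 = y := hx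
      linarith
    rw [← hx', Real.sqrt_sq_eq_abs]
    rcases abs_cases x with h | h
    · left; simp [h.1]
    · right; simp [h.1]
  · exact measure_union_null (gaussianReal_singleton _ _) (gaussianReal_singleton _ _)

lemma noncentralChiSq_Ioi_of_neg (ν : ℕ) (δ : ℝ) {q : ℝ} (hq : q < 0) :
    (noncentralChiSq ν δ).real (Ioi q) = 1 := by
  have : noncentralChiSq ν δ (Ioi q) = 1 := by
    rw [noncentralChiSq, Measure.map_apply (by fun_prop) measurableSet_Ioi]
    have : (fun z : Fin ν → ℝ => ∑ i, z i ^ 2) ⁻¹' Ioi q = univ :=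
      eq_univ_of_forall fun z => hq.trans_le (Finset.sum_nonneg fun i _ => sq_nonneg _)
    rw [this, measure_univ]
  rw [measureReal_def, this, ENNReal.toReal_one]

lemma chiSqUpperQuantile_spec (ν : ℕ) {α : ℝ} (h0 : 0 < α) (h1 : α < 1) :
    (chiSq (ν + 1)).real (Ioi (chiSqUpperQuantile (ν + 1) α)) = α :=
  measureReal_Ioi_sInf (noncentralChiSq_singleton ν 0)
    (fun _ hq => noncentralChiSq_Ioi_of_neg _ _ hq) h0 h1

lemma noncentralChiSq_eq_map (ν : ℕ) (δ : ℝ) :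
    noncentralChiSq ν δ = (Measure.pi fun _ : Fin ν => gaussianReal 0 1).map
      fun z => ∑ i, (z i + if i.val = 0 then √δ else 0) ^ 2 := by
  have h : (Measure.pi fun i : Fin ν => gaussianReal (if i.val = 0 then √δ else 0) 1) =
      (Measure.pi fun _ : Fin ν => gaussianReal 0 1).map
        fun z i => z i + if i.val = 0 then √δ else 0 := by
    have : ∀ i : Fin ν, IsProbabilityMeasure ((gaussianReal 0 1).map
        (fun x => x + if i.val = 0 then √δ else 0)) := fun i =>
      Measure.isProbabilityMeasure_map (by fun_prop)
    rw [Measure.pi_map_pi (f := fun (i : Fin ν) (x : ℝ) => x + if i.val = 0 then √δ else 0)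
      fun i => by fun_prop]
    congr 1
    funext i
    rw [gaussianReal_map_add_const, zero_add]
  rw [noncentralChiSq, h, Measure.map_map (by fun_prop) (by fun_prop)]
  rfl

/-- An orthonormal basis adapted to a unit vector and to the orthogonal part of another vector. -/
lemma exists_adapted_basis {n : ℕ} {s : Vec (n + 1)} (hs : ‖s‖ = 1) (a : Vec (n + 1)) :
    ∃ b : OrthonormalBasis (Fin (n + 1)) ℝ (Vec (n + 1)), b 0 = s ∧
      ∀ i : Fin n, inner ℝ (b i.succ) a =
        if i.val = 0 then √(‖a‖ ^ 2 - inner ℝ s a ^ 2) else 0 := by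
  set p : Vec (n + 1) := a - inner ℝ s a • s with hp
  have hss : inner ℝ s s = (1 : ℝ) := by rw [real_inner_self_eq_norm_sq, hs]; norm_num
  have hsp : inner ℝ s p = (0 : ℝ) := by
    rw [hp, inner_sub_right, inner_smul_right, hss]
    ring
  have hpn : ‖p‖ ^ 2 = ‖a‖ ^ 2 - inner ℝ s a ^ 2 := by
    rw [← real_inner_self_eq_norm_sq p]
    nth_rw 1 [hp]
    rw [inner_sub_left, inner_smul_left, hsp, hp, inner_sub_right, inner_smul_right,
      real_inner_self_eq_norm_sq, real_inner_comm s a]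
    simp
    ring
  rw [← hpn, Real.sqrt_sq (norm_nonneg _)]
  have hbs : ∀ b : OrthonormalBasis (Fin (n + 1)) ℝ (Vec (n + 1)), b 0 = s → ∀ i : Fin n,
      inner ℝ (b i.succ) a = inner ℝ (b i.succ) p := by
    intro b hb i
    rw [hp, inner_sub_right, inner_smul_right, ← hb, b.inner_eq_zero (Fin.succ_ne_zero i)]
    ring
  have hcard : Module.finrank ℝ (Vec (n + 1)) = Fintype.card (Fin (n + 1)) := by simp
  by_cases h0 : p = 0
  · have ho : Orthonormal ℝ (Set.domRestrict ({0} : Set (Fin (n + 1))) fun _ => s) := by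
      refine ⟨fun _ => hs, fun i j hij => ?_⟩
      exact absurd (Subtype.ext (i.2.trans j.2.symm)) hij
    obtain ⟨b, hb⟩ := ho.exists_orthonormalBasis_extension_of_card_eq hcard
    have hb0 : b 0 = s := hb 0 rfl
    refine ⟨b, hb0, fun i => ?_⟩
    rw [hbs b hb0, h0]
    simp
  · have hpp : 0 < ‖p‖ := norm_pos_iff.2 h0
    -- In dimension one `s` alone is a basis, so a vector orthogonal to it vanishes.
    have hn : 1 ≤ n := by
      by_contra hlt
      have hn0 : n = 0 := by omega
      subst hn0
      have ho : Orthonormal ℝ (Set.domRestrict (univ : Set (Fin 1)) fun _ => s) := by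
        refine ⟨fun _ => hs, fun i j hij => ?_⟩
        exact absurd (Subsingleton.elim i j) hij
      obtain ⟨b, hb⟩ := ho.exists_orthonormalBasis_extension_of_card_eq hcard
      have hz := b.sum_sq_norm_inner_right p
      rw [Finset.sum_eq_zero fun i _ => by rw [hb i (mem_univ _), hsp]; simp] at hz
      exact hpp.ne' (pow_eq_zero_iff two_ne_zero |>.1 hz.symm)
    obtain ⟨n, rfl⟩ : ∃ n', n = n' + 1 := ⟨n - 1, by omega⟩
    set v : Fin (n + 1 + 1) → Vec (n + 1 + 1) := fun i => if i = 0 then s else ‖p‖⁻¹ • p with hv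
    have hn1 : ‖‖p‖⁻¹ • p‖ = 1 := by
      rw [norm_smul, norm_inv, norm_norm, inv_mul_cancel₀ hpp.ne']
    have ho : Orthonormal ℝ (Set.domRestrict ({0, 1} : Set (Fin (n + 1 + 1))) v) := by
      refine ⟨fun i => ?_, fun i j hij => ?_⟩
      · simp only [Set.domRestrict_apply, hv]
        split_ifs
        exacts [hs, hn1]
      · obtain ⟨i, hi⟩ := i
        obtain ⟨j, hj⟩ := j
        have hij' : i ≠ j := fun h => hij (Subtype.ext h)
        simp only [Set.domRestrict_apply, hv]
        rcases hi with rfl | rfl <;> rcases hj with rfl | rfl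
        · exact absurd rfl hij'
        · simp [inner_smul_right, hsp]
        · simp [inner_smul_left, real_inner_comm s p, hsp]
        · exact absurd rfl hij'
    obtain ⟨b, hb⟩ := ho.exists_orthonormalBasis_extension_of_card_eq hcard
    have hb0 : b 0 = s := by rw [hb 0 (by simp)]; simp [hv]
    have hb1 : b 1 = ‖p‖⁻¹ • p := by rw [hb 1 (by simp)]; simp [hv]
    have hbp : p = ‖p‖ • b 1 := by
      rw [hb1, smul_smul, mul_inv_cancel₀ hpp.ne', one_smul]
    refine ⟨b, hb0, fun i => ?_⟩
    rw [hbs b hb0]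
    by_cases hi : i = 0
    · subst hi
      have h11 : inner ℝ (b 1) (b 1) = (1 : ℝ) := by
        rw [real_inner_self_eq_norm_sq, b.norm_eq_one]; norm_num
      nth_rw 1 [hbp]
      rw [Fin.succ_zero_eq_one, inner_smul_right, h11]
      simp
    · have hi' : i.succ ≠ (1 : Fin (n + 1 + 1)) := fun h =>
        hi (Fin.succ_injective _ (h.trans Fin.succ_zero_eq_one.symm))
      have hi2 : i.val ≠ 0 := fun h => hi (Fin.ext h)
      nth_rw 1 [hbp]
      rw [inner_smul_right, b.inner_eq_zero hi', mul_zero, if_neg hi2]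

/-- The squared norm of the projection of a shifted standard Gaussian vector on a hyperplane has a
non-central chi-square law. -/
theorem map_stdGaussian_projection (hm : 2 ≤ m) {s : Vec m} (hs : ‖s‖ = 1) (a : Vec m) :
    (stdGaussian (Vec m)).map (fun z => ‖z + a‖ ^ 2 - inner ℝ s (z + a) ^ 2) =
      noncentralChiSq (m - 1) (‖a‖ ^ 2 - inner ℝ s a ^ 2) := by
  obtain ⟨n, rfl⟩ : ∃ n, m = n + 1 := ⟨m - 1, by omega⟩
  obtain ⟨b, hb0, hb⟩ := exists_adapted_basis hs a
  rw [stdGaussian_eq_map_pi_orthonormalBasis b, Measure.map_map (by fun_prop) (by fun_prop),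
    Nat.add_sub_cancel, noncentralChiSq_eq_map]
  set δ := ‖a‖ ^ 2 - inner ℝ s a ^ 2
  have h1 := (measurePreserving_piFinSuccAbove (fun _ : Fin (n + 1) => gaussianReal 0 1) 0)
  have h2 : (Measure.pi fun _ : Fin (n + 1) => gaussianReal 0 1).map (fun z (i : Fin n) => z i.succ) =
      Measure.pi fun _ : Fin n => gaussianReal 0 1 := by
    have h3 := (measurePreserving_snd (μ := gaussianReal 0 1)
      (ν := Measure.pi fun _ : Fin n => gaussianReal 0 1)).comp h1
    exact h3.map_eq
  rw [← h2, Measure.map_map (by fun_prop) (by fun_prop)]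
  congr 1
  funext x
  simp only [Function.comp_apply]
  have hin : ∀ i, inner ℝ (b i) (∑ j, x j • b j) = x i := by
    intro i
    rw [inner_sum, Finset.sum_eq_single i]
    · rw [inner_smul_right, real_inner_self_eq_norm_sq, b.norm_eq_one]; simp
    · intro j _ hj
      rw [inner_smul_right, b.inner_eq_zero hj.symm, mul_zero]
    · simp
  rw [← b.sum_sq_norm_inner_right, Fin.sum_univ_succ, hb0]
  simp only [inner_add_right, Real.norm_eq_abs, sq_abs, add_sub_cancel_left]
  refine Finset.sum_congr rfl fun i _ => ?_
  rw [hin, hb]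

lemma map_stdGaussian_inner {u : Vec m} (hu : ‖u‖ = 1) (a : Vec m) :
    (stdGaussian (Vec m)).map (fun z => inner ℝ u (z + a)) = gaussianReal (inner ℝ u a) 1 := by
  have h1 := IsGaussian.map_eq_gaussianReal (μ := stdGaussian (Vec m)) (innerSL ℝ u)
  rw [integral_strongDual_stdGaussian, variance_dual_stdGaussian, innerSL_apply_norm, hu] at h1
  have h2 : (fun z : Vec m => inner ℝ u (z + a)) = (fun t => t + inner ℝ u a) ∘ innerSL ℝ u := by
    funext z
    simp [inner_add_right]
  rw [h2, ← Measure.map_map (by fun_prop) (by fun_prop), h1, gaussianReal_map_add_const]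
  simp

end FvML

namespace FvML

variable {m k : ℕ}

/-! ### Average power of tests against a prior on the concentrations -/

lemma integral_law_shiftConc [NeZero k] (hk : 2 ≤ k) (N : Fin m → ℕ) (κ : ℝ) {θ : Fin m → Vec k}
    (hθ : ∀ i, ‖θ i‖ = 1) (c : Vec m) (f : Sample m k N → ℝ) :
    ∫ x, f x ∂law N (shiftConc N κ θ c) = (normConst k N κ c)⁻¹ *
      ∫ x, Real.exp (inner ℝ c (zstat κ θ x)) * f x ∂law N ⟨fun _ => κ, θ⟩ := by
  rw [law_shiftConc, integral_tilted, integral_exp_inner_zstat hk N κ hθ, ← integral_const_mul]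
  congr 1
  funext x
  rw [smul_eq_mul]
  ring

lemma exists_norm_zstat_le {N : Fin m → ℕ} (κ : ℝ) (θ : Fin m → Vec k) :
    ∃ M, ∀ x : Sample m k N, ‖zstat κ θ x‖ ≤ M := by
  obtain ⟨M, hM⟩ := (isCompact_univ (X := Sample m k N)).exists_bound_of_continuousOn
    (continuous_zstat κ θ).continuousOn
  exact ⟨M, fun x => hM x (mem_univ x)⟩

lemma abs_integral_law_le_one [NeZero k] {N : Fin m → ℕ} (ϑ : Param m k) {f : Sample m k N → ℝ}
    (hf1 : ∀ x, |f x| ≤ 1) : |∫ x, f x ∂law N ϑ| ≤ 1 := by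
  have := norm_integral_le_of_norm_le_const (f := f) (μ := law N ϑ) (C := 1) (ae_of_all _ hf1)
  simpa using this

section Prior

variable {N : Fin m → ℕ} {κ : ℝ} {θ : Fin m → Vec k} {Ξ : Type*} [MeasurableSpace Ξ]
  {μ : Measure Ξ} [IsProbabilityMeasure μ] {c : Ξ → Vec m} {ρ : ℝ}

lemma measurable_exp_inner_zstat_mul (hc : Measurable c) {f : Sample m k N → ℝ}
    (hf : Measurable f) : Measurable fun p : Ξ × Sample m k N =>
      Real.exp (inner ℝ (c p.1) (zstat κ θ p.2)) * f p.2 := by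
  have h1 : Measurable fun p : Ξ × Sample m k N => c p.1 := hc.comp measurable_fst
  have h2 : Measurable fun p : Ξ × Sample m k N => zstat κ θ p.2 :=
    (continuous_zstat κ θ).measurable.comp measurable_snd
  exact (Real.measurable_exp.comp (h1.inner h2)).mul (hf.comp measurable_snd)

lemma measurable_normConst [NeZero k] (hk : 2 ≤ k) (hθ : ∀ i, ‖θ i‖ = 1) (hc : Measurable c) :
    Measurable fun ξ => normConst k N κ (c ξ) := by
  have h := (measurable_exp_inner_zstat_mul (N := N) (κ := κ) (θ := θ) hc
    measurable_one).stronglyMeasurable.integral_prod_right' (ν := law N ⟨fun _ => κ, θ⟩)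
  simp only [Pi.one_apply, mul_one, integral_exp_inner_zstat hk N κ hθ] at h
  exact h.measurable

lemma measurable_integral_law_shiftConc [NeZero k] (hk : 2 ≤ k) (hθ : ∀ i, ‖θ i‖ = 1) (hc : Measurable c)
    {f : Sample m k N → ℝ} (hf : Measurable f) :
    Measurable fun ξ => ∫ x, f x ∂law N (shiftConc N κ θ (c ξ)) := by
  simp_rw [integral_law_shiftConc hk N κ hθ]
  have h := (measurable_exp_inner_zstat_mul (N := N) (κ := κ) (θ := θ) hc
    hf).stronglyMeasurable.integral_prod_right' (ν := law N ⟨fun _ => κ, θ⟩)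
  exact (measurable_normConst hk hθ hc).inv.mul h.measurable

lemma normConst_mul_exp_le (hk : 2 ≤ k) {d : ℝ} (hd : 0 ≤ d) {c : Vec m} (hρ : ‖c‖ ≤ ρ) :
    normConst k N κ c * Real.exp (-(d * ‖c‖ ^ 2 / 2)) ≤ Real.exp (ρ ^ 2 / 2) := by
  have h1 := normConst_le hk N κ c
  have h2 : Real.exp (-(d * ‖c‖ ^ 2 / 2)) ≤ 1 := Real.exp_le_one_iff.2 (by
    have : 0 ≤ d * ‖c‖ ^ 2 / 2 := by positivity
    linarith)
  have h3 : Real.exp (‖c‖ ^ 2 / 2) ≤ Real.exp (ρ ^ 2 / 2) := by gcongr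
  calc _ ≤ normConst k N κ c * 1 := by gcongr; exact (normConst_pos hk N κ c).le
    _ ≤ _ := by linarith

/-- A Neyman–Pearson bound on the power of tests averaged over a prior, when the likelihood ratios
are replaced by their Gaussian limits. -/
theorem integral_power_le_of_prior [NeZero k] (hk : 2 ≤ k) (hθ : ∀ i, ‖θ i‖ = 1) (hc : Measurable c)
    (hρ : ∀ ξ, ‖c ξ‖ ≤ ρ) (c₀ : Vec m) {K d : ℝ} (hK : 0 ≤ K) (hd : 0 ≤ d) {R : Set (Vec m)}
    (hR : MeasurableSet R)
    (h1 : ∀ z ∈ R, K * Real.exp (inner ℝ c₀ z - d * ‖c₀‖ ^ 2 / 2) ≤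
      ∫ ξ, Real.exp (inner ℝ (c ξ) z - d * ‖c ξ‖ ^ 2 / 2) ∂μ)
    (h2 : ∀ z ∉ R, ∫ ξ, Real.exp (inner ℝ (c ξ) z - d * ‖c ξ‖ ^ 2 / 2) ∂μ ≤
      K * Real.exp (inner ℝ c₀ z - d * ‖c₀‖ ^ 2 / 2))
    {ψ : Sample m k N → ℝ} (hψ : Measurable ψ) (hψ1 : ∀ x, ψ x ∈ Icc (0 : ℝ) 1) :
    ∫ ξ, ∫ x, ψ x ∂law N (shiftConc N κ θ (c ξ)) ∂μ ≤
      ∫ ξ, (law N (shiftConc N κ θ (c ξ))).real (zstat κ θ ⁻¹' R) ∂μ +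
      K * (∫ x, ψ x ∂law N (shiftConc N κ θ c₀) -
        (law N (shiftConc N κ θ c₀)).real (zstat κ θ ⁻¹' R)) +
      (∫ ξ, |1 - normConst k N κ (c ξ) * Real.exp (-(d * ‖c ξ‖ ^ 2 / 2))| ∂μ +
        K * |1 - normConst k N κ c₀ * Real.exp (-(d * ‖c₀‖ ^ 2 / 2))|) := by
  have hS : MeasurableSet (zstat κ θ ⁻¹' R : Set (Sample m k N)) :=
    (continuous_zstat κ θ).measurable hR
  set S : Set (Sample m k N) := zstat κ θ ⁻¹' R with hSdef
  set P := law N (⟨fun _ => κ, θ⟩ : Param m k) with hP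
  -- The Neyman–Pearson difference: `f` is nonpositive on the region of the optimal test and
  -- nonnegative off it, exactly where the two likelihoods compare in the opposite way.
  set f : Sample m k N → ℝ := fun x => ψ x - S.indicator 1 x with hf
  have hfm : Measurable f := hψ.sub (measurable_one.indicator hS)
  have hf1 : ∀ x, |f x| ≤ 1 := by
    intro x
    have := hψ1 x
    by_cases hx : x ∈ S
    · simp only [hf, indicator_of_mem hx, Pi.one_apply, abs_le]
      constructor <;> linarith [this.1, this.2]
    · simp only [hf, indicator_of_notMem hx, abs_le]
      constructor <;> linarith [this.1, this.2]
  have hψi : ∀ ϑ, Integrable ψ (law N ϑ) := fun ϑ =>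
    Integrable.of_bound hψ.aestronglyMeasurable 1 (ae_of_all _ fun x => by
      rw [Real.norm_of_nonneg (hψ1 x).1]; exact (hψ1 x).2)
  have hEf : ∀ ϑ, ∫ x, f x ∂law N ϑ = ∫ x, ψ x ∂law N ϑ - (law N ϑ).real S := by
    intro ϑ
    have hi : Integrable (S.indicator (1 : Sample m k N → ℝ)) (law N ϑ) :=
      (integrable_const (1 : ℝ)).indicator hS
    simp only [hf]
    rw [integral_sub (hψi ϑ) hi, integral_indicator_one hS]
  set E : Ξ → ℝ := fun ξ => ∫ x, f x ∂law N (shiftConc N κ θ (c ξ)) with hE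
  have hEm : Measurable E := measurable_integral_law_shiftConc hk hθ hc hfm
  have hE1 : ∀ ξ, |E ξ| ≤ 1 := fun ξ => abs_integral_law_le_one _ hf1
  set e : Ξ → ℝ := fun ξ => Real.exp (-(d * ‖c ξ‖ ^ 2 / 2)) with he
  have hem : Measurable e := by
    have := hc.norm
    fun_prop
  -- The ratio of the exact normalizing constant to its Gaussian limit. Weighting the power
  -- difference by `a` replaces the likelihood ratio by its Gaussian form, at a cost of at most `|1
  -- - a|`.
  set a : Ξ → ℝ := fun ξ => normConst k N κ (c ξ) * e ξ with ha
  have ham : Measurable a := (measurable_normConst hk hθ hc).mul hem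
  have ha0 : ∀ ξ, 0 ≤ a ξ := fun ξ => mul_nonneg (normConst_pos hk N κ _).le (Real.exp_pos _).le
  have haB : ∀ ξ, a ξ ≤ Real.exp (ρ ^ 2 / 2) := fun ξ => normConst_mul_exp_le hk hd (hρ ξ)
  have hEi : Integrable E μ := Integrable.of_bound hEm.aestronglyMeasurable 1 (ae_of_all _ hE1)
  have hai : Integrable a μ := Integrable.of_bound ham.aestronglyMeasurable _
    (ae_of_all _ fun ξ => by rw [Real.norm_of_nonneg (ha0 ξ)]; exact haB ξ)
  have haEi : Integrable (fun ξ => a ξ * E ξ) μ :=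
    hai.mul_bdd (c := 1) hEm.aestronglyMeasurable (ae_of_all _ hE1)
  -- exchange of the order of integration
  obtain ⟨M, hM⟩ := exists_norm_zstat_le (N := N) κ θ
  have hbound : ∀ ξ (x : Sample m k N), Real.exp (inner ℝ (c ξ) (zstat κ θ x)) ≤
      Real.exp (ρ * M) := by
    intro ξ x
    refine Real.exp_le_exp.2 ((real_inner_le_norm _ _).trans ?_)
    exact mul_le_mul (hρ ξ) (hM x) (norm_nonneg _) ((norm_nonneg _).trans (hρ ξ))
  have hprod : Integrable (fun p : Ξ × Sample m k N =>
      e p.1 * (Real.exp (inner ℝ (c p.1) (zstat κ θ p.2)) * f p.2)) (μ.prod P) := by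
    refine Integrable.of_bound ((hem.comp measurable_fst).mul
      (measurable_exp_inner_zstat_mul hc hfm)).aestronglyMeasurable (1 * (Real.exp (ρ * M) * 1))
      (ae_of_all _ fun p => ?_)
    rw [norm_mul, norm_mul, Real.norm_of_nonneg (Real.exp_pos _).le,
      Real.norm_of_nonneg (Real.exp_pos _).le]
    refine mul_le_mul ?_ (mul_le_mul (hbound _ _) (hf1 _) (norm_nonneg _) (Real.exp_pos _).le)
      (by positivity) zero_le_one
    refine Real.exp_le_one_iff.2 ?_
    have : 0 ≤ d * ‖c p.1‖ ^ 2 / 2 := by positivity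
    linarith
  have haE : ∀ ξ, a ξ * E ξ =
      ∫ x, e ξ * (Real.exp (inner ℝ (c ξ) (zstat κ θ x)) * f x) ∂P := by
    intro ξ
    have hn := (normConst_pos hk N κ (c ξ)).ne'
    simp only [ha, hE]
    rw [integral_law_shiftConc hk N κ hθ, integral_const_mul]
    field_simp
    rfl
  have hswap : ∫ ξ, a ξ * E ξ ∂μ =
      ∫ x, f x * ∫ ξ, Real.exp (inner ℝ (c ξ) (zstat κ θ x) - d * ‖c ξ‖ ^ 2 / 2) ∂μ ∂P := by
    simp_rw [haE]
    rw [integral_integral_swap hprod]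
    congr 1
    funext x
    rw [← integral_const_mul]
    congr 1
    funext ξ
    simp only [he]
    rw [sub_eq_add_neg, Real.exp_add]
    ring
  have hI1 : Integrable (fun x => f x * ∫ ξ, Real.exp (inner ℝ (c ξ) (zstat κ θ x) -
      d * ‖c ξ‖ ^ 2 / 2) ∂μ) P := by
    refine hprod.integral_prod_right.congr (ae_of_all _ fun x => ?_)
    simp only
    rw [← integral_const_mul]
    congr 1
    funext ξ
    simp only [he]
    rw [sub_eq_add_neg, Real.exp_add]
    ring
  have hcz := continuous_zstat (N := N) κ θ
  have hI2 : Integrable (fun x => f x * (K * Real.exp (inner ℝ c₀ (zstat κ θ x) -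
      d * ‖c₀‖ ^ 2 / 2))) P :=
    (integrable_sample (f := fun x => K * Real.exp (inner ℝ c₀ (zstat κ θ x) -
      d * ‖c₀‖ ^ 2 / 2)) (by fun_prop) P).bdd_mul (c := 1) hfm.aestronglyMeasurable
      (ae_of_all _ hf1)
  set a₀ := normConst k N κ c₀ * Real.exp (-(d * ‖c₀‖ ^ 2 / 2)) with ha₀
  set E₀ := ∫ x, f x ∂law N (shiftConc N κ θ c₀) with hE₀
  have hE₀1 : |E₀| ≤ 1 := abs_integral_law_le_one _ hf1
  have hmain : ∫ ξ, a ξ * E ξ ∂μ ≤ K * (a₀ * E₀) := by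
    have h0 : K * (a₀ * E₀) = ∫ x, f x * (K * Real.exp (inner ℝ c₀ (zstat κ θ x) -
        d * ‖c₀‖ ^ 2 / 2)) ∂P := by
      have hn := (normConst_pos hk N κ c₀).ne'
      rw [ha₀, hE₀, integral_law_shiftConc hk N κ hθ]
      have : K * (normConst k N κ c₀ * Real.exp (-(d * ‖c₀‖ ^ 2 / 2)) * ((normConst k N κ c₀)⁻¹ *
          ∫ x, Real.exp (inner ℝ c₀ (zstat κ θ x)) * f x ∂P)) =
          (K * Real.exp (-(d * ‖c₀‖ ^ 2 / 2))) *
            ∫ x, Real.exp (inner ℝ c₀ (zstat κ θ x)) * f x ∂P := by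
        field_simp
      rw [this, ← integral_const_mul]
      congr 1
      funext x
      rw [sub_eq_add_neg, Real.exp_add]
      ring
    rw [h0, hswap]
    refine integral_mono hI1 hI2 fun x => ?_
    have := hψ1 x
    by_cases hx : x ∈ S
    · have hfx : f x ≤ 0 := by
        simp only [hf, indicator_of_mem hx, Pi.one_apply]
        linarith [this.2]
      exact mul_le_mul_of_nonpos_left (h1 _ hx) hfx
    · have hfx : 0 ≤ f x := by
        simp only [hf, indicator_of_notMem hx, sub_zero]
        exact this.1
      exact mul_le_mul_of_nonneg_left (h2 _ hx) hfx
  have hsplit : ∫ ξ, E ξ ∂μ ≤ ∫ ξ, a ξ * E ξ ∂μ + ∫ ξ, |1 - a ξ| ∂μ := by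
    have hi : Integrable (fun ξ => |1 - a ξ|) μ := ((integrable_const 1).sub hai).abs
    rw [← integral_add haEi hi]
    refine integral_mono hEi (haEi.add hi) fun ξ => ?_
    have h3 : (1 - a ξ) * E ξ ≤ |1 - a ξ| := by
      refine (le_abs_self _).trans ?_
      rw [abs_mul]
      exact mul_le_of_le_one_right (abs_nonneg _) (hE1 ξ)
    simp only
    linarith
  have hlast : K * (a₀ * E₀) ≤ K * E₀ + K * |1 - a₀| := by
    rw [← mul_add]
    refine mul_le_mul_of_nonneg_left ?_ hK
    have : -((1 - a₀) * E₀) ≤ |1 - a₀| := by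
      refine (neg_le_abs _).trans ?_
      rw [abs_mul]
      exact mul_le_of_le_one_right (abs_nonneg _) hE₀1
    linarith
  have hEE : ∫ ξ, E ξ ∂μ = ∫ ξ, ∫ x, ψ x ∂law N (shiftConc N κ θ (c ξ)) ∂μ -
      ∫ ξ, (law N (shiftConc N κ θ (c ξ))).real S ∂μ := by
    have hm1 := measurable_integral_law_shiftConc (N := N) (κ := κ) hk hθ hc hψ
    have hm2 := measurable_integral_law_shiftConc (N := N) (κ := κ) hk hθ hc
      (measurable_one.indicator hS)
    simp only [integral_indicator_one hS] at hm2
    rw [← integral_sub]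
    · simp only [hE, hEf]
    · refine Integrable.of_bound hm1.aestronglyMeasurable 1 (ae_of_all _ fun ξ => ?_)
      refine abs_integral_law_le_one _ fun x => ?_
      rw [abs_of_nonneg (hψ1 x).1]
      exact (hψ1 x).2
    · refine Integrable.of_bound hm2.aestronglyMeasurable 1 (ae_of_all _ fun ξ => ?_)
      rw [Real.norm_of_nonneg measureReal_nonneg]
      exact measureReal_le_one
  have hE₀' := hEf (shiftConc N κ θ c₀)
  rw [← hE₀] at hE₀'
  rw [← hE₀']
  linarith

end Prior

/-- Asymptotic form of the Neyman–Pearson bound. -/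
theorem eventually_integral_power_le [NeZero k] (hk : 2 ≤ k) {N : ℕ → Fin m → ℕ}
    (hN : ∀ i, Tendsto (fun j => N j i) atTop atTop) {κ : ℝ} (hκ : 0 < κ)
    {θ : ℕ → Fin m → Vec k} (hθ : ∀ᶠ j in atTop, ∀ i, ‖θ j i‖ = 1)
    {Ξ : Type*} [MeasurableSpace Ξ] {μ : Measure Ξ} [IsProbabilityMeasure μ] {c : Ξ → Vec m}
    (hc : Measurable c) {ρ : ℝ} (hρ : ∀ ξ, ‖c ξ‖ ≤ ρ) (c₀ : Vec m) {K : ℝ} (hK : 0 ≤ K)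
    {R : Set (Vec m)} (hR : MeasurableSet R)
    (h1 : ∀ z ∈ R, K * Real.exp (inner ℝ c₀ z - D k κ * ‖c₀‖ ^ 2 / 2) ≤
      ∫ ξ, Real.exp (inner ℝ (c ξ) z - D k κ * ‖c ξ‖ ^ 2 / 2) ∂μ)
    (h2 : ∀ z ∉ R, ∫ ξ, Real.exp (inner ℝ (c ξ) z - D k κ * ‖c ξ‖ ^ 2 / 2) ∂μ ≤
      K * Real.exp (inner ℝ c₀ z - D k κ * ‖c₀‖ ^ 2 / 2))
    {ψ : TestSeq m k N} (hψ : ∀ j, Measurable (ψ j)) (hψ1 : ∀ j x, ψ j x ∈ Icc (0 : ℝ) 1)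
    {ε : ℝ} (hε : 0 < ε) :
    ∀ᶠ j in atTop, ∫ ξ, power ψ j (shiftConc (N j) κ (θ j) (c ξ)) ∂μ ≤
      ∫ ξ, (law (N j) (shiftConc (N j) κ (θ j) (c ξ))).real (zstat κ (θ j) ⁻¹' R) ∂μ +
      K * (power ψ j (shiftConc (N j) κ (θ j) c₀) -
        (law (N j) (shiftConc (N j) κ (θ j) c₀)).real (zstat κ (θ j) ⁻¹' R)) + ε := by
  have hd := (D_pos hk hκ.ne').le
  have ha : ∀ v : Vec m, Tendsto (fun j => |1 - normConst k (N j) κ v *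
      Real.exp (-(D k κ * ‖v‖ ^ 2 / 2))|) atTop (𝓝 0) := by
    intro v
    have h := ((tendsto_normConst hk hN hκ.ne' v).mul_const
      (Real.exp (-(D k κ * ‖v‖ ^ 2 / 2)))).const_sub 1
    rw [← Real.exp_add, add_neg_cancel, Real.exp_zero, sub_self] at h
    simpa using h.abs
  have hI : Tendsto (fun j => ∫ ξ, |1 - normConst k (N j) κ (c ξ) *
      Real.exp (-(D k κ * ‖c ξ‖ ^ 2 / 2))| ∂μ) atTop (𝓝 0) := by
    have h0 : (0 : ℝ) = ∫ _ξ : Ξ, (0 : ℝ) ∂μ := by simp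
    rw [h0]
    -- The convergence is pointwise in the prior variable; the Hoeffding bound on the normalizing
    -- constants over a bounded support provides the dominating constant.
    refine tendsto_integral_filter_of_dominated_convergence
      (fun _ => 1 + Real.exp (ρ ^ 2 / 2)) ?_ (Eventually.of_forall fun j => ae_of_all _ fun ξ => ?_)
      (integrable_const _) (ae_of_all _ fun ξ => ha (c ξ))
    · filter_upwards [hθ] with j hj
      have hm1 := measurable_normConst (N := N j) (κ := κ) hk hj hc
      have hm2 := hc.norm
      exact Measurable.aestronglyMeasurable (by fun_prop)
    · rw [Real.norm_eq_abs, abs_abs]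
      have h3 := normConst_mul_exp_le (N := N j) (κ := κ) hk hd (hρ ξ)
      have h4 : 0 ≤ normConst k (N j) κ (c ξ) * Real.exp (-(D k κ * ‖c ξ‖ ^ 2 / 2)) :=
        mul_nonneg (normConst_pos hk _ κ _).le (Real.exp_pos _).le
      rw [abs_le]
      have h5 := Real.exp_pos (ρ ^ 2 / 2)
      constructor <;> linarith
  have hsum := hI.add ((ha c₀).const_mul K)
  rw [mul_zero, add_zero] at hsum
  filter_upwards [hθ, hsum.eventually_lt_const hε] with j hj1 hj2
  have h := integral_power_le_of_prior (N := N j) (κ := κ) hk hj1 hc hρ c₀ hK hd hR h1 h2 (hψ j)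
    (hψ1 j)
  simp only [power]
  linarith

end FvML

namespace FvML

variable {m k : ℕ}

/-! ### The Laplace transform of the uniform distribution on the sphere -/

/-- The Laplace transform of the uniform distribution on the sphere. -/
def sphTransform (n : ℕ) (ρ : ℝ) (y : Vec n) : ℝ :=
  ∫ x : Sph n, Real.exp (ρ * inner ℝ (x : Vec n) y) ∂fvml n 0 0

lemma sphTransform_nonneg {n : ℕ} (ρ : ℝ) (y : Vec n) : 0 ≤ sphTransform n ρ y :=
  integral_nonneg fun _ => (Real.exp_pos _).le

section SphTransform

variable {n : ℕ} [NeZero n] (ρ : ℝ)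

lemma integrable_fvml_of_continuous {f : Sph n → ℝ} (hf : Continuous f) (κ : ℝ) (θ : Vec n) :
    Integrable f (fvml n κ θ) :=
  hf.integrable_of_hasCompactSupport (HasCompactSupport.of_compactSpace _)

lemma sphTransform_isometry (U : Vec n ≃ₗᵢ[ℝ] Vec n) (y : Vec n) :
    sphTransform n ρ (U y) = sphTransform n ρ y := by
  have h := integral_fvml_comp_sphMap 0 U (map_zero U)
    (f := fun x : Sph n => Real.exp (ρ * inner ℝ (x : Vec n) (U y))) (by fun_prop)
  simp only [coe_sphMap, LinearIsometryEquiv.inner_map_map] at h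
  exact h.symm

lemma sphTransform_congr_norm {y y' : Vec n} (h : ‖y‖ = ‖y'‖) :
    sphTransform n ρ y = sphTransform n ρ y' := by
  rcases eq_or_ne y 0 with rfl | hy
  · rw [norm_zero] at h
    rw [norm_eq_zero.1 h.symm]
  have hy0 : 0 < ‖y‖ := norm_pos_iff.2 hy
  have h1 : ‖‖y‖⁻¹ • y‖ = 1 := by rw [norm_smul, norm_inv, norm_norm, inv_mul_cancel₀ hy0.ne']
  have h2 : ‖‖y‖⁻¹ • y'‖ = 1 := by
    rw [norm_smul, norm_inv, norm_norm, ← h, inv_mul_cancel₀ hy0.ne']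
  obtain ⟨U, hU⟩ := exists_isometry_map_eq h2 h1
  have h3 : U y = y' := by
    have := congrArg (fun w => ‖y‖ • w) hU
    simpa only [map_smul, smul_smul, mul_inv_cancel₀ hy0.ne', one_smul] using this
  rw [← h3, sphTransform_isometry]

/-- For `t` in `[0,1]`, `t x` is a convex combination of `x` and `-x`, and by symmetry the transform
takes the same value at `y` and at `-y`. -/
lemma sphTransform_smul_le {t : ℝ} (h0 : 0 ≤ t) (h1 : t ≤ 1) (y : Vec n) :
    sphTransform n ρ (t • y) ≤ sphTransform n ρ y := by
  have hneg : sphTransform n ρ (-y) = sphTransform n ρ y :=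
    sphTransform_congr_norm ρ (norm_neg y)
  have hconv : ∀ x : ℝ, Real.exp (t * x) ≤
      (1 + t) / 2 * Real.exp x + (1 - t) / 2 * Real.exp (-x) := by
    intro x
    have := convexOn_exp.2 (mem_univ x) (mem_univ (-x)) (show 0 ≤ (1 + t) / 2 by linarith)
      (show 0 ≤ (1 - t) / 2 by linarith) (by ring)
    simp only [smul_eq_mul] at this
    rwa [show (1 + t) / 2 * x + (1 - t) / 2 * -x = t * x by ring] at this
  have hi : ∀ w : Vec n, Integrable (fun x : Sph n => Real.exp (ρ * inner ℝ (x : Vec n) w))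
      (fvml n 0 0) := fun w => integrable_fvml_of_continuous (by fun_prop) _ _
  calc sphTransform n ρ (t • y)
      ≤ ∫ x : Sph n, ((1 + t) / 2 * Real.exp (ρ * inner ℝ (x : Vec n) y) +
        (1 - t) / 2 * Real.exp (ρ * inner ℝ (x : Vec n) (-y))) ∂fvml n 0 0 := by
        refine integral_mono (hi _) (((hi y).const_mul _).add ((hi (-y)).const_mul _)) fun x => ?_
        have := hconv (ρ * inner ℝ (x : Vec n) y)
        simp only [inner_smul_right, inner_neg_right]
        rwa [mul_neg, mul_left_comm ρ t]
    _ = (1 + t) / 2 * sphTransform n ρ y + (1 - t) / 2 * sphTransform n ρ (-y) := by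
        rw [integral_add ((hi y).const_mul _) ((hi (-y)).const_mul _), integral_const_mul,
          integral_const_mul]
        rfl
    _ = sphTransform n ρ y := by rw [hneg]; ring

/-- Rotation invariance reduces the comparison to one ray, where scaling down decreases the
transform. This monotonicity turns the likelihood ratio region of the uniform prior into a
chi-square region. -/
lemma sphTransform_mono {y y' : Vec n} (h : ‖y‖ ≤ ‖y'‖) :
    sphTransform n ρ y ≤ sphTransform n ρ y' := by
  rcases eq_or_ne y' 0 with rfl | hy
  · rw [norm_zero] at h
    rw [norm_le_zero_iff.1 h]
  have hy0 : 0 < ‖y'‖ := norm_pos_iff.2 hy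
  have h1 : ‖y‖ = ‖(‖y‖ / ‖y'‖) • y'‖ := by
    rw [norm_smul, norm_div, norm_norm, norm_norm, div_mul_cancel₀ _ hy0.ne']
  rw [sphTransform_congr_norm ρ h1]
  exact sphTransform_smul_le ρ (by positivity) ((div_le_one hy0).2 h) y'

end SphTransform

/-! ### Limits of rejection probabilities -/

/-- The rejection region here uses the limit direction `s` and the true `D k κ`: it is the ideal
version of the chi-square test to which competitors are compared. -/
lemma tendsto_zstat_projection [NeZero k] (hm : 2 ≤ m) (hk : 2 ≤ k) {N : ℕ → Fin m → ℕ}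
    (hN : ∀ i, Tendsto (fun j => N j i) atTop atTop) {κ : ℝ} (hκ : 0 < κ)
    {θ : ℕ → Fin m → Vec k} (hθ : ∀ᶠ j in atTop, ∀ i, ‖θ j i‖ = 1) {s : Vec m} (hs : ‖s‖ = 1)
    (c : Vec m) (q : ℝ) :
    Tendsto (fun j => (law (N j) (shiftConc (N j) κ (θ j) c)).real
        (zstat κ (θ j) ⁻¹' {z | D k κ * q < ‖z‖ ^ 2 - inner ℝ s z ^ 2})) atTop
      (𝓝 ((noncentralChiSq (m - 1) (D k κ * (‖c‖ ^ 2 - inner ℝ s c ^ 2))).real (Ioi q))) := by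
  have hD := D_pos hk hκ.ne'
  obtain ⟨n, rfl⟩ : ∃ n, m = n + 2 := ⟨m - 2, by omega⟩
  have h := (tendstoInDistribution_zstat hk hN hκ.ne' hθ c).continuous_comp
    (g := fun z : Vec (n + 2) => (D k κ)⁻¹ * (‖z‖ ^ 2 - inner ℝ s z ^ 2)) (by fun_prop)
  have hμ : (stdGaussian (Vec (n + 2))).map ((fun z : Vec (n + 2) => (D k κ)⁻¹ *
      (‖z‖ ^ 2 - inner ℝ s z ^ 2)) ∘ fun z => √(D k κ) • z + D k κ • c) =
      noncentralChiSq (n + 2 - 1) (D k κ * (‖c‖ ^ 2 - inner ℝ s c ^ 2)) := by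
    have h2 := map_stdGaussian_projection hm hs (√(D k κ) • c)
    rw [norm_smul, inner_smul_right, Real.norm_of_nonneg (Real.sqrt_nonneg _), mul_pow, mul_pow,
      Real.sq_sqrt hD.le, ← mul_sub] at h2
    rw [← h2]
    congr 1
    funext z
    have e : √(D k κ) • z + D k κ • c = √(D k κ) • (z + √(D k κ) • c) := by
      rw [smul_add, smul_smul, Real.mul_self_sqrt hD.le]
    simp only [Function.comp_apply]
    rw [e, norm_smul, inner_smul_right, Real.norm_of_nonneg (Real.sqrt_nonneg _), mul_pow, mul_pow,
      Real.sq_sqrt hD.le]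
    field_simp
  have h3 := tendsto_measureReal_Ioi_of_tendstoInDistribution
    (fun j => (Continuous.comp (by fun_prop) (continuous_zstat κ (θ j))).measurable) h hμ
    (noncentralChiSq_singleton n _) q
  refine h3.congr fun j => ?_
  congr 1
  ext x
  simp only [mem_ofPred_eq, Function.comp_apply, Set.mem_preimage]
  rw [← div_eq_inv_mul, lt_div_iff₀ hD, mul_comm]

lemma tendsto_zstat_inner [NeZero k] (hk : 2 ≤ k) {N : ℕ → Fin m → ℕ}
    (hN : ∀ i, Tendsto (fun j => N j i) atTop atTop) {κ : ℝ} (hκ : 0 < κ)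
    {θ : ℕ → Fin m → Vec k} (hθ : ∀ᶠ j in atTop, ∀ i, ‖θ j i‖ = 1) {u : Vec m} (hu : ‖u‖ = 1)
    (c : Vec m) (q : ℝ) :
    Tendsto (fun j => (law (N j) (shiftConc (N j) κ (θ j) c)).real
        (zstat κ (θ j) ⁻¹' {z | √(D k κ) * q < inner ℝ u z})) atTop
      (𝓝 ((gaussianReal (√(D k κ) * inner ℝ u c) 1).real (Ioi q))) := by
  have hD := Real.sqrt_pos.2 (D_pos hk hκ.ne')
  have h := (tendstoInDistribution_zstat hk hN hκ.ne' hθ c).continuous_comp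
    (g := fun z : Vec m => (√(D k κ))⁻¹ * inner ℝ u z) (by fun_prop)
  have hμ : (stdGaussian (Vec m)).map ((fun z : Vec m => (√(D k κ))⁻¹ * inner ℝ u z) ∘
      fun z => √(D k κ) • z + D k κ • c) = gaussianReal (√(D k κ) * inner ℝ u c) 1 := by
    have h2 := map_stdGaussian_inner hu (√(D k κ) • c)
    rw [inner_smul_right] at h2
    rw [← h2]
    congr 1
    funext z
    have e : √(D k κ) • z + D k κ • c = √(D k κ) • (z + √(D k κ) • c) := by
      rw [smul_add, smul_smul, Real.mul_self_sqrt (D_pos hk hκ.ne').le]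
    simp only [Function.comp_apply]
    rw [e, inner_smul_right, inv_mul_cancel_left₀ hD.ne']
  have h3 := tendsto_measureReal_Ioi_of_tendstoInDistribution
    (fun j => (Continuous.comp (by fun_prop) (continuous_zstat κ (θ j))).measurable) h hμ
    (gaussianReal_singleton _) q
  refine h3.congr fun j => ?_
  congr 1
  ext x
  simp only [mem_ofPred_eq, Function.comp_apply, Set.mem_preimage]
  rw [← div_eq_inv_mul, lt_div_iff₀ hD, mul_comm]

/-! ### The envelope power -/

/-- An asymptotic upper bound for the power, along local alternatives, of asymptotically
level-`α` tests. -/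
theorem eventually_power_le_envelope [NeZero k] (hk : 2 ≤ k) {N : ℕ → Fin m → ℕ}
    (hN : ∀ i, Tendsto (fun j => N j i) atTop atTop) {κ : ℝ} (hκ : 0 < κ)
    {θ : ℕ → Fin m → Vec k} (hθ : ∀ᶠ j in atTop, ∀ i, ‖θ j i‖ = 1)
    {ψ : TestSeq m k N} (hψ : ∀ j, Measurable (ψ j)) (hψ1 : ∀ j x, ψ j x ∈ Icc (0 : ℝ) 1)
    {u c₀ : Vec m} (hu : ‖u‖ = 1) (huc : inner ℝ u c₀ = (0 : ℝ)) {ρ : ℝ} (hρ : 0 < ρ) {q : ℝ}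
    (hlevel : ∀ ε > 0, ∀ᶠ j in atTop, power ψ j (shiftConc (N j) κ (θ j) c₀) ≤
      (gaussianReal 0 1).real (Ioi q) + ε) {ε : ℝ} (hε : 0 < ε) :
    ∀ᶠ j in atTop, power ψ j (shiftConc (N j) κ (θ j) (c₀ + ρ • u)) ≤
      (gaussianReal (√(D k κ) * ρ) 1).real (Ioi q) + ε := by
  have hD := D_pos hk hκ.ne'
  set d := D k κ with hd
  set R : Set (Vec m) := {z | √d * q < inner ℝ u z} with hR
  have hRm : MeasurableSet R := measurableSet_lt measurable_const (by fun_prop)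
  -- The value of the likelihood ratio between `c₀ + ρ u` and `c₀` on the boundary of `R`. As `u` is
  -- orthogonal to `c₀`, the ratio depends on `z` only through its component along `u`, so the
  -- Neyman–Pearson region is a half-space.
  set K := Real.exp (ρ * (√d * q) - d * ρ ^ 2 / 2) with hK
  have hK0 : 0 < K := Real.exp_pos _
  have hnorm : ‖c₀ + ρ • u‖ ^ 2 = ‖c₀‖ ^ 2 + ρ ^ 2 := by
    rw [norm_add_sq_real, inner_smul_right, real_inner_comm u c₀, huc, norm_smul, hu,
      Real.norm_of_nonneg hρ.le]
    ring
  have hratio : ∀ z : Vec m, Real.exp (inner ℝ (c₀ + ρ • u) z - d * ‖c₀ + ρ • u‖ ^ 2 / 2) =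
      Real.exp (ρ * inner ℝ u z - d * ρ ^ 2 / 2) *
        Real.exp (inner ℝ c₀ z - d * ‖c₀‖ ^ 2 / 2) := by
    intro z
    rw [← Real.exp_add, hnorm, inner_add_left, inner_smul_left]
    congr 1
    simp only [conj_trivial]
    ring
  -- A point mass as prior: testing a simple null against a simple alternative.
  have h := eventually_integral_power_le hk hN hκ hθ (μ := Measure.dirac ())
    (c := fun _ => c₀ + ρ • u) measurable_const (fun _ => le_rfl) c₀ hK0.le hRm
    (fun z hz => by
      rw [integral_dirac, ← hd, hratio, hK]
      gcongr
      exact le_of_lt hz)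
    (fun z hz => by
      rw [integral_dirac, ← hd, hratio, hK]
      gcongr
      exact not_lt.1 hz) hψ hψ1 (show 0 < ε / 4 by positivity)
  simp only [integral_dirac] at h
  have hη : 0 < ε / (8 * K) := by positivity
  have h1 := tendsto_zstat_inner hk hN hκ hθ hu (c₀ + ρ • u) q
  have h2 := tendsto_zstat_inner hk hN hκ hθ hu c₀ q
  have h11 : inner ℝ u u = (1 : ℝ) := by rw [real_inner_self_eq_norm_sq, hu]; norm_num
  rw [inner_add_right, inner_smul_right, huc, h11, zero_add, mul_one] at h1
  rw [huc, mul_zero] at h2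
  filter_upwards [h, hlevel _ hη, h1.eventually_lt_const (lt_add_of_pos_right _
    (show 0 < ε / 4 by positivity)), h2.eventually_const_lt (sub_lt_self _ hη)]
    with j hj1 hj2 hj3 hj4
  have h5 : K * (power ψ j (shiftConc (N j) κ (θ j) c₀) -
      (law (N j) (shiftConc (N j) κ (θ j) c₀)).real (zstat κ (θ j) ⁻¹' R)) ≤
      K * (2 * (ε / (8 * K))) := by
    gcongr
    linarith
  have h6 : K * (2 * (ε / (8 * K))) = ε / 4 := by
    field_simp
    norm_num
  linarith

/-! ### The minimax bound -/

/-- On every sphere of alternatives orthogonal to `s`, the minimal asymptotic power of asymptotically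
level-`α` tests does not exceed the one of the chi-square test. -/
theorem exists_frequently_power_le [NeZero k] (hm : 2 ≤ m) (hk : 2 ≤ k) {N : ℕ → Fin m → ℕ}
    (hN : ∀ i, Tendsto (fun j => N j i) atTop atTop) {κ : ℝ} (hκ : 0 < κ) {θ : Fin m → Vec k}
    (hθ : ∀ i, ‖θ i‖ = 1) {ψ : TestSeq m k N} (hψ : ∀ j, Measurable (ψ j))
    (hψ1 : ∀ j x, ψ j x ∈ Icc (0 : ℝ) 1) {s : Vec m} (hs : ‖s‖ = 1) {q : ℝ}
    (hlevel : ∀ ε > 0, ∀ᶠ j in atTop, power ψ j (shiftConc (N j) κ θ 0) ≤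
      (chiSq (m - 1)).real (Ioi q) + ε) {δ : ℝ} (hδ : 0 < δ) {ε : ℝ} (hε : 0 < ε) :
    ∃ c : Vec m, inner ℝ s c = (0 : ℝ) ∧ D k κ * ‖c‖ ^ 2 = δ ∧
      ∃ᶠ j in atTop, power ψ j (shiftConc (N j) κ θ c) ≤
        (noncentralChiSq (m - 1) δ).real (Ioi q) + ε := by
  obtain ⟨n, rfl⟩ : ∃ n, m = n + 2 := ⟨m - 2, by omega⟩
  have hD := D_pos hk hκ.ne'
  set d := D k κ with hd
  obtain ⟨b, hb0, -⟩ := exists_adapted_basis hs 0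
  -- the isometric embedding on the orthogonal complement of `s` and its adjoint
  let J : Vec (n + 1) → Vec (n + 2) := fun w => ∑ i, w i • b i.succ
  let J' : Vec (n + 2) → Vec (n + 1) := fun z => WithLp.toLp 2 fun i => inner ℝ (b i.succ) z
  have hadj : ∀ w z, inner ℝ (J w) z = inner ℝ w (J' z) := by
    intro w z
    simp only [J, J', sum_inner, inner_smul_left, PiLp.inner_apply, RCLike.inner_apply,
      conj_trivial]
    exact Finset.sum_congr rfl fun i _ => mul_comm _ _
  have hJ'n : ∀ z, ‖J' z‖ ^ 2 = ‖z‖ ^ 2 - inner ℝ s z ^ 2 := by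
    intro z
    rw [← b.sum_sq_norm_inner_right z, Fin.sum_univ_succ, hb0, EuclideanSpace.norm_sq_eq]
    simp [J']
  have hJ'J : ∀ w, J' (J w) = w := by
    intro w
    ext i
    simp only [J, J', inner_sum]
    rw [Finset.sum_eq_single i]
    · rw [inner_smul_right, real_inner_self_eq_norm_sq, b.norm_eq_one]
      simp
    · intro j _ hj
      rw [inner_smul_right, b.inner_eq_zero fun h => hj (Fin.succ_injective _ h).symm, mul_zero]
    · simp
  have hJn : ∀ w, ‖J w‖ = ‖w‖ := by
    intro w
    have : ‖J w‖ ^ 2 = ‖w‖ ^ 2 := by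
      rw [← real_inner_self_eq_norm_sq, hadj, hJ'J, real_inner_self_eq_norm_sq]
    exact (sq_eq_sq₀ (norm_nonneg _) (norm_nonneg _)).1 this
  have hsJ : ∀ w, inner ℝ s (J w) = (0 : ℝ) := by
    intro w
    simp only [J, inner_sum, inner_smul_right, ← hb0]
    exact Finset.sum_eq_zero fun i _ => by rw [b.inner_eq_zero (Fin.succ_ne_zero i).symm, mul_zero]
  -- The radius at which the noncentrality `d ‖c‖²` equals `δ`.
  set ρ := √(δ / d) with hρ
  have hρ0 : 0 ≤ ρ := Real.sqrt_nonneg _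
  have hρ2 : d * ρ ^ 2 = δ := by
    rw [hρ, Real.sq_sqrt (by positivity)]
    field_simp
  set c : Sph (n + 1) → Vec (n + 2) := fun x => ρ • J x with hc
  have hcn : ∀ x, ‖c x‖ = ρ := by
    intro x
    have hx : ‖(x : Vec (n + 1))‖ = 1 := by simp
    rw [hc, norm_smul, hJn, hx, mul_one, Real.norm_of_nonneg hρ0]
  have hcc : Continuous c := by
    simp only [hc, J]
    fun_prop
  have hsc : ∀ x, inner ℝ s (c x) = (0 : ℝ) := fun x => by
    rw [hc, inner_smul_right, hsJ, mul_zero]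
  set β := (noncentralChiSq (n + 2 - 1) δ).real (Ioi q) with hβ
  by_contra hcon
  push Not at hcon
  have hev : ∀ x, ∀ᶠ j in atTop, β + ε < power ψ j (shiftConc (N j) κ θ (c x)) := by
    intro x
    exact hcon (c x) (hsc x) (by rw [hcn, hρ2])
  set R : Set (Vec (n + 2)) := {z | d * q < ‖z‖ ^ 2 - inner ℝ s z ^ 2} with hR
  have hRm : MeasurableSet R := measurableSet_lt measurable_const
    (Continuous.measurable (by fun_prop))
  -- Any vector of norm `√(d q)` would do, as the transform depends only on the norm. It fixes the
  -- threshold `K`, the mixture likelihood ratio at the boundary of `R`.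
  set y₀ : Vec (n + 1) := EuclideanSpace.single 0 √(d * q) with hy₀
  have hy₀n : ‖y₀‖ = √(d * q) := by
    rw [hy₀, PiLp.norm_single, Real.norm_of_nonneg (Real.sqrt_nonneg _)]
  set K := Real.exp (-(δ / 2)) * sphTransform (n + 1) ρ y₀ with hK
  have hK0 : 0 ≤ K := mul_nonneg (Real.exp_pos _).le (sphTransform_nonneg ρ y₀)
  have hmix : ∀ z, ∫ x, Real.exp (inner ℝ (c x) z - d * ‖c x‖ ^ 2 / 2) ∂fvml (n + 1) 0 0 =
      Real.exp (-(δ / 2)) * sphTransform (n + 1) ρ (J' z) := by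
    intro z
    rw [sphTransform, ← integral_const_mul]
    congr 1
    funext x
    rw [hcn, hρ2, ← Real.exp_add, hc, inner_smul_left, hadj]
    congr 1
    simp only [conj_trivial]
    ring
  have hzero : ∀ z : Vec (n + 2), K * Real.exp (inner ℝ (0 : Vec (n + 2)) z -
      d * ‖(0 : Vec (n + 2))‖ ^ 2 / 2) = K := by
    intro z
    simp
  have hθe : ∀ᶠ _j : ℕ in atTop, ∀ i, ‖θ i‖ = 1 := Eventually.of_forall fun _ => hθ
  have hbound := eventually_integral_power_le hk hN hκ (θ := fun _ => θ) hθe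
    (μ := fvml (n + 1) 0 0) hcc.measurable (fun x => (hcn x).le) 0 hK0 hRm
    (fun z hz => by
      rw [← hd, hzero, hmix]
      have : ‖y₀‖ ≤ ‖J' z‖ := by
        rw [hy₀n, ← Real.sqrt_sq (norm_nonneg (J' z)), hJ'n]
        exact Real.sqrt_le_sqrt (le_of_lt hz)
      exact mul_le_mul_of_nonneg_left (sphTransform_mono ρ this) (Real.exp_pos _).le)
    (fun z hz => by
      rw [← hd, hzero, hmix]
      have : ‖J' z‖ ≤ ‖y₀‖ := by
        rw [hy₀n, ← Real.sqrt_sq (norm_nonneg (J' z)), hJ'n]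
        exact Real.sqrt_le_sqrt (not_lt.1 hz)
      exact mul_le_mul_of_nonneg_left (sphTransform_mono ρ this) (Real.exp_pos _).le)
    hψ hψ1 (show 0 < ε / 8 by positivity)
  -- the average power of the chi-square test
  have hlim : ∀ v : Vec (n + 2), _ := fun v =>
    tendsto_zstat_projection hm hk hN hκ (θ := fun _ => θ) hθe hs v q
  have hPR : Tendsto (fun j => ∫ x, (law (N j) (shiftConc (N j) κ θ (c x))).real
      (zstat κ θ ⁻¹' R) ∂fvml (n + 1) 0 0) atTop (𝓝 β) := by
    have h0 : β = ∫ _x : Sph (n + 1), β ∂fvml (n + 1) 0 0 := by simp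
    rw [h0]
    refine tendsto_integral_of_dominated_convergence (fun _ => 1) (fun j => ?_)
      (integrable_const _) (fun j => ae_of_all _ fun x => ?_) (ae_of_all _ fun x => ?_)
    · have hS : MeasurableSet (zstat κ θ ⁻¹' R : Set (Sample (n + 2) k (N j))) :=
        (continuous_zstat κ θ).measurable hRm
      have := measurable_integral_law_shiftConc (N := N j) (κ := κ) hk hθ hcc.measurable
        (measurable_one.indicator hS)
      simp only [integral_indicator_one hS] at this
      exact this.aestronglyMeasurable
    · rw [Real.norm_of_nonneg measureReal_nonneg]
      exact measureReal_le_one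
    · have := hlim (c x)
      rw [hsc, hcn, ← hd, zero_pow two_ne_zero, sub_zero, hρ2] at this
      exact this
  have hP0 := hlim 0
  simp only [norm_zero, inner_zero_right, ne_eq, OfNat.ofNat_ne_zero, not_false_eq_true, zero_pow,
    sub_self, mul_zero] at hP0
  -- a lower bound for the average power of `ψ`
  have hfm : ∀ j, Measurable fun x => power ψ j (shiftConc (N j) κ θ (c x)) := fun j =>
    measurable_integral_law_shiftConc hk hθ hcc.measurable (hψ j)
  have hf01 : ∀ j ϑ, 0 ≤ power ψ j ϑ ∧ power ψ j ϑ ≤ 1 := by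
    intro j ϑ
    refine ⟨integral_nonneg fun x => (hψ1 j x).1, (le_abs_self _).trans
      (abs_integral_law_le_one ϑ fun x => ?_)⟩
    rw [abs_of_nonneg (hψ1 j x).1]
    exact (hψ1 j x).2
  have hβ0 : 0 ≤ β := measureReal_nonneg
  -- By contradiction hypothesis the power exceeds `β + ε` eventually at each point of the sphere,
  -- but not uniformly. Dominated convergence of the shortfall is enough for the average power.
  have hneg : Tendsto (fun j => ∫ x, max (β + ε - power ψ j (shiftConc (N j) κ θ (c x))) 0
      ∂fvml (n + 1) 0 0) atTop (𝓝 0) := by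
    rw [show 𝓝 (0 : ℝ) = 𝓝 (∫ _x : Sph (n + 1), (0 : ℝ) ∂fvml (n + 1) 0 0) by simp]
    refine tendsto_integral_of_dominated_convergence (fun _ => β + ε)
      (fun j => ((measurable_const.sub (hfm j)).max measurable_const).aestronglyMeasurable)
      (integrable_const _) (fun j => ae_of_all _ fun x => ?_) (ae_of_all _ fun x => ?_)
    · rw [Real.norm_of_nonneg (le_max_right _ _)]
      refine max_le ?_ (by positivity)
      linarith [(hf01 j (shiftConc (N j) κ θ (c x))).1]
    · refine tendsto_const_nhds.congr' ?_
      filter_upwards [hev x] with j hj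
      rw [max_eq_right (by linarith)]
  have hlow : ∀ j, β + ε - ∫ x, power ψ j (shiftConc (N j) κ θ (c x)) ∂fvml (n + 1) 0 0 ≤
      ∫ x, max (β + ε - power ψ j (shiftConc (N j) κ θ (c x))) 0 ∂fvml (n + 1) 0 0 := by
    intro j
    have hi : Integrable (fun x => power ψ j (shiftConc (N j) κ θ (c x))) (fvml (n + 1) 0 0) :=
      Integrable.of_bound (hfm j).aestronglyMeasurable 1 (ae_of_all _ fun x => by
        rw [Real.norm_of_nonneg (hf01 j _).1]; exact (hf01 j _).2)
    have h0 : β + ε - ∫ x, power ψ j (shiftConc (N j) κ θ (c x)) ∂fvml (n + 1) 0 0 =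
        ∫ x, (β + ε - power ψ j (shiftConc (N j) κ θ (c x))) ∂fvml (n + 1) 0 0 := by
      rw [integral_sub (integrable_const _) hi]
      simp
    rw [h0]
    have hi2 : Integrable (fun x => β + ε - power ψ j (shiftConc (N j) κ θ (c x)))
        (fvml (n + 1) 0 0) := (integrable_const _).sub hi
    exact integral_mono hi2 hi2.pos_part fun x => le_max_left _ _
  have hη : 0 < ε / (16 * (K + 1)) := by positivity
  obtain ⟨j, hj1, hj2, hj3, hj4, hj5⟩ := (hbound.and ((hlevel _ hη).and
    ((hPR.eventually_lt_const (lt_add_of_pos_right _ (show 0 < ε / 8 by positivity))).and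
    ((hP0.eventually_const_lt (sub_lt_self _ hη)).and
    (hneg.eventually_lt_const (show 0 < ε / 8 by positivity)))))).exists
  have h5 : K * (power ψ j (shiftConc (N j) κ θ 0) -
      (law (N j) (shiftConc (N j) κ θ 0)).real (zstat κ θ ⁻¹' R)) ≤
      K * (2 * (ε / (16 * (K + 1)))) := by
    refine mul_le_mul_of_nonneg_left ?_ hK0
    linarith
  have h6 : K * (2 * (ε / (16 * (K + 1)))) ≤ ε / 8 := by
    rw [mul_div_assoc', mul_div_assoc', div_le_div_iff₀ (by positivity) (by positivity)]
    nlinarith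
  have h7 := hlow j
  linarith

end FvML

namespace FvML

variable {m k : ℕ}

/-! ### Local perturbations and the null hypothesis -/

lemma exists_eq_of_mem_nullHyp (hm : 2 ≤ m) {ϑ : Param m k} (h : ϑ ∈ nullHyp m k) :
    ∃ (κ : ℝ) (θ : Fin m → Vec k), 0 < κ ∧ (∀ i, ‖θ i‖ = 1) ∧ ϑ = ⟨fun _ => κ, θ⟩ := by
  obtain ⟨conc, loc⟩ := ϑ
  refine ⟨conc ⟨0, by omega⟩, loc, (h.1 _).1, fun i => (h.1 i).2, ?_⟩
  congr 1
  funext i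
  exact h.2 i _

lemma AssumptionA.norm_sqrt {N : ℕ → Fin m → ℕ} {r : Fin m → ℝ} (hA : AssumptionA N r) :
    ‖(WithLp.toLp 2 fun i => √(r i) : Vec m)‖ = 1 := by
  rw [EuclideanSpace.norm_eq, Real.sqrt_eq_one, ← hA.sum_eq_one]
  refine Finset.sum_congr rfl fun i _ => ?_
  rw [Real.norm_eq_abs, sq_abs, Real.sq_sqrt (hA.pos i).le]

lemma noncentrality_eq (r c : Fin m → ℝ) :
    ‖(WithLp.toLp 2 c : Vec m)‖ ^ 2 -
      inner ℝ (WithLp.toLp 2 fun i => √(r i) : Vec m) (WithLp.toLp 2 c) ^ 2 =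
      ∑ i, c i ^ 2 - (∑ i, √(r i) * c i) ^ 2 := by
  rw [EuclideanSpace.norm_sq_eq, PiLp.inner_apply]
  simp [mul_comm]

lemma map_stdGaussian_noncentralChiSq (hm : 2 ≤ m) {r : Fin m → ℝ} {N : ℕ → Fin m → ℕ}
    (hA : AssumptionA N r) {d : ℝ} (hd : 0 ≤ d) (c : Fin m → ℝ) :
    (stdGaussian (Vec m)).map (fun z => ‖z + √d • (WithLp.toLp 2 c : Vec m)‖ ^ 2 -
        inner ℝ (WithLp.toLp 2 fun i => √(r i) : Vec m)
          (z + √d • (WithLp.toLp 2 c : Vec m)) ^ 2) =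
      noncentralChiSq (m - 1) (d * (∑ i, c i ^ 2 - (∑ i, √(r i) * c i) ^ 2)) := by
  have hμ := map_stdGaussian_projection hm hA.norm_sqrt (√d • (WithLp.toLp 2 c : Vec m))
  rwa [norm_smul, inner_smul_right, Real.norm_of_nonneg (Real.sqrt_nonneg _), mul_pow, mul_pow,
    Real.sq_sqrt hd, ← mul_sub, noncentrality_eq] at hμ

/-! ### Local perturbations inside the null and the alternative hypotheses -/

section Perturb

variable {N : ℕ → Fin m → ℕ} {r : Fin m → ℝ} {κ : ℝ} {θ : Fin m → Vec k}

lemma AssumptionA.eventually_ratio_pos (hA : AssumptionA N r) :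
    ∀ᶠ j in atTop, 0 < (√(total (N j) : ℝ))⁻¹ ∧ ∀ i, 0 < √(ratio (N j) i) := by
  have h1 : ∀ᶠ j in atTop, ∀ i, 0 < ratio (N j) i :=
    eventually_all.2 fun i => (hA.ratio_tendsto i).eventually_const_lt (hA.pos i)
  filter_upwards [h1, hA.total_tendsto.eventually_gt_atTop 0] with j hj1 hj2
  exact ⟨inv_pos.2 (Real.sqrt_pos.2 (by exact_mod_cast hj2)), fun i => Real.sqrt_pos.2 (hj1 i)⟩

lemma isLocalPerturbation_of_conc (hA : AssumptionA N r) (hκ : 0 < κ)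
    {c : ℕ → Fin m → ℝ} {c' : Fin m → ℝ} (hc : Tendsto c atTop (𝓝 c')) {t : ℕ → Fin m → Vec k}
    (ht : ∃ M : ℝ, ∀ j i, ‖t j i‖ ≤ M)
    (hu : ∀ᶠ j in atTop, ∀ i, ‖(perturb (N j) ⟨fun _ => κ, θ⟩ (c j) (t j)).loc i‖ = 1) :
    IsLocalPerturbation N ⟨fun _ => κ, θ⟩ c t c' := by
  refine ⟨hc, ht, ?_⟩
  have h1 : ∀ᶠ j in atTop, ∀ i, 0 < κ + (√(N j i : ℝ))⁻¹ * c j i := by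
    refine eventually_all.2 fun i => ?_
    have h2 := (tendsto_inv_atTop_zero.comp (tendsto_sqrt_size (hA.tendsto_size i))).mul
      (tendsto_pi_nhds.1 hc i)
    have h3 := h2.const_add κ
    rw [zero_mul, add_zero] at h3
    exact h3.eventually_const_lt hκ
  filter_upwards [h1, hu] with j hj1 hj2 i
  refine ⟨?_, hj2 i⟩
  rw [perturb_eq]
  exact hj1 i

lemma perturb_zero_loc (N : Fin m → ℕ) (κ : ℝ) (θ : Fin m → Vec k) (c : Fin m → ℝ) :
    perturb N ⟨fun _ => κ, θ⟩ c 0 = shiftConc N κ θ (WithLp.toLp 2 c) := by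
  rw [perturb_eq_shiftConc]
  simp

lemma isLocalPerturbation_const (hA : AssumptionA N r) (hκ : 0 < κ) (hθ : ∀ i, ‖θ i‖ = 1)
    (c : Fin m → ℝ) :
    IsLocalPerturbation N ⟨fun _ => κ, θ⟩ (fun _ => c) (fun _ => (0 : Fin m → Vec k)) c :=
  isLocalPerturbation_of_conc hA hκ tendsto_const_nhds ⟨0, fun _ _ => by simp⟩
    (Eventually.of_forall fun j i => by rw [perturb_zero_loc]; exact hθ i)

/-- Equal concentrations mean that `c_i` is proportional to the square root of the sampling ratio,
written without division. -/
lemma perturb_conc_eq_imp {N : Fin m → ℕ} {c : Fin m → ℝ} {t : Fin m → Vec k}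
    (h0 : 0 < (√(total N : ℝ))⁻¹) (h1 : ∀ i, 0 < √(ratio N i)) {i i' : Fin m}
    (h : (perturb N ⟨fun _ => κ, θ⟩ c t).conc i = (perturb N ⟨fun _ => κ, θ⟩ c t).conc i') :
    c i * √(ratio N i') = c i' * √(ratio N i) := by
  simp only [perturb, add_right_inj, mul_assoc] at h
  have h2 := mul_left_cancel₀ h0.ne' h
  have h3 := (h1 i).ne'
  have h4 := (h1 i').ne'
  field_simp at h2
  linarith

lemma tendsto_cross (hA : AssumptionA N r) {c : ℕ → Fin m → ℝ} {c' : Fin m → ℝ}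
    (hc : Tendsto c atTop (𝓝 c')) (i i' : Fin m) :
    Tendsto (fun j => c j i * √(ratio (N j) i') - c j i' * √(ratio (N j) i)) atTop
      (𝓝 (c' i * √(r i') - c' i' * √(r i))) := by
  have hr := fun i => (Real.continuous_sqrt.tendsto _).comp (hA.ratio_tendsto i)
  exact ((tendsto_pi_nhds.1 hc i).mul (hr i')).sub ((tendsto_pi_nhds.1 hc i').mul (hr i))

lemma eq_smul_of_cross (hm : 2 ≤ m) (hA : AssumptionA N r) {c : Fin m → ℝ}
    (h : ∀ i i', c i * √(r i') = c i' * √(r i)) :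
    ∃ l : ℝ, (WithLp.toLp 2 c : Vec m) = l • (WithLp.toLp 2 fun i => √(r i) : Vec m) := by
  set o : Fin m := ⟨0, by omega⟩
  have ho : √(r o) ≠ 0 := (Real.sqrt_pos.2 (hA.pos o)).ne'
  refine ⟨c o / √(r o), ?_⟩
  ext i
  simp only [PiLp.smul_apply, smul_eq_mul]
  rw [div_mul_eq_mul_div, eq_div_iff ho]
  exact h i o

/-- The limit of a local perturbation along the null hypothesis. -/
lemma IsLocalPerturbation.eq_smul_of_nullHyp (hm : 2 ≤ m) (hA : AssumptionA N r)
    {c : ℕ → Fin m → ℝ} {t : ℕ → Fin m → Vec k} {c' : Fin m → ℝ}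
    (h : IsLocalPerturbation N ⟨fun _ => κ, θ⟩ c t c')
    (h0 : ∀ᶠ j in atTop, perturb (N j) ⟨fun _ => κ, θ⟩ (c j) (t j) ∈ nullHyp m k) :
    ∃ l : ℝ, (WithLp.toLp 2 c' : Vec m) = l • (WithLp.toLp 2 fun i => √(r i) : Vec m) := by
  refine eq_smul_of_cross hm hA fun i i' => ?_
  have h1 : Tendsto (fun j => c j i * √(ratio (N j) i') - c j i' * √(ratio (N j) i)) atTop
      (𝓝 0) := by
    refine tendsto_const_nhds.congr' ?_
    filter_upwards [h0, hA.eventually_ratio_pos] with j hj1 hj2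
    exact (sub_eq_zero.2 (perturb_conc_eq_imp hj2.1 hj2.2 (hj1.2 i i'))).symm
  exact sub_eq_zero.1 (tendsto_nhds_unique (tendsto_cross hA h.tendsto i i') h1)

/-- A nonzero vector orthogonal to `√r` is not proportional to it, so two perturbed concentrations
eventually differ. -/
lemma eventually_perturb_mem_altHyp (hm : 2 ≤ m) (hA : AssumptionA N r) (hκ : 0 < κ)
    (hθ : ∀ i, ‖θ i‖ = 1) {c : Vec m}
    (hc : inner ℝ (WithLp.toLp 2 fun i => √(r i) : Vec m) c = (0 : ℝ)) (hc0 : c ≠ 0) :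
    ∀ᶠ j in atTop, perturb (N j) ⟨fun _ => κ, θ⟩ c 0 ∈ altHyp m k := by
  have h1 : ∃ i i', c i * √(r i') ≠ c i' * √(r i) := by
    by_contra hcon
    push Not at hcon
    obtain ⟨l, hl⟩ := eq_smul_of_cross hm hA hcon
    have hl' : c = l • (WithLp.toLp 2 fun i => √(r i) : Vec m) := hl
    rw [hl', inner_smul_right, real_inner_self_eq_norm_sq, hA.norm_sqrt] at hc
    rw [hl', show l = 0 by linarith, zero_smul] at hc0
    exact hc0 rfl
  obtain ⟨i, i', hii⟩ := h1
  have h2 := (tendsto_cross hA (tendsto_const_nhds (x := (c : Fin m → ℝ))) i i').eventually_ne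
    (sub_ne_zero.2 hii)
  filter_upwards [(isLocalPerturbation_const hA hκ hθ c).mem, h2, hA.eventually_ratio_pos]
    with j hj1 hj2 hj3
  exact ⟨hj1, i, i', fun h => hj2 (sub_eq_zero.2 (perturb_conc_eq_imp hj3.1 hj3.2 h))⟩

end Perturb

/-! ### Asymptotic levels and powers -/

lemma limsup_coe_le {f : ℕ → ℝ} {b : ℝ} (h : ∀ ε > 0, ∀ᶠ j in atTop, f j ≤ b + ε) :
    limsup (fun j => (f j : EReal)) atTop ≤ (b : EReal) := by
  by_contra hlt
  obtain ⟨y, hy1, hy2⟩ := EReal.lt_iff_exists_real_btwn.1 (not_le.1 hlt)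
  have hb : b < y := EReal.coe_lt_coe_iff.1 hy1
  refine absurd hy2 (not_lt.2 (limsup_le_of_le (by isBoundedDefault) ?_))
  filter_upwards [h (y - b) (by linarith)] with j hj
  exact EReal.coe_le_coe_iff.2 (by linarith)

lemma eventually_le_of_limsup_coe_le {f : ℕ → ℝ} {b : ℝ}
    (h : limsup (fun j => (f j : EReal)) atTop ≤ (b : EReal)) {ε : ℝ} (hε : 0 < ε) :
    ∀ᶠ j in atTop, f j ≤ b + ε := by
  have hlt : limsup (fun j => (f j : EReal)) atTop < ((b + ε : ℝ) : EReal) :=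
    h.trans_lt (EReal.coe_lt_coe_iff.2 (by linarith))
  filter_upwards [eventually_lt_of_limsup_lt hlt] with j hj
  exact (EReal.coe_lt_coe_iff.1 hj).le

lemma power_indicator [NeZero k] {N : ℕ → Fin m → ℕ} {S : (j : ℕ) → Set (Sample m k (N j))}
    (hS : ∀ j, MeasurableSet (S j)) (j : ℕ) (ϑ : Param m k) :
    power (fun j => (S j).indicator 1 : TestSeq m k N) j ϑ = (law (N j) ϑ).real (S j) :=
  integral_indicator_one (hS j)

/-! ### Asymptotic powers of the chi-square and one-sided linear tests -/

section Power

variable [NeZero k] {N : ℕ → Fin m → ℕ} {r : Fin m → ℝ} {κ : ℝ} {θ : Fin m → Vec k}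
  {c : ℕ → Fin m → ℝ} {t : ℕ → Fin m → Vec k} {c' : Fin m → ℝ}

/-- Replacing a local perturbation by its limit does not change the asymptotic powers. -/
lemma IsLocalPerturbation.tendsto_power_sub (h : IsLocalPerturbation N ⟨fun _ => κ, θ⟩ c t c')
    {ψ : TestSeq m k N} (hψ : ∀ j, Measurable (ψ j)) (hψ1 : ∀ j x, ψ j x ∈ Icc (0 : ℝ) 1) :
    Tendsto (fun j => power ψ j (perturb (N j) ⟨fun _ => κ, θ⟩ (c j) (t j)) -
      power ψ j (shiftConc (N j) κ (fun i => θ i + (√(N j i : ℝ))⁻¹ • t j i)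
        (WithLp.toLp 2 c'))) atTop (𝓝 0) :=
  tendsto_integral_sub_of_chiBound h.tendsto_chiBound hψ fun j x => by
    rw [abs_of_nonneg (hψ1 j x).1]
    exact (hψ1 j x).2

/-- Tests of the level class have asymptotic level `α` under the constant perturbations of the
concentrations by multiples of `√r`, whatever the perturbation of the locations. -/
lemma eventually_power_le_of_mem_levelClass (hA : AssumptionA N r) (hκ : 0 < κ)
    {B : Set (Param m k)} (hB : (⟨fun _ => κ, θ⟩ : Param m k) ∈ B) {α : ℝ} {ψ : TestSeq m k N}
    (hψ : ψ ∈ levelClass N B α) (h : IsLocalPerturbation N ⟨fun _ => κ, θ⟩ c t c') (l : ℝ)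
    {ε : ℝ} (hε : 0 < ε) :
    ∀ᶠ j in atTop, power ψ j (shiftConc (N j) κ (fun i => θ i + (√(N j i : ℝ))⁻¹ • t j i)
      (l • (WithLp.toLp 2 fun i => √(r i) : Vec m))) ≤ α + ε := by
  -- The finite-sample ratios, not their limits, keep the perturbed parameter exactly in the null
  -- hypothesis, where the level condition applies; `r` enters only in the limit.
  set c₀ : ℕ → Fin m → ℝ := fun j i => l * √(ratio (N j) i) with hc₀
  have hlim : Tendsto c₀ atTop (𝓝 fun i => l * √(r i)) := tendsto_pi_nhds.2 fun i =>
    ((Real.continuous_sqrt.tendsto _).comp (hA.ratio_tendsto i)).const_mul l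
  have hp : IsLocalPerturbation N ⟨fun _ => κ, θ⟩ c₀ t fun i => l * √(r i) := by
    refine isLocalPerturbation_of_conc hA hκ hlim h.bounded ?_
    filter_upwards [h.mem] with j hj i using (hj i).2
  have hnull : ∀ᶠ j in atTop, perturb (N j) ⟨fun _ => κ, θ⟩ (c₀ j) (t j) ∈ nullHyp m k := by
    filter_upwards [hp.mem, hA.eventually_ratio_pos] with j hj1 hj2
    have : ∀ i, (perturb (N j) ⟨fun _ => κ, θ⟩ (c₀ j) (t j)).conc i =
        κ + (√(total (N j) : ℝ))⁻¹ * l := by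
      intro i
      simp only [perturb, hc₀]
      have := (hj2.2 i).ne'
      field_simp
    exact ⟨hj1, fun i i' => by rw [this, this]⟩
  have h1 := eventually_le_of_limsup_coe_le (hψ.2.2 _ hB c₀ t _ hp hnull) (half_pos hε)
  have h2 := hp.tendsto_power_sub hψ.1 hψ.2.1
  have e : (WithLp.toLp 2 fun i => l * √(r i) : Vec m) =
      l • (WithLp.toLp 2 fun i => √(r i) : Vec m) := rfl
  rw [e] at h2
  filter_upwards [h1, h2.eventually_const_lt (neg_lt_zero.2 (half_pos hε))] with j hj1 hj2
  linarith

variable {θhat : (j : ℕ) → Sample m k (N j) → Fin m → Vec k}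

theorem tendstoInDistribution_QHom_noncentralChiSq (hm : 2 ≤ m) (hk : 2 ≤ k)
    (hA : AssumptionA N r) (hκ : 0 < κ) (hθ : ∀ i, ‖θ i‖ = 1)
    (hc : RootNConsistent N θhat ⟨fun _ => κ, θ⟩)
    (hp : IsLocalPerturbation N ⟨fun _ => κ, θ⟩ c t c') :
    TendstoInDistribution (fun j x => QHom (θhat j x) x) atTop (id : ℝ → ℝ)
      (fun j => law (N j) (perturb (N j) ⟨fun _ => κ, θ⟩ (c j) (t j)))
      (noncentralChiSq (m - 1) (D k κ * (∑ i, c' i ^ 2 - (∑ i, √(r i) * c' i) ^ 2))) := by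
  have h := tendstoInDistribution_QHom hk hA hκ hθ hc hp
  refine ⟨h.forall_aemeasurable, aemeasurable_id, ?_⟩
  refine h.tendsto.trans_eq (congrArg 𝓝 (Subtype.ext ?_))
  refine Eq.trans ?_ Measure.map_id.symm
  exact map_stdGaussian_noncentralChiSq hm hA (D_pos hk hκ.ne').le c'

lemma tendsto_power_testHom (hm : 2 ≤ m) (hk : 2 ≤ k) (hA : AssumptionA N r) (hκ : 0 < κ)
    (hθ : ∀ i, ‖θ i‖ = 1) (hc : RootNConsistent N θhat ⟨fun _ => κ, θ⟩)
    (hp : IsLocalPerturbation N ⟨fun _ => κ, θ⟩ c t c') (α : ℝ) :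
    Tendsto (fun j => power (testHom θhat α) j (perturb (N j) ⟨fun _ => κ, θ⟩ (c j) (t j))) atTop
      (𝓝 ((noncentralChiSq (m - 1) (D k κ * (∑ i, c' i ^ 2 - (∑ i, √(r i) * c' i) ^ 2))).real
        (Ioi (chiSqUpperQuantile (m - 1) α)))) := by
  have hm1 : ∀ j, Measurable fun x : Sample m k (N j) => QHom (θhat j x) x :=
    fun j => measurable_QHom hk (hc.measurable j)
  have hμ := map_stdGaussian_noncentralChiSq hm hA (D_pos hk hκ.ne').le c'
  obtain ⟨n, rfl⟩ : ∃ n, m = n + 2 := ⟨m - 2, by omega⟩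
  have h := tendsto_measureReal_Ioi_of_tendstoInDistribution hm1
    (tendstoInDistribution_QHom hk hA hκ hθ hc hp) hμ (noncentralChiSq_singleton n _)
    (chiSqUpperQuantile (n + 2 - 1) α)
  exact h.congr fun j => (power_indicator (fun j => measurableSet_lt measurable_const (hm1 j)) j
    _).symm

/-- The one-sided test based on the linear statistic in the direction `u`. -/
def testLin (θhat : (j : ℕ) → Sample m k (N j) → Fin m → Vec k) (u : Vec m) (q : ℝ) :
    TestSeq m k N :=
  fun j => indicator {x | q < linStat u (θhat j x) x} 1

lemma tendsto_power_testLin (hk : 2 ≤ k) (hA : AssumptionA N r) (hκ : 0 < κ)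
    (hθ : ∀ i, ‖θ i‖ = 1) (hc : RootNConsistent N θhat ⟨fun _ => κ, θ⟩)
    (hp : IsLocalPerturbation N ⟨fun _ => κ, θ⟩ c t c') {u : Vec m} (hu1 : ‖u‖ = 1)
    (hu : inner ℝ u (WithLp.toLp 2 fun i => √(r i) : Vec m) = 0) (q : ℝ) :
    Tendsto (fun j => power (testLin θhat u q) j (perturb (N j) ⟨fun _ => κ, θ⟩ (c j) (t j))) atTop
      (𝓝 ((gaussianReal (√(D k κ) * inner ℝ u (WithLp.toLp 2 c' : Vec m)) 1).real (Ioi q))) := by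
  have hm1 : ∀ j, Measurable fun x : Sample m k (N j) => linStat u (θhat j x) x :=
    fun j => measurable_linStat hk (hc.measurable j) u
  have hμ := map_stdGaussian_inner hu1 (√(D k κ) • (WithLp.toLp 2 c' : Vec m))
  rw [inner_smul_right] at hμ
  have h := tendsto_measureReal_Ioi_of_tendstoInDistribution hm1
    (tendstoInDistribution_linStat hk hA hκ hθ hc hp hu) hμ (gaussianReal_singleton _) q
  exact h.congr fun j => (power_indicator (fun j => measurableSet_lt measurable_const (hm1 j)) j
    _).symm

lemma indicator_one_mem_Icc {Ω : Type*} (S : Set Ω) (x : Ω) :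
    S.indicator (1 : Ω → ℝ) x ∈ Icc (0 : ℝ) 1 := by
  by_cases hx : x ∈ S <;> simp [hx]

end Power

/-- The regret of a test in the class is nonnegative. -/
lemma regret_nonneg {N : ℕ → Fin m → ℕ} {B : Set (Param m k)} {α : ℝ} {ψ : TestSeq m k N} (hψ : ψ ∈ levelClass N B α) (a : LocalSeq m k) :
    0 ≤ regret N B α ψ a := by
  refine le_trans ?_ (le_iSup₂ (f := fun ψ' (_ : ψ' ∈ levelClass N B α) =>
    limsup (fun j => ((power ψ' j (a.param N j) - power ψ j (a.param N j) : ℝ) : EReal)) atTop)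
    ψ hψ)
  simp

/-! ### Level of the two tests, and comparison of the maximal regrets -/

section Stringency

variable [NeZero k] {N : ℕ → Fin m → ℕ} {r : Fin m → ℝ} {B : Set (Param m k)} {α : ℝ}
  {θhat : (j : ℕ) → Sample m k (N j) → Fin m → Vec k}

lemma limsup_coe_le_of_tendsto {f : ℕ → ℝ} {b : ℝ} (h : Tendsto f atTop (𝓝 b)) :
    limsup (fun j => (f j : EReal)) atTop ≤ (b : EReal) :=
  limsup_coe_le fun _ hε =>
    (h.eventually_lt_const (lt_add_of_pos_right b hε)).mono fun _ hj => hj.le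

lemma chiSq_quantile (hm : 2 ≤ m) (h0 : 0 < α) (h1 : α < 1) :
    (chiSq (m - 1)).real (Ioi (chiSqUpperQuantile (m - 1) α)) = α := by
  obtain ⟨n, rfl⟩ : ∃ n, m = n + 2 := ⟨m - 2, by omega⟩
  exact chiSqUpperQuantile_spec n h0 h1

/-- Null perturbations have limits proportional to the unit vector `√r`, for which the noncentrality
vanishes. -/
theorem testHom_mem_levelClass (hm : 2 ≤ m) (hk : 2 ≤ k) (hA : AssumptionA N r)
    (hB : B ⊆ nullHyp m k) (hc : ∀ ϑ ∈ nullHyp m k, RootNConsistent N θhat ϑ)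
    (h0 : 0 < α) (h1 : α < 1) (hne : ∀ j i, Measurable fun x => θhat j x i) :
    testHom θhat α ∈ levelClass N B α := by
  refine ⟨fun j => measurable_one.indicator (measurableSet_lt measurable_const
    (measurable_QHom hk (hne j))), fun j x => indicator_one_mem_Icc _ x, ?_⟩
  intro ϑ hϑ c t c' hp hnull
  have hcϑ := hc ϑ (hB hϑ)
  obtain ⟨κ, θ, hκ, hθ, rfl⟩ := exists_eq_of_mem_nullHyp hm (hB hϑ)
  have h := tendsto_power_testHom hm hk hA hκ hθ hcϑ hp α
  obtain ⟨l, hl⟩ := hp.eq_smul_of_nullHyp hm hA hnull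
  rw [← noncentrality_eq, hl, norm_smul, inner_smul_right, real_inner_self_eq_norm_sq,
    hA.norm_sqrt, mul_one, Real.norm_eq_abs, sq_abs, one_pow, mul_one, sub_self, mul_zero,
    chiSq_quantile hm h0 h1] at h
  exact limsup_coe_le_of_tendsto h

/-- The direction `u` is orthogonal to `√r`, so null perturbations produce no drift. This is what
makes the envelope power attainable within the class. -/
theorem testLin_mem_levelClass (hm : 2 ≤ m) (hk : 2 ≤ k) (hA : AssumptionA N r)
    (hB : B ⊆ nullHyp m k) (hc : ∀ ϑ ∈ nullHyp m k, RootNConsistent N θhat ϑ)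
    {u : Vec m} (hu1 : ‖u‖ = 1) (hu : inner ℝ u (WithLp.toLp 2 fun i => √(r i) : Vec m) = 0)
    {q : ℝ} (hq : (gaussianReal 0 1).real (Ioi q) = α) (hne : ∀ j i, Measurable fun x => θhat j x i) :
    testLin θhat u q ∈ levelClass N B α := by
  refine ⟨fun j => measurable_one.indicator (measurableSet_lt measurable_const
    (measurable_linStat hk (hne j) u)), fun j x => indicator_one_mem_Icc _ x, ?_⟩
  intro ϑ hϑ c t c' hp hnull
  have hcϑ := hc ϑ (hB hϑ)
  obtain ⟨κ, θ, hκ, hθ, rfl⟩ := exists_eq_of_mem_nullHyp hm (hB hϑ)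
  have h := tendsto_power_testLin hk hA hκ hθ hcϑ hp hu1 hu q
  obtain ⟨l, hl⟩ := hp.eq_smul_of_nullHyp hm hA hnull
  rw [hl, inner_smul_right, hu, mul_zero, mul_zero, hq] at h
  exact limsup_coe_le_of_tendsto h

/-- The regret of the chi-square test along given local alternatives is bounded by the maximal
regret of every other test. -/
theorem regret_testHom_le (hm : 2 ≤ m) (hk : 2 ≤ k) (hA : AssumptionA N r)
    (hB : B ⊆ nullHyp m k) (hc : ∀ ϑ ∈ nullHyp m k, RootNConsistent N θhat ϑ)
    (h0 : 0 < α) (h1 : α < 1) {ψ : TestSeq m k N} (hψ : ψ ∈ levelClass N B α)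
    {a : LocalSeq m k} (ha : a ∈ localAlternatives N B) :
    regret N B α (testHom θhat α) a ≤ ⨆ a ∈ localAlternatives N B, regret N B α ψ a := by
  obtain ⟨base, c, t⟩ := a
  obtain ⟨hbase, ⟨c', hp⟩, halt⟩ := ha
  simp only at hbase hp
  have hcb := hc base (hB hbase)
  obtain ⟨κ, θ, hκ, hθ, rfl⟩ := exists_eq_of_mem_nullHyp hm (hB hbase)
  have hN := hA.tendsto_size
  have hD := D_pos hk hκ.ne'
  set s : Vec m := WithLp.toLp 2 fun i => √(r i) with hs
  have hs1 : ‖s‖ = 1 := hA.norm_sqrt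
  have hss : inner ℝ s s = (1 : ℝ) := by rw [real_inner_self_eq_norm_sq, hs1]; norm_num
  set v : Vec m := WithLp.toLp 2 c' with hv
  set l : ℝ := inner ℝ s v with hl
  set p : Vec m := v - l • s with hpdef
  have hsp : inner ℝ s p = (0 : ℝ) := by
    rw [hpdef, inner_sub_right, inner_smul_right, hss]
    ring
  have hvp : v = l • s + p := by rw [hpdef]; abel
  have hpn : ‖p‖ ^ 2 = ‖v‖ ^ 2 - l ^ 2 := by
    have : ‖v‖ ^ 2 = l ^ 2 + ‖p‖ ^ 2 := by
      nth_rw 1 [hvp]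
      rw [norm_add_sq_real, inner_smul_left, hsp, norm_smul, hs1, Real.norm_eq_abs, mul_one,
        sq_abs]
      ring
    linarith
  set θ' : ℕ → Fin m → Vec k := fun j i => θ i + (√(N j i : ℝ))⁻¹ • t j i with hθ'
  have hunit : ∀ᶠ j in atTop, ∀ i, ‖θ' j i‖ = 1 := hp.eventually_norm_eq_one
  have hφ := tendsto_power_testHom hm hk hA hκ hθ hcb hp α
  rw [← noncentrality_eq, ← hs, ← hv, ← hl, ← hpn] at hφ
  set δ := D k κ * ‖p‖ ^ 2 with hδ
  set q := chiSqUpperQuantile (m - 1) α with hq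
  set β := (noncentralChiSq (m - 1) δ).real (Ioi q) with hβ
  have hqα : (chiSq (m - 1)).real (Ioi q) = α := chiSq_quantile hm h0 h1
  -- an upper bound for the regret in terms of an upper bound for the power
  have hreg : ∀ e : ℝ, (∀ ψ' ∈ levelClass N B α, ∀ ε > 0, ∀ᶠ j in atTop,
      power ψ' j (shiftConc (N j) κ (θ' j) v) ≤ e + ε) →
      regret N B α (testHom θhat α) ⟨⟨fun _ => κ, θ⟩, c, t⟩ ≤ ((e - β : ℝ) : EReal) := by
    intro e he
    refine iSup₂_le fun ψ' hψ' => limsup_coe_le fun ε hε => ?_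
    have h2 := hp.tendsto_power_sub hψ'.1 hψ'.2.1
    filter_upwards [he ψ' hψ' (ε / 3) (by positivity),
      h2.eventually_lt_const (show 0 < ε / 3 by positivity),
      hφ.eventually_const_lt (sub_lt_self β (show 0 < ε / 3 by positivity))] with j hj1 hj2 hj3
    simp only [LocalSeq.param]
    linarith
  -- Alternatives may approach the null hypothesis to first order. No test of the class then has
  -- asymptotic power above `α`, which the chi-square test attains, so its regret is at most zero.
  by_cases hp0 : p = 0
  · have hδ0 : δ = 0 := by rw [hδ, hp0]; simp
    have hβα : β = α := by rw [hβ, hδ0]; exact hqα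
    have h3 := hreg α fun ψ' hψ' ε hε => by
      have := eventually_power_le_of_mem_levelClass hA hκ hbase hψ' hp l hε
      rw [hvp, hp0, add_zero]
      exact this
    rw [hβα, sub_self, EReal.coe_zero] at h3
    refine h3.trans ((regret_nonneg hψ ⟨⟨fun _ => κ, θ⟩, c, t⟩).trans ?_)
    exact le_iSup₂ (f := fun a (_ : a ∈ localAlternatives N B) => regret N B α ψ a)
      (⟨⟨fun _ => κ, θ⟩, c, t⟩ : LocalSeq m k) ⟨hbase, ⟨c', hp⟩, halt⟩
  · have hpp : 0 < ‖p‖ := norm_pos_iff.2 hp0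
    have hδ0 : 0 < δ := by positivity
    have hsδ : √(D k κ) * ‖p‖ = √δ := by
      rw [hδ, Real.sqrt_mul hD.le, Real.sqrt_sq hpp.le]
    obtain ⟨z, hz⟩ := exists_measureReal_Ioi_eq (gaussianReal_singleton 0) h0 h1
    set E := (gaussianReal √δ 1).real (Ioi z) with hE
    have h3 := hreg E fun ψ' hψ' ε hε => by
      have hu1 : ‖‖p‖⁻¹ • p‖ = 1 := by
        rw [norm_smul, norm_inv, norm_norm, inv_mul_cancel₀ hpp.ne']
      have hus : inner ℝ (‖p‖⁻¹ • p) (l • s) = (0 : ℝ) := by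
        rw [inner_smul_left, inner_smul_right, real_inner_comm s p, hsp]
        simp
      -- The null competitor is the component `l s` along the null direction, at the same moving
      -- locations as the alternative; this gives the signal `√D_k ‖p‖ = √δ`.
      have := eventually_power_le_envelope hk hN hκ hunit hψ'.1 hψ'.2.1 hu1 hus hpp (q := z)
        (fun ε hε => by
          rw [hz]
          exact eventually_power_le_of_mem_levelClass hA hκ hbase hψ' hp l hε) hε
      rw [smul_smul, mul_inv_cancel₀ hpp.ne', one_smul, hsδ, ← hvp] at this
      exact this
    refine h3.trans ?_
    by_contra hlt
    obtain ⟨y, hy1, hy2⟩ := EReal.lt_iff_exists_real_btwn.1 (not_le.1 hlt)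
    have hyE : y < E - β := EReal.coe_lt_coe_iff.1 hy2
    set ε := (E - β - y) / 2 with hε
    have hε0 : 0 < ε := by rw [hε]; linarith
    have hlev : ∀ ε > 0, ∀ᶠ j in atTop, power ψ j (shiftConc (N j) κ θ 0) ≤
        (chiSq (m - 1)).real (Ioi q) + ε := by
      intro ε hε
      have h4 := eventually_power_le_of_mem_levelClass hA hκ hbase hψ
        (isLocalPerturbation_const hA hκ hθ (0 : Fin m → ℝ)) 0 hε
      simp only [zero_smul, Pi.zero_apply, smul_zero, add_zero] at h4
      rw [hqα]
      exact h4
    -- The unfavourable direction depends on `ψ`, but it has the same base point and the same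
    -- noncentrality `δ` as the given alternative, so the same `E` and `β` occur.
    obtain ⟨w, hsw, hwδ, hfreq⟩ := exists_frequently_power_le hm hk hN hκ hθ hψ.1 hψ.2.1 hs1
      hlev hδ0 hε0
    have hw0 : w ≠ 0 := by
      rintro rfl
      rw [norm_zero, zero_pow two_ne_zero, mul_zero] at hwδ
      exact hδ0.ne hwδ
    have hwp : 0 < ‖w‖ := norm_pos_iff.2 hw0
    have hu1 : ‖‖w‖⁻¹ • w‖ = 1 := by
      rw [norm_smul, norm_inv, norm_norm, inv_mul_cancel₀ hwp.ne']
    have hus : inner ℝ (‖w‖⁻¹ • w) s = (0 : ℝ) := by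
      rw [inner_smul_left, real_inner_comm s w, hsw, mul_zero]
    have hlin := testLin_mem_levelClass hm hk hA hB hc hu1 hus hz hcb.measurable
    set a' : LocalSeq m k := ⟨⟨fun _ => κ, θ⟩, fun _ => w, fun _ => 0⟩ with ha'
    have hpw := isLocalPerturbation_const hA hκ hθ (w : Fin m → ℝ)
    have ha'm : a' ∈ localAlternatives N B :=
      ⟨hbase, ⟨w, hpw⟩, eventually_perturb_mem_altHyp hm hA hκ hθ hsw hw0⟩
    have hpow := tendsto_power_testLin hk hA hκ hθ hcb hpw hu1 hus z
    have hmean : √(D k κ) * inner ℝ (‖w‖⁻¹ • w) (WithLp.toLp 2 (w : Fin m → ℝ) : Vec m) = √δ := by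
      have : (WithLp.toLp 2 (w : Fin m → ℝ) : Vec m) = w := rfl
      rw [this, inner_smul_left, real_inner_self_eq_norm_sq, ← hwδ, Real.sqrt_mul hD.le,
        Real.sqrt_sq hwp.le]
      simp only [conj_trivial]
      field_simp
    rw [hmean, ← hE] at hpow
    -- The linear test in the direction of `w` reaches `E`, while `ψ` stays below `β + ε` infinitely
    -- often. That is enough for a lower bound on a limsup, with gap `E - β - 2ε = y`.
    have hy3 : (y : EReal) ≤ regret N B α ψ a' := by
      refine le_trans ?_ (le_iSup₂ (f := fun ψ' (_ : ψ' ∈ levelClass N B α) =>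
        limsup (fun j => ((power ψ' j (a'.param N j) - power ψ j (a'.param N j) : ℝ) : EReal))
          atTop) _ hlin)
      refine le_limsup_of_frequently_le ?_ (by isBoundedDefault)
      refine (hfreq.and_eventually (hpow.eventually_const_lt (sub_lt_self E hε0))).mono ?_
      rintro j ⟨hj1, hj2⟩
      refine EReal.coe_le_coe_iff.2 ?_
      have e1 : a'.param N j = shiftConc (N j) κ θ w := perturb_zero_loc (N j) κ θ w
      have e2 : perturb (N j) ⟨fun _ => κ, θ⟩ w 0 = shiftConc (N j) κ θ w :=
        perturb_zero_loc (N j) κ θ w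
      rw [e2] at hj2
      rw [e1]
      linarith
    have hy4 : regret N B α ψ a' ≤ ⨆ a ∈ localAlternatives N B, regret N B α ψ a :=
      le_iSup₂ (f := fun a (_ : a ∈ localAlternatives N B) => regret N B α ψ a) a' ha'm
    exact absurd hy1 (not_lt.2 (hy3.trans hy4))

theorem isMostStringent_testHom (hm : 2 ≤ m) (hk : 2 ≤ k) (hA : AssumptionA N r)
    (hB : B ⊆ nullHyp m k) (hc : ∀ ϑ ∈ nullHyp m k, RootNConsistent N θhat ϑ)
    (h0 : 0 < α) (h1 : α < 1) (hne : ∀ j i, Measurable fun x => θhat j x i) :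
    IsMostStringent N B α (testHom θhat α) :=
  ⟨testHom_mem_levelClass hm hk hA hB hc h0 h1 hne, fun _ hψ => iSup₂_le fun _ ha =>
    regret_testHom_le hm hk hA hB hc h0 h1 hψ ha⟩

end Stringency

end FvML

end

/-! ### The main theorem -/

theorem mainTheorem1 (m k : ℕ) [NeZero k] (hm : 2 ≤ m) (hk : 2 ≤ k)
    (N : ℕ → Fin m → ℕ) (r : Fin m → ℝ) (hA : FvML.AssumptionA N r) :
    (∀ ϑ ∈ FvML.paramSpace m k,
      FvML.RootNConsistent N (fun _ x => FvML.sphericalMean x) ϑ) ∧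
    ∀ θhat : (j : ℕ) → FvML.Sample m k (N j) → Fin m → FvML.Vec k,
      (∀ ϑ ∈ FvML.nullHyp m k, FvML.RootNConsistent N θhat ϑ) →
      (∀ ϑ ∈ FvML.nullHyp m k,
        TendstoInDistribution (fun j x => FvML.QHom (θhat j x) x) atTop (id : ℝ → ℝ)
          (fun j => FvML.law (N j) ϑ) (FvML.chiSq (m - 1))) ∧
      (∀ (κ : ℝ) (θ : Fin m → FvML.Vec k), 0 < κ → (∀ i, ‖θ i‖ = 1) →
        ∀ (c : ℕ → Fin m → ℝ) (t : ℕ → Fin m → FvML.Vec k) (c' : Fin m → ℝ),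
          FvML.IsLocalPerturbation N ⟨fun _ => κ, θ⟩ c t c' →
          TendstoInDistribution (fun j x => FvML.QHom (θhat j x) x) atTop (id : ℝ → ℝ)
            (fun j => FvML.law (N j) (FvML.perturb (N j) ⟨fun _ => κ, θ⟩ (c j) (t j)))
            (FvML.noncentralChiSq (m - 1)
              (FvML.D k κ * (∑ i, c' i ^ 2 - (∑ i, √(r i) * c' i) ^ 2)))) ∧
      (∀ α : ℝ, 0 < α → α < 1 →
        (∀ ϑ ∈ FvML.nullHyp m k,
          Tendsto (fun j => FvML.power (FvML.testHom θhat α) j ϑ) atTop (𝓝 α)) ∧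
        ∀ B : Set (FvML.Param m k), B ⊆ FvML.nullHyp m k →
          FvML.IsMostStringent N B α (FvML.testHom θhat α)) := by
  refine ⟨fun ϑ hϑ => FvML.rootNConsistent_sphericalMean hk hA.tendsto_size hϑ,
    fun θhat hc => ?_⟩
  -- Measurability of the estimators does not involve the parameter, so it is read off at one null
  -- point; this also serves when `B` is empty.
  have hne : ∀ j i, Measurable fun x => θhat j x i := by
    obtain ⟨e, he⟩ := FvML.exists_norm_eq_one hk
    exact (hc ⟨fun _ => 1, fun _ => e⟩ ⟨fun _ => ⟨one_pos, he⟩, fun _ _ => rfl⟩).measurable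
  have hii : ∀ (κ : ℝ) (θ : Fin m → FvML.Vec k), 0 < κ → (∀ i, ‖θ i‖ = 1) →
      ∀ (c : ℕ → Fin m → ℝ) (t : ℕ → Fin m → FvML.Vec k) (c' : Fin m → ℝ),
        FvML.IsLocalPerturbation N ⟨fun _ => κ, θ⟩ c t c' →
        TendstoInDistribution (fun j x => FvML.QHom (θhat j x) x) atTop (id : ℝ → ℝ)
          (fun j => FvML.law (N j) (FvML.perturb (N j) ⟨fun _ => κ, θ⟩ (c j) (t j)))
          (FvML.noncentralChiSq (m - 1)
            (FvML.D k κ * (∑ i, c' i ^ 2 - (∑ i, √(r i) * c' i) ^ 2))) :=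
    fun κ θ hκ hθ c t c' hp => FvML.tendstoInDistribution_QHom_noncentralChiSq hm hk hA hκ hθ
      (hc _ ⟨fun i => ⟨hκ, hθ i⟩, fun _ _ => rfl⟩) hp
  refine ⟨fun ϑ hϑ => ?_, hii, fun α h0 h1 => ⟨fun ϑ hϑ => ?_, fun B hB =>
    FvML.isMostStringent_testHom hm hk hA hB hc h0 h1 hne⟩⟩
  · obtain ⟨κ, θ, hκ, hθ, rfl⟩ := FvML.exists_eq_of_mem_nullHyp hm hϑ
    -- The null limit is the zero perturbation of the local result.
    have h := hii κ θ hκ hθ _ _ _ (FvML.isLocalPerturbation_const hA hκ hθ 0)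
    simpa [FvML.perturb] using h
  · have hcϑ := hc ϑ hϑ
    obtain ⟨κ, θ, hκ, hθ, rfl⟩ := FvML.exists_eq_of_mem_nullHyp hm hϑ
    have h := FvML.tendsto_power_testHom hm hk hA hκ hθ hcϑ
      (FvML.isLocalPerturbation_const hA hκ hθ 0) α
    simpa [FvML.perturb, FvML.chiSq_quantile hm h0 h1] using h
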